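/- **Setting.** A weight on $\mathbb R$ is a function $w\ge 0$ with $\int |x|^k w(x)\,dx<\infty$ for all $k\ge 0$. Let $\vec w_1=(w_{1,1},\dots,w_{1,p})$ and $\vec w_2=(w_{2,1},\dots,w_{2,q})$ be vectors of weights, let $\vec n=(n_1,\dots,n_p)$ and $\vec m=(m_1,\dots,m_q)$ be multi-indices of positive integers, $|\vec n|=\sum_k n_k$, $|\vec m|=\sum_l m_l$, and let $\vec e_k$ be the $k$th standard basis vector. Put $W=\vec w_1^{\,t}\vec w_2=(w_{1,k}w_{2,l})_{k,l}$. Assume $x^jw_{1,k}\in L^2(\mathbb R)$ for $0\le j\le n_k-1$, $x^jw_{2,l}\in L^2(\mathbb R)$ for $0\le j\le m_l-1$, and $x^{n_k+m_l}w_{1,k}w_{2,l}\in L^1(\mathbb R)$ for all $k,l$. Let $$F_{\vec n}=\Big\{\sum_{j=1}^p A_jw_{1,j} : A_j\in\mathbb C[x],\ \deg A_j\le n_j-1\Big\},\qquad G_{\vec m}=\Big\{\sum_{j=1}^q B_jw_{2,j} : B_j\in\mathbb C[x],\ \deg B_j\le m_j-1\Big\}\subset L^2(\mathbb R).$$ For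 multi-indices $\vec a$ (of length $p$) and $\vec b$ (of length $q$) with $|\vec a|=|\vec b|+1$, multiple orthogonal polynomials of mixed type for $(\vec a,\vec b)$ are polynomials $A_1,\dots,A_p$ with $\deg A_j\le a_j-1$ ($A_j=0$ if $a_j=0$) such that $Q=\sum_j A_jw_{1,j}$ satisfies $\int Q(x)x^jw_{2,l}(x)\,dx=0$ for $0\le j\le b_l-1$, $1\le l\le q$. The pair $(\vec a,\vec b)$ is normal if these are unique up to a multiplicative constant (a nonzero solution always exists). One writes $A^{(I,k)}_{j,\vec a,\vec b}$, $Q^{(I,k)}_{\vec a,\vec b}$ under the normalization $\int Q(x)x^{b_k}w_{2,k}(x)\,dx=1$, and $A^{(II,k)}_{j,\vec a,\vec b}$, $Q^{(II,k)}_{\vec a,\vec b}$ under the normalization that $A_k$ is monic of degree $a_k-1$. **Riemann–Hilbert problem.** Find $Y:\mathbb C\setminus\mathbb R\to\mathbb C^{(p+q)\times(p+q)}$ such that 1. $Y$ is analytic on $\mathbb C\setminus\mathbb R$; 2. $Y_+(x)=Y_-(x)J(x)$ on $\mathbb R$, where $J(x)=\begin{bmatrix} I_p& W(x)\\ 0&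 I_q\end{bmatrix}$; 3. $Y(z)=\big(I_{p+q}+O(1/z)\big)\,\mathrm{diag}(z^{n_1},\dots,z^{n_p},z^{-m_1},\dots,z^{-m_q})$ as $z\to\infty$. For general weights, (2) and (3) are understood as follows. (2): for almost every $x$ the limits $Y_\pm(x)=\lim_{\varepsilon\downarrow0}Y(x\pm i\varepsilon)$ exist and $Y_+(x)=Y_-(x)J(x)$, and moreover $Y(\cdot+i\varepsilon)-Y(\cdot-i\varepsilon)J\to0$ in $L^1_{\rm loc}(\mathbb R)$ as $\varepsilon\downarrow0$. (3): the error term is $O(1/z)$ in each cone $\{|\mathrm{Im}\,z|\ge\delta|z|\}$, $\delta>0$, and is $O(1/|\mathrm{Im}\,z|)$ as $z\to\infty$ in $\mathbb C\setminus\mathbb R$. In the classical sense, (2) means that $Y$ has limits $Y_\pm(x)$ at every $x\in\mathbb R$ from the upper and lower half plane with $Y_+(x)=Y_-(x)J(x)$, and in (3) the error term is $O(1/z)$ as $z\to\infty$ in $\mathbb C\setminus\mathbb R$. **Theorem 3.1.** Suppose that $|\vec n|=|\vec m|$, that $\dim F_{\vec n}=|\vec n|$, and that $F_{\vec n}\cap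 G_{\vec m}^\perp=\{0\}$. Then the pairs $(\vec n+\vec e_k,\vec m)$ for $1\le k\le p$ and $(\vec n,\vec m-\vec e_k)$ for $1\le k\le q$ are normal, the polynomials $A^{(II,k)}_{l,\vec n+\vec e_k,\vec m}$ and $A^{(I,k)}_{l,\vec n,\vec m-\vec e_k}$ exist and are unique, and the Riemann–Hilbert problem has a unique solution $Y$, given for $z\in\mathbb C\setminus\mathbb R$ by $$\begin{aligned} Y_{k,l}(z)&=A^{(II,k)}_{l,\vec n+\vec e_k,\vec m}(z), && 1\le k,l\le p,\\ Y_{p+k,l}(z)&=-2\pi i\,A^{(I,k)}_{l,\vec n,\vec m-\vec e_k}(z), && 1\le k\le q,\ 1\le l\le p,\\ Y_{k,p+l}(z)&=\frac1{2\pi i}\int\frac{Q^{(II,k)}_{\vec n+\vec e_k,\vec m}(x)\,w_{2,l}(x)}{x-z}\,dx, && 1\le k\le p,\ 1\le l\le q,\\ Y_{p+k,p+l}(z)&=-\int\frac{Q^{(I,k)}_{\vec n,\vec m-\vec e_k}(x)\,w_{2,l}(x)}{x-z}\,dx, && 1\le k,l\le q. \end{aligned}$$ If in addition the functions $x^jw_{1,k}(x)w_{2,l}(x)$,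 $0\le j\le n_k+m_l+1$, are integrable and (globally) Hölder continuous on $\mathbb R$ for all $k,l$, then the same $Y$ is also the unique solution of the Riemann–Hilbert problem in the classical sense. -/

import Mathlib

open MeasureTheory Filter Topology
open scoped Polynomial NNReal ENNReal

/-- A weight on the real line: a nonnegative function all of whose moments are finite. -/
structure IsWeight (w : ℝ → ℝ) : Prop where
  nonneg : ∀ x, 0 ≤ w x
  moments : ∀ k : ℕ, Integrable (fun x : ℝ => x ^ k * w x)

/-- The linear form `∑ j, A j * w j` on the real line. -/
noncomputable def linForm {p : ℕ} (w : Fin p → ℝ → ℝ) (A : Fin p → ℂ[X]) (x : ℝ) : ℂ :=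
  ∑ j, (A j).eval (x : ℂ) * (w j x : ℂ)

/-- The space of all linear forms `∑ j, A j * w j` with `deg (A j) ≤ n j - 1`,
as a subspace of `L²(ℝ)`. For the first vector of weights it is `F_n`, for the second `G_m`. -/
noncomputable def formSpace {p : ℕ} (w : Fin p → ℝ → ℝ) (n : Fin p → ℕ) :
    Submodule ℂ (Lp ℂ 2 (volume : Measure ℝ)) where
  carrier := {f | ∃ A : Fin p → ℂ[X], (∀ j, (A j).degree < (n j : WithBot ℕ)) ∧
    (f : ℝ → ℂ) =ᵐ[volume] linForm w A}
  zero_mem' := by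
    refine ⟨fun _ => 0, fun j => by simp [bot_lt_iff_ne_bot], ?_⟩
    filter_upwards [Lp.coeFn_zero ℂ 2 (volume : Measure ℝ)] with x hx
    rw [hx]
    simp [linForm]
  add_mem' := by
    rintro f g ⟨A, hA, hf⟩ ⟨B, hB, hg⟩
    refine ⟨fun j => A j + B j, fun j => ?_, ?_⟩
    · exact lt_of_le_of_lt (Polynomial.degree_add_le _ _) (max_lt (hA j) (hB j))
    · filter_upwards [Lp.coeFn_add f g, hf, hg] with x hx h1 h2
      rw [hx, Pi.add_apply, h1, h2]
      simp [linForm, add_mul, Finset.sum_add_distrib]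
  smul_mem' := by
    rintro c f ⟨A, hA, hf⟩
    refine ⟨fun j => c • A j, fun j => ?_, ?_⟩
    · exact lt_of_le_of_lt (Polynomial.degree_smul_le _ _) (hA j)
    · filter_upwards [Lp.coeFn_smul c f, hf] with x hx h1
      rw [hx, Pi.smul_apply, h1]
      simp [linForm, Finset.mul_sum, mul_assoc]

/-- `A` is a vector of multiple orthogonal polynomials of mixed type for the pair `(n, m)`
with respect to the weights `w₁`, `w₂`. The condition `degree < n j` means `deg ≤ n j - 1`
(and `A j = 0` if `n j = 0`). -/
structure IsMixedMOP {p q : ℕ} (w₁ : Fin p → ℝ → ℝ) (w₂ : Fin q → ℝ → ℝ)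
    (n : Fin p → ℕ) (m : Fin q → ℕ) (A : Fin p → ℂ[X]) : Prop where
  deg : ∀ j, (A j).degree < (n j : WithBot ℕ)
  orth : ∀ k, ∀ j < m k, ∫ x : ℝ, linForm w₁ A x * (x : ℂ) ^ j * (w₂ k x : ℂ) = 0

/-- `(n, m)` is a normal pair: `|n| = |m| + 1` and the multiple orthogonal polynomials of mixed
type are nonzero and unique up to a multiplicative constant. -/
def IsNormalPair {p q : ℕ} (w₁ : Fin p → ℝ → ℝ) (w₂ : Fin q → ℝ → ℝ)
    (n : Fin p → ℕ) (m : Fin q → ℕ) : Prop :=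
  ∑ j, n j = ∑ k, m k + 1 ∧
    ∃ A, A ≠ 0 ∧ IsMixedMOP w₁ w₂ n m A ∧ ∀ B, IsMixedMOP w₁ w₂ n m B → ∃ c : ℂ, B = c • A

/-- `A = A^{(I,k)}_{n,m}`: the type I normalization `∫ Q x^{m_k} w_{2,k} dx = 1`. -/
def IsTypeI {p q : ℕ} (w₁ : Fin p → ℝ → ℝ) (w₂ : Fin q → ℝ → ℝ)
    (n : Fin p → ℕ) (m : Fin q → ℕ) (k : Fin q) (A : Fin p → ℂ[X]) : Prop :=
  IsMixedMOP w₁ w₂ n m A ∧ ∫ x : ℝ, linForm w₁ A x * (x : ℂ) ^ (m k) * (w₂ k x : ℂ) = 1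

/-- `A = A^{(II,k)}_{n,m}`: the type II normalization, `A_k` is monic of degree `n_k - 1`. -/
def IsTypeII {p q : ℕ} (w₁ : Fin p → ℝ → ℝ) (w₂ : Fin q → ℝ → ℝ)
    (n : Fin p → ℕ) (m : Fin q → ℕ) (k : Fin p) (A : Fin p → ℂ[X]) : Prop :=
  IsMixedMOP w₁ w₂ n m A ∧ (A k).Monic ∧ (A k).natDegree + 1 = n k

/-- Square matrices of size `p + q`, in block form. -/
abbrev BlockMat (p q : ℕ) := Matrix (Fin p ⊕ Fin q) (Fin p ⊕ Fin q) ℂ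

/-- The jump matrix `[[I_p, W(x)], [0, I_q]]` with `W = w₁ᵗ w₂`. -/
noncomputable def jumpMatrix {p q : ℕ} (w₁ : Fin p → ℝ → ℝ) (w₂ : Fin q → ℝ → ℝ) (x : ℝ) :
    BlockMat p q :=
  Matrix.fromBlocks 1 (Matrix.of fun k l => (w₁ k x : ℂ) * (w₂ l x : ℂ)) 0 1

/-- The matrix `diag(z^{n_1}, …, z^{n_p}, z^{-m_1}, …, z^{-m_q})`. -/
noncomputable def asympMatrix {p q : ℕ} (n : Fin p → ℕ) (m : Fin q → ℕ) (z : ℂ) :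
    BlockMat p q :=
  Matrix.fromBlocks (Matrix.diagonal fun k => z ^ (n k)) 0 0
    (Matrix.diagonal fun l => z ^ (-(m l : ℤ)))

/-- The complement of the real line. -/
def offReal : Set ℂ := {z | z.im ≠ 0}

/-- `Y` solves the Riemann-Hilbert problem, in the sense that is meaningful for all weights:
* the boundary values `Y₊(x)`, `Y₋(x)` are the limits of `Y(x + iε)`, `Y(x - iε)` as `ε ↓ 0`; they
  exist and `Y₊ = Y₋ J` for almost every `x`; and (as boundary values almost everywhere do not
  detect, say, poles on the real line) the jump relation also holds in the sense of `L¹_loc`;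
* `Y(z) = (I + E(z)) diag(z^{n_k}, z^{-m_l})`, where `E(z) = O(1/z)` as `z → ∞` in every closed
  cone that avoids the real axis, and `E(z) = O(1/|Im z|)` as `z → ∞` without restriction.

For a merely integrable jump matrix, pointwise boundary values at every real point and a bound
`O(1/z)` up to the real axis cannot be expected; see `IsClassicalRHSolution` for these. -/
structure IsRHSolution {p q : ℕ} (w₁ : Fin p → ℝ → ℝ) (w₂ : Fin q → ℝ → ℝ)
    (n : Fin p → ℕ) (m : Fin q → ℕ) (Y : ℂ → BlockMat p q) : Prop where
  holo : ∀ i j, DifferentiableOn ℂ (fun z => Y z i j) offReal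
  jump_ae : ∀ᵐ x : ℝ, ∃ Yp Ym : BlockMat p q,
    Tendsto (fun ε : ℝ => Y ((x : ℂ) + ε * Complex.I)) (𝓝[>] 0) (𝓝 Yp) ∧
    Tendsto (fun ε : ℝ => Y ((x : ℂ) - ε * Complex.I)) (𝓝[>] 0) (𝓝 Ym) ∧
    Yp = Ym * jumpMatrix w₁ w₂ x
  jump_L1 : ∀ a b : ℝ, ∀ i j, Tendsto (fun ε : ℝ => ∫⁻ x in Set.Icc a b,
      ‖(Y ((x : ℂ) + ε * Complex.I)
        - Y ((x : ℂ) - ε * Complex.I) * jumpMatrix w₁ w₂ x) i j‖ₑ) (𝓝[>] 0) (𝓝 0)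
  asymp : ∃ E : ℂ → BlockMat p q,
    (∀ z ∈ offReal, Y z = (1 + E z) * asympMatrix n m z) ∧
    (∀ δ > 0, ∀ i j, (fun z => E z i j)
      =O[Bornology.cobounded ℂ ⊓ 𝓟 (offReal ∩ {z | δ * ‖z‖ ≤ |z.im|})] fun z => z⁻¹) ∧
    (∀ i j, (fun z => E z i j)
      =O[Bornology.cobounded ℂ ⊓ 𝓟 offReal] fun z => (|z.im|)⁻¹)

/-- `Y` solves the Riemann-Hilbert problem in the classical sense: `Y` has limits at every real
point from the upper and from the lower half plane, these satisfy `Y₊(x) = Y₋(x) J(x)` for every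
real `x`, and `Y(z) = (I + O(1/z)) diag(z^{n_k}, z^{-m_l})` as `z → ∞` in `ℂ ∖ ℝ`. -/
structure IsClassicalRHSolution {p q : ℕ} (w₁ : Fin p → ℝ → ℝ) (w₂ : Fin q → ℝ → ℝ)
    (n : Fin p → ℕ) (m : Fin q → ℕ) (Y : ℂ → BlockMat p q) : Prop where
  holo : ∀ i j, DifferentiableOn ℂ (fun z => Y z i j) offReal
  jump : ∀ x : ℝ, ∃ Yp Ym : BlockMat p q,
    Tendsto Y (𝓝[{z : ℂ | 0 < z.im}] (x : ℂ)) (𝓝 Yp) ∧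
    Tendsto Y (𝓝[{z : ℂ | z.im < 0}] (x : ℂ)) (𝓝 Ym) ∧
    Yp = Ym * jumpMatrix w₁ w₂ x
  asymp : ∃ E : ℂ → BlockMat p q,
    (∀ z ∈ offReal, Y z = (1 + E z) * asympMatrix n m z) ∧
    (∀ i j, (fun z => E z i j) =O[Bornology.cobounded ℂ ⊓ 𝓟 offReal] fun z => z⁻¹)

/-- The entries of `W = w₁ᵗ w₂` are regular enough for the classical sense: `x^j W_{k,l}(x)` is
integrable and Hölder continuous for `0 ≤ j ≤ n_k + m_l + 1`. -/
def IsRegularJump {p q : ℕ} (w₁ : Fin p → ℝ → ℝ) (w₂ : Fin q → ℝ → ℝ)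
    (n : Fin p → ℕ) (m : Fin q → ℕ) : Prop :=
  ∀ k l, ∀ j ≤ n k + m l + 1, Integrable (fun x : ℝ => x ^ j * (w₁ k x * w₂ l x)) ∧
    ∃ C α : ℝ≥0, 0 < α ∧ HolderWith C α (fun x : ℝ => x ^ j * (w₁ k x * w₂ l x))

/-! Each row of the solution is a vector of polynomials `A` followed by `1/(2πi)` times the Cauchy
transforms of `Q w₂ₗ`, where `Q = ∑ Aₖ w₁ₖ`. The jump matrix leaves the first `p` columns alone and
adds `Q w₂ₗ` to column `p + l`, which is exactly the Plemelj jump. Expanding `1/(x - z)` in powers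
of `1/z` turns the decay `z^(-mₗ)` into conditions on the moments `∫ Q x^j w₂ₗ`, `j < mₗ`: all of
them vanish, except that the last one in row `p + l` is `-2πi`. The degrees are governed by the
polynomial columns. Hence the rows are the type II vectors and `-2πi` times the type I vectors.

Algebra: the moment map on vectors with `deg Aₖ < nₖ` acts between spaces of dimensions `|n|` and
`|m|`, which agree. A vector in its kernel gives a form in `F ∩ G^⊥ = 0`, and `dim F = |n|` says
that only the zero vector gives the zero form. So the map is bijective (`momentsBijective`), which
yields existence, uniqueness and normality of both types.

Analysis for general weights: the Cauchy kernels at `x + iε` and `x - iε` differ by a multiple of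
the Poisson kernel, an approximate identity. Lebesgue points give the pointwise jump and continuity
of translations in `L¹` gives the jump in `L¹`. That each one-sided limit exists almost everywhere
is deeper: for `f ≥ 0` the function `exp(i C f)` is bounded in the upper half-plane, and Fatou's
theorem applies to it (`ae_exists_tendsto_cauchyT`).

Uniqueness (`IsRHSolution.eqOn`) works with the difference of two solutions. Its polynomial columns
have no jump, hence are polynomials of degree `< nₖ` by a Liouville theorem that tolerates a factor
`1/|Im z|` (`NoJump.eq_polynomial`). The same theorem identifies the other columns with Cauchy
transforms of the resulting forms. Their decay makes all moments vanish, so everything vanishes by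
the bijectivity above.

In the classical sense, Hölder continuity gives limits at every point and bounded Cauchy transforms,
and one extra power of `x` gives `O(1/z)`. A classical solution is a solution in the general sense
by dominated convergence, so uniqueness carries over. -/

/-! ### Cauchy's formula on rectangles -/

/-- The integral of `F` along the boundary of the rectangle `[a, b] × [c, d]`. -/
noncomputable def rectInt (F : ℂ → ℂ) (a b c d : ℝ) : ℂ :=
  (∫ x : ℝ in a..b, F (x + c * Complex.I)) - (∫ x : ℝ in a..b, F (x + d * Complex.I)) +
    Complex.I * (∫ y : ℝ in c..d, F (b + y * Complex.I)) -
    Complex.I * (∫ y : ℝ in c..d, F (a + y * Complex.I))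

theorem rectInt_eq_zero {F : ℂ → ℂ} {a b c d : ℝ} (hab : a ≤ b) (hcd : c ≤ d)
    (hF : DifferentiableOn ℂ F (Set.Icc a b ×ℂ Set.Icc c d)) : rectInt F a b c d = 0 := by
  have := Complex.integral_boundary_rect_eq_zero_of_differentiableOn F ⟨a, c⟩ ⟨b, d⟩
    (by simpa [Set.uIcc_of_le hab, Set.uIcc_of_le hcd] using hF)
  simpa [rectInt] using this

theorem integral_horizontal_inv_sub {a b y : ℝ} {w : ℂ} (h : y ≠ w.im) :
    ∫ x : ℝ in a..b, ((x + y * Complex.I : ℂ) - w)⁻¹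
      = Complex.log (b + y * Complex.I - w) - Complex.log (a + y * Complex.I - w) := by
  have him : ∀ x : ℝ, ((x : ℂ) + y * Complex.I - w).im ≠ 0 := fun x => by
    simpa [sub_ne_zero] using h
  have h0 : ∀ x : ℝ, ((x : ℂ) + y * Complex.I - w) ≠ 0 := fun x hx => him x (by rw [hx]; simp)
  have hd : ∀ x : ℝ, HasDerivAt (fun x : ℝ => Complex.log (x + y * Complex.I - w))
      ((x + y * Complex.I : ℂ) - w)⁻¹ x := fun x => by
    have h1 : HasDerivAt (fun x : ℝ => ((x : ℂ) + y * Complex.I - w)) 1 x :=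
      ((Complex.ofRealCLM.hasDerivAt (x := x)).add_const _).sub_const _
    simpa using h1.clog_real (Or.inr (him x))
  exact intervalIntegral.integral_eq_sub_of_hasDerivAt (fun x _ => hd x)
    (Continuous.intervalIntegrable
      (Continuous.inv₀ (by fun_prop) h0) _ _)

theorem integral_vertical_inv_sub {c d x : ℝ} {w : ℂ} (h : w.re < x) :
    Complex.I * ∫ y : ℝ in c..d, ((x + y * Complex.I : ℂ) - w)⁻¹
      = Complex.log (x + d * Complex.I - w) - Complex.log (x + c * Complex.I - w) := by
  have him : ∀ y : ℝ, 0 < ((x : ℂ) + y * Complex.I - w).re := fun y => by simpa using h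
  have h0 : ∀ y : ℝ, ((x : ℂ) + y * Complex.I - w) ≠ 0 := fun y hx => by
    have := him y; rw [hx] at this; simp at this
  have hd : ∀ y : ℝ, HasDerivAt (fun y : ℝ => Complex.log (x + y * Complex.I - w))
      (Complex.I * ((x + y * Complex.I : ℂ) - w)⁻¹) y := fun y => by
    have h1 : HasDerivAt (fun y : ℝ => ((x : ℂ) + y * Complex.I - w)) Complex.I y := by
      simpa using (((Complex.ofRealCLM.hasDerivAt (x := y)).mul_const Complex.I).const_add
        (x : ℂ)).sub_const w
    simpa [div_eq_mul_inv] using h1.clog_real (Or.inl (him y))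
  rw [← intervalIntegral.integral_const_mul]
  exact intervalIntegral.integral_eq_sub_of_hasDerivAt (fun y _ => hd y)
    (Continuous.intervalIntegrable
      (continuous_const.mul (Continuous.inv₀ (by fun_prop) h0)) _ _)

/-- To the left of `w` the side may cross the branch cut of `log (ζ - w)`; the antiderivative `log
(w - ζ)` is smooth there. -/
theorem integral_vertical_inv_sub' {c d x : ℝ} {w : ℂ} (h : x < w.re) :
    Complex.I * ∫ y : ℝ in c..d, ((x + y * Complex.I : ℂ) - w)⁻¹
      = Complex.log (w - (x + d * Complex.I)) - Complex.log (w - (x + c * Complex.I)) := by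
  have him : ∀ y : ℝ, 0 < (w - ((x : ℂ) + y * Complex.I)).re := fun y => by simpa using h
  have h0 : ∀ y : ℝ, ((x : ℂ) + y * Complex.I - w) ≠ 0 := fun y hx => by
    have := him y; rw [← neg_sub, hx] at this; simp at this
  have hd : ∀ y : ℝ, HasDerivAt (fun y : ℝ => Complex.log (w - (x + y * Complex.I)))
      (Complex.I * ((x + y * Complex.I : ℂ) - w)⁻¹) y := fun y => by
    have h1 : HasDerivAt (fun y : ℝ => (w - ((x : ℂ) + y * Complex.I))) (-Complex.I) y := by
      simpa using (((Complex.ofRealCLM.hasDerivAt (x := y)).mul_const Complex.I).const_add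
        (x : ℂ)).const_sub w
    have h2 := h1.clog_real (Or.inl (him y))
    rwa [show -Complex.I / (w - ((x : ℂ) + y * Complex.I))
      = Complex.I * ((x + y * Complex.I : ℂ) - w)⁻¹ by
        rw [← neg_sub w, inv_neg, div_eq_mul_inv]; ring] at h2
  rw [← intervalIntegral.integral_const_mul]
  exact intervalIntegral.integral_eq_sub_of_hasDerivAt (fun y _ => hd y)
    (Continuous.intervalIntegrable
      (continuous_const.mul (Continuous.inv₀ (by fun_prop) h0)) _ _)

theorem log_sub_log_neg_of_im_pos {z : ℂ} (h : 0 < z.im) :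
    Complex.log z - Complex.log (-z) = Real.pi * Complex.I := by
  simp only [Complex.log, norm_neg, Complex.arg_neg_eq_arg_sub_pi_of_im_pos h]
  push_cast; ring

/-- The logarithms cancel at the two right corners. At each left corner two different branches meet,
and the mismatch contributes `πi`. -/
theorem rectInt_inv_sub {a b c d : ℝ} {w : ℂ} (hre : w.re ∈ Set.Ioo a b)
    (him : w.im ∈ Set.Ioo c d) :
    rectInt (fun ζ => (ζ - w)⁻¹) a b c d = 2 * Real.pi * Complex.I := by
  rw [rectInt, integral_horizontal_inv_sub him.1.ne, integral_horizontal_inv_sub him.2.ne',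
    integral_vertical_inv_sub hre.2, integral_vertical_inv_sub' hre.1]
  have h1 := log_sub_log_neg_of_im_pos (z := a + d * Complex.I - w) (by simpa using him.2)
  have h2 := log_sub_log_neg_of_im_pos (z := w - (a + c * Complex.I)) (by simpa using him.1)
  rw [neg_sub] at h1 h2
  linear_combination h1 + h2

theorem reProdIm_mem_nhds {a b c d : ℝ} {w : ℂ} (hre : w.re ∈ Set.Ioo a b)
    (him : w.im ∈ Set.Ioo c d) : Set.Icc a b ×ℂ Set.Icc c d ∈ 𝓝 w :=
  mem_of_superset ((isOpen_Ioo.reProdIm isOpen_Ioo).mem_nhds ⟨hre, him⟩)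
    fun _ hz => ⟨Set.Ioo_subset_Icc_self hz.1, Set.Ioo_subset_Icc_self hz.2⟩

section sides

variable {F : ℂ → ℂ} {a b c d : ℝ}

/-- Continuity of `F` on the boundary of a rectangle. -/
def ContSides (F : ℂ → ℂ) (a b c d : ℝ) : Prop :=
  ContinuousOn F {z | z ∈ Set.Icc a b ×ℂ Set.Icc c d ∧ (z.re = a ∨ z.re = b ∨ z.im = c ∨ z.im = d)}

theorem ContSides.integrable (hab : a ≤ b) (hcd : c ≤ d) (h : ContSides F a b c d) :
    (IntervalIntegrable (fun x : ℝ => F (x + c * Complex.I)) volume a b ∧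
    IntervalIntegrable (fun x : ℝ => F (x + d * Complex.I)) volume a b) ∧
    IntervalIntegrable (fun y : ℝ => F (a + y * Complex.I)) volume c d ∧
    IntervalIntegrable (fun y : ℝ => F (b + y * Complex.I)) volume c d := by
  refine ⟨⟨?_, ?_⟩, ?_, ?_⟩ <;>
  refine ContinuousOn.intervalIntegrable (h.comp (by fun_prop) ?_) <;>
  intro x hx <;> simp only [Set.uIcc_of_le hab, Set.uIcc_of_le hcd] at hx <;>
  simp [Complex.mem_reProdIm, hab, hcd, hx.1, hx.2]

theorem rectInt_add {G : ℂ → ℂ} (hab : a ≤ b) (hcd : c ≤ d) (hF : ContSides F a b c d)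
    (hG : ContSides G a b c d) :
    rectInt (fun z => F z + G z) a b c d = rectInt F a b c d + rectInt G a b c d := by
  obtain ⟨⟨f1, f2⟩, f3, f4⟩ := hF.integrable hab hcd
  obtain ⟨⟨g1, g2⟩, g3, g4⟩ := hG.integrable hab hcd
  simp only [rectInt]
  rw [intervalIntegral.integral_add f1 g1, intervalIntegral.integral_add f2 g2,
    intervalIntegral.integral_add f3 g3, intervalIntegral.integral_add f4 g4]
  ring

theorem rectInt_const_mul (k : ℂ) :
    rectInt (fun z => k * F z) a b c d = k * rectInt F a b c d := by
  simp only [rectInt, intervalIntegral.integral_const_mul]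
  ring

theorem rectInt_sum {ι : Type*} (s : Finset ι) {G : ι → ℂ → ℂ} (hab : a ≤ b) (hcd : c ≤ d)
    (hG : ∀ i ∈ s, ContSides (G i) a b c d) :
    rectInt (fun z => ∑ i ∈ s, G i z) a b c d = ∑ i ∈ s, rectInt (G i) a b c d := by
  classical
  induction s using Finset.induction_on with
  | empty => simp [rectInt]
  | insert i s hi ih =>
    simp only [Finset.sum_insert hi]
    rw [rectInt_add hab hcd (hG i (by simp)), ih fun j hj => hG j (by simp [hj])]
    exact continuousOn_finsetSum _ fun j hj => hG j (by simp [hj])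

theorem rectInt_congr {G : ℂ → ℂ} (hab : a ≤ b) (hcd : c ≤ d)
    (h : ∀ z ∈ Set.Icc a b ×ℂ Set.Icc c d, (z.re = a ∨ z.re = b ∨ z.im = c ∨ z.im = d) →
      F z = G z) : rectInt F a b c d = rectInt G a b c d := by
  have hx : ∀ y : ℝ, (y = c ∨ y = d) → y ∈ Set.Icc c d →
      ∫ x : ℝ in a..b, F (x + y * Complex.I) = ∫ x : ℝ in a..b, G (x + y * Complex.I) := by
    intro y hy hy'
    refine intervalIntegral.integral_congr fun x hx => ?_
    rw [Set.uIcc_of_le hab] at hx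
    refine h _ ?_ ?_
    · simpa [Complex.mem_reProdIm] using ⟨hx, hy'⟩
    · simpa using Or.inr (Or.inr hy)
  have hy : ∀ x : ℝ, (x = a ∨ x = b) → x ∈ Set.Icc a b →
      ∫ y : ℝ in c..d, F (x + y * Complex.I) = ∫ y : ℝ in c..d, G (x + y * Complex.I) := by
    intro x hx hx'
    refine intervalIntegral.integral_congr fun y hy => ?_
    rw [Set.uIcc_of_le hcd] at hy
    refine h _ ?_ ?_
    · simpa [Complex.mem_reProdIm] using ⟨hx', hy⟩
    · have := hx; simp; tauto
  simp only [rectInt]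
  rw [hx c (Or.inl rfl) ⟨le_rfl, hcd⟩, hx d (Or.inr rfl) ⟨hcd, le_rfl⟩,
    hy a (Or.inl rfl) ⟨le_rfl, hab⟩, hy b (Or.inr rfl) ⟨hab, le_rfl⟩]

/-- **Cauchy's integral formula** on a rectangle. -/
theorem rectInt_mul_inv_sub {w : ℂ} (hF : DifferentiableOn ℂ F (Set.Icc a b ×ℂ Set.Icc c d))
    (hre : w.re ∈ Set.Ioo a b) (him : w.im ∈ Set.Ioo c d) :
    rectInt (fun ζ => F ζ * (ζ - w)⁻¹) a b c d = 2 * Real.pi * Complex.I * F w := by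
  have hab := (hre.1.trans hre.2).le
  have hcd := (him.1.trans him.2).le
  have hne : ∀ z ∈ Set.Icc a b ×ℂ Set.Icc c d, (z.re = a ∨ z.re = b ∨ z.im = c ∨ z.im = d) →
      z ≠ w := by
    rintro z - h rfl
    have := hre.1; have := hre.2; have := him.1; have := him.2
    rcases h with h | h | h | h <;> linarith
  -- `dslope` removes the singularity, so that only `F w / (ζ - w)` contributes.
  have hD : DifferentiableOn ℂ (dslope F w) (Set.Icc a b ×ℂ Set.Icc c d) :=
    (Complex.differentiableOn_dslope (reProdIm_mem_nhds hre him)).2 hF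
  have hi : ContSides (fun ζ => (ζ - w)⁻¹) a b c d := by
    refine ContinuousOn.inv₀ (by fun_prop) fun z hz => sub_ne_zero.2 (hne z hz.1 hz.2)
  have e : rectInt (fun ζ => F ζ * (ζ - w)⁻¹) a b c d
      = rectInt (fun ζ => dslope F w ζ + F w * (ζ - w)⁻¹) a b c d := by
    refine rectInt_congr hab hcd fun z hz h => ?_
    rw [dslope_of_ne _ (hne z hz h), slope_def_field]
    have := sub_ne_zero.2 (hne z hz h)
    field_simp; ring
  rw [e, rectInt_add (G := fun ζ => F w * (ζ - w)⁻¹) hab hcd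
    (hD.continuousOn.mono fun z hz => hz.1) (continuousOn_const.mul hi), rectInt_const_mul, rectInt_eq_zero hab hcd hD, rectInt_inv_sub hre him]
  ring

end sides

/-! ### Liouville's theorem for functions without jump on the real line -/

/-- For use on the two halves of a square cut along the real axis: the poles in one half lie outside
the closed strip of the other, so each pole is counted exactly once. -/
theorem rectInt_mul_sum_inv_sub {ι : Type*} (s : Finset ι) {F : ℂ → ℂ} {a b c d : ℝ}
    (hab : a ≤ b) (hcd : c ≤ d)
    (hF : DifferentiableOn ℂ F (Set.Icc a b ×ℂ Set.Icc c d)) (v k : ι → ℂ)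
    (hv : ∀ i ∈ s, (v i).re ∈ Set.Ioo a b)
    (hv' : ∀ i ∈ s, (v i).im ∈ Set.Ioo c d ∨ (v i).im ∉ Set.Icc c d) :
    rectInt (fun ζ => F ζ * ∑ i ∈ s, k i * (ζ - v i)⁻¹) a b c d
      = 2 * Real.pi * Complex.I *
        ∑ i ∈ s, open Classical in if (v i).im ∈ Set.Ioo c d then k i * F (v i) else 0 := by
  classical
  have hne : ∀ i ∈ s, ∀ z ∈ Set.Icc a b ×ℂ Set.Icc c d,
      (z.re = a ∨ z.re = b ∨ z.im = c ∨ z.im = d) → z - v i ≠ 0 := by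
    intro i hi z hz h h0
    obtain rfl := sub_eq_zero.1 h0
    rcases hv' i hi with h1 | h1
    · have := (hv i hi).1; have := (hv i hi).2; have := h1.1; have := h1.2
      rcases h with h | h | h | h <;> linarith
    · exact h1 hz.2
  have e : (fun ζ => F ζ * ∑ i ∈ s, k i * (ζ - v i)⁻¹)
      = fun ζ => ∑ i ∈ s, k i * (F ζ * (ζ - v i)⁻¹) := by
    funext ζ
    rw [Finset.mul_sum]
    exact Finset.sum_congr rfl fun i _ => by ring
  rw [e, rectInt_sum s hab hcd, Finset.mul_sum]
  · refine Finset.sum_congr rfl fun i hi => ?_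
    rw [rectInt_const_mul]
    split_ifs with h
    · rw [rectInt_mul_inv_sub hF (hv i hi) h]; ring
    · have h2 := (hv' i hi).resolve_left h
      rw [rectInt_eq_zero hab hcd]
      · simp
      · refine hF.mul (DifferentiableOn.inv (by fun_prop) fun z hz h0 => h2 ?_)
        rw [← sub_eq_zero.1 h0]; exact hz.2
  · intro i hi
    refine continuousOn_const.mul ((hF.continuousOn.mono fun z hz => hz.1).mul
      (ContinuousOn.inv₀ (by fun_prop) fun z hz => hne i hi z hz.1 hz.2))

theorem mem_offReal {z : ℂ} : z ∈ offReal ↔ z.im ≠ 0 := Iff.rfl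

theorem isOpen_offReal : IsOpen offReal := isOpen_ne.preimage Complex.continuous_im

/-- The two boundary values of `D` on the real line agree in `L¹_loc`. -/
def NoJump (D : ℂ → ℂ) : Prop :=
  ∀ a b : ℝ, Tendsto (fun ε : ℝ => ∫⁻ x in Set.Icc a b,
      ‖D ((x : ℂ) + ε * Complex.I) - D ((x : ℂ) - ε * Complex.I)‖ₑ) (𝓝[>] 0) (𝓝 0)

theorem NoJump.tendsto_integral {D g : ℂ → ℂ} (h : NoJump D) {a b B : ℝ} (hab : a ≤ b)
    (hg : ∀ x ∈ Set.Icc a b, ‖g (x : ℝ)‖ ≤ B) :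
    Tendsto (fun ε : ℝ => ∫ x in a..b,
      (D ((x : ℂ) + ε * Complex.I) - D ((x : ℂ) - ε * Complex.I)) * g x) (𝓝[>] 0) (𝓝 0) := by
  rw [tendsto_zero_iff_enorm_tendsto_zero]
  have h2 : Tendsto (fun ε : ℝ => ENNReal.ofReal B * ∫⁻ x in Set.Icc a b,
      ‖D ((x : ℂ) + ε * Complex.I) - D ((x : ℂ) - ε * Complex.I)‖ₑ) (𝓝[>] 0) (𝓝 0) := by
    simpa using ENNReal.Tendsto.const_mul (h a b) (Or.inr ENNReal.ofReal_ne_top)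
  refine tendsto_of_tendsto_of_tendsto_of_le_of_le tendsto_const_nhds h2 (fun _ => zero_le)
    fun ε => ?_
  dsimp only
  rw [intervalIntegral.integral_of_le hab, ← integral_Icc_eq_integral_Ioc]
  refine (enorm_integral_le_lintegral_enorm _).trans ?_
  rw [← lintegral_const_mul' _ _ ENNReal.ofReal_ne_top]
  refine setLIntegral_mono' measurableSet_Icc fun x hx => ?_
  rw [enorm_mul, mul_comm]
  gcongr
  rw [← ofReal_norm]
  exact ENNReal.ofReal_le_ofReal (hg x hx)

/-- The factor `ζ² - ρ²` vanishes where the contour meets the real axis and thus absorbs the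
possible growth `1/|Im ξ|` of `D`. The point `ξ` is `ζ` pushed vertically away from the axis. -/
theorem norm_mul_sq_sub_le {D : ℂ → ℂ} {ζ ξ S : ℂ} {ρ M K : ℝ} (hρ : 0 < ρ)
    (hM : ‖D ξ‖ * |ξ.im| ≤ M) (hK : ‖S‖ ≤ K) (hξ : |ζ.im| ≤ |ξ.im|)
    (hζ : ‖ζ ^ 2 - ρ ^ 2‖ ≤ 3 * ρ * |ζ.im|) :
    ‖D ξ * (ζ ^ 2 - ρ ^ 2) * S‖ ≤ 3 * ρ * M * K := by
  rw [norm_mul, norm_mul]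
  have : ‖D ξ‖ * ‖ζ ^ 2 - (ρ : ℂ) ^ 2‖ ≤ 3 * ρ * M := by
    calc _ ≤ ‖D ξ‖ * (3 * ρ * |ξ.im|) := by
          refine mul_le_mul_of_nonneg_left (hζ.trans ?_) (norm_nonneg _)
          gcongr
      _ = 3 * ρ * (‖D ξ‖ * |ξ.im|) := by ring
      _ ≤ _ := by gcongr
  have hM0 : 0 ≤ 3 * ρ * M := le_trans (by positivity) this
  gcongr

theorem norm_sq_sub_le_vertical {ρ y : ℝ} (hy : |y| ≤ ρ) {x : ℝ} (hx : x ^ 2 = ρ ^ 2)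
    (hx' : |x| = ρ) :
    ‖((x : ℂ) + y * Complex.I) ^ 2 - (ρ : ℂ) ^ 2‖ ≤ 3 * ρ * |y| := by
  have hx2 : (x : ℂ) ^ 2 = ρ ^ 2 := by exact_mod_cast hx
  have : ((x : ℂ) + y * Complex.I) ^ 2 - (ρ : ℂ) ^ 2 = y * (2 * x * Complex.I - y) := by
    have := Complex.I_sq
    linear_combination hx2 + y ^ 2 * this
  rw [this, norm_mul, mul_comm, Complex.norm_real, Real.norm_eq_abs]
  gcongr
  calc _ ≤ ‖2 * (x : ℂ) * Complex.I‖ + ‖(y : ℂ)‖ := norm_sub_le _ _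
    _ ≤ _ := by simp [hx']; linarith

theorem norm_sq_sub_le_horizontal {ρ x y : ℝ} (hy : |y| = ρ) (hx : |x| ≤ ρ) :
    ‖((x : ℂ) + y * Complex.I) ^ 2 - (ρ : ℂ) ^ 2‖ ≤ 3 * ρ * |y| := by
  have hy2 : y ^ 2 = ρ ^ 2 := by rw [← hy, sq_abs]
  have hyc : (y : ℂ) ^ 2 = ρ ^ 2 := by exact_mod_cast hy2
  have hx2 : x ^ 2 ≤ ρ ^ 2 := by rw [← sq_abs x]; gcongr
  have : ((x : ℂ) + y * Complex.I) ^ 2 - (ρ : ℂ) ^ 2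
      = ((x ^ 2 - 2 * ρ ^ 2 : ℝ) : ℂ) + ((2 * x * y : ℝ) : ℂ) * Complex.I := by
    push_cast
    linear_combination y ^ 2 * Complex.I_sq - hyc
  have hρ : 0 ≤ ρ := hy ▸ abs_nonneg y
  rw [this, hy, Complex.norm_add_mul_I]
  refine Real.sqrt_le_iff.2 ⟨by positivity, ?_⟩
  -- The squared modulus is `x⁴ + 4ρ⁴ ≤ 5ρ⁴ ≤ (3ρ²)²`.
  nlinarith [sq_nonneg x, sq_nonneg ρ, mul_nonneg (sq_nonneg x) (sub_nonneg.2 hx2)]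

/-- Cauchy's formula for `D (ζ² - ρ²) ∑ kᵢ/(ζ - vᵢ)` on a square centred at `0`, although `D` is
undefined on the axis through it: the absence of a jump lets the integrals along the axis cancel in
the limit. -/
theorem norm_sum_le_of_noJump {ι : Type*} (s : Finset ι) {D : ℂ → ℂ}
    (hD : DifferentiableOn ℂ D offReal) (hJ : NoJump D) {ρ M K : ℝ} (hρ : 0 < ρ)
    (v k : ι → ℂ) (hre : ∀ i ∈ s, |(v i).re| < ρ) (him : ∀ i ∈ s, |(v i).im| < ρ)
    (h0 : ∀ i ∈ s, (v i).im ≠ 0)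
    (hM : ∀ ζ : ℂ, ζ.im ≠ 0 → ρ ≤ ‖ζ‖ → ‖ζ‖ ≤ 4 * ρ → ‖D ζ‖ * |ζ.im| ≤ M)
    (hK : ∀ ζ : ℂ, ρ ≤ ‖ζ‖ → ‖ζ‖ ≤ 4 * ρ → ‖∑ i ∈ s, k i * (ζ - v i)⁻¹‖ ≤ K) :
    2 * Real.pi * ‖∑ i ∈ s, k i * (D (v i) * (v i ^ 2 - ρ ^ 2))‖ ≤ 24 * ρ ^ 2 * M * K := by
  classical
  set S : ℂ → ℂ := fun ζ => ∑ i ∈ s, k i * (ζ - v i)⁻¹ with hS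
  have hre' : ∀ i ∈ s, (v i).re ∈ Set.Ioo (-ρ) ρ := fun i hi => abs_lt.1 (hre i hi)
  have him' : ∀ i ∈ s, (v i).im ∈ Set.Ioo (-ρ) ρ := fun i hi => abs_lt.1 (him i hi)
  -- Shifting only the argument of `D` by `±iε` makes the integrands holomorphic on the closed upper
  -- and lower halves, while the weight and the poles stay in place.
  set Tp : ℝ → ℂ := fun ε => rectInt
    (fun ζ => (D (ζ + ε * Complex.I) * (ζ ^ 2 - ρ ^ 2)) * S ζ) (-ρ) ρ 0 ρ with hTp
  set Tm : ℝ → ℂ := fun ε => rectInt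
    (fun ζ => (D (ζ - ε * Complex.I) * (ζ ^ 2 - ρ ^ 2)) * S ζ) (-ρ) ρ (-ρ) 0 with hTm
  have hPp : ∀ ε : ℝ, 0 < ε → DifferentiableOn ℂ
      (fun ζ => D (ζ + ε * Complex.I) * (ζ ^ 2 - ρ ^ 2)) (Set.Icc (-ρ) ρ ×ℂ Set.Icc 0 ρ) := by
    intro ε hε
    refine (hD.comp (by fun_prop) fun z hz => ?_).mul (by fun_prop)
    have h1 : 0 ≤ z.im := hz.2.1
    simp only [mem_offReal, Complex.add_im, Complex.mul_im, Complex.ofReal_re,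
      Complex.I_im, Complex.ofReal_im, Complex.I_re]
    intro h; linarith
  have hPm : ∀ ε : ℝ, 0 < ε → DifferentiableOn ℂ
      (fun ζ => D (ζ - ε * Complex.I) * (ζ ^ 2 - ρ ^ 2)) (Set.Icc (-ρ) ρ ×ℂ Set.Icc (-ρ) 0) := by
    intro ε hε
    refine (hD.comp (by fun_prop) fun z hz => ?_).mul (by fun_prop)
    have h1 : z.im ≤ 0 := hz.2.2
    simp only [mem_offReal, Complex.sub_im, Complex.mul_im, Complex.ofReal_re,
      Complex.I_im, Complex.ofReal_im, Complex.I_re]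
    intro h; linarith
  have hTp' : ∀ ε : ℝ, 0 < ε → Tp ε = 2 * Real.pi * Complex.I * ∑ i ∈ s,
      if (v i).im ∈ Set.Ioo 0 ρ then
        k i * (D (v i + ε * Complex.I) * (v i ^ 2 - ρ ^ 2)) else 0 := by
    intro ε hε
    refine (rectInt_mul_sum_inv_sub s (by linarith) hρ.le (hPp ε hε) v k hre' fun i hi => ?_).trans
      (by congr!)
    rcases lt_or_gt_of_ne (h0 i hi) with h | h
    · exact Or.inr fun h' => by linarith [h'.1]
    · exact Or.inl ⟨h, (him' i hi).2⟩
  have hTm' : ∀ ε : ℝ, 0 < ε → Tm ε = 2 * Real.pi * Complex.I * ∑ i ∈ s,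
      if (v i).im ∈ Set.Ioo (-ρ) 0 then
        k i * (D (v i - ε * Complex.I) * (v i ^ 2 - ρ ^ 2)) else 0 := by
    intro ε hε
    refine (rectInt_mul_sum_inv_sub s (by linarith) (by linarith) (hPm ε hε) v k hre'
      fun i hi => ?_).trans (by congr!)
    rcases lt_or_gt_of_ne (h0 i hi) with h | h
    · exact Or.inl ⟨(him' i hi).1, h⟩
    · exact Or.inr fun h' => by linarith [h'.2]
  have hcont : ∀ z : ℂ, z.im ≠ 0 → ContinuousAt D z := fun z hz =>
    (hD.differentiableAt (isOpen_offReal.mem_nhds hz)).continuousAt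
  have hlim : Tendsto (fun ε => Tp ε + Tm ε) (𝓝[>] 0)
      (𝓝 (2 * Real.pi * Complex.I * ∑ i ∈ s, k i * (D (v i) * (v i ^ 2 - ρ ^ 2)))) := by
    have : (fun ε : ℝ => 2 * Real.pi * Complex.I * ∑ i ∈ s,
        k i * (D (v i + (if 0 < (v i).im then (ε : ℂ) else -ε) * Complex.I)
          * (v i ^ 2 - ρ ^ 2))) =ᶠ[𝓝[>] 0] fun ε => Tp ε + Tm ε := by
      filter_upwards [self_mem_nhdsWithin] with ε hε
      rw [hTp' ε hε, hTm' ε hε, ← mul_add, ← Finset.sum_add_distrib]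
      congr 1
      refine Finset.sum_congr rfl fun i hi => ?_
      have := him' i hi
      rcases lt_or_gt_of_ne (h0 i hi) with h | h
      · rw [if_neg (not_lt.2 h.le), if_neg fun h' => (h'.1.trans h).false, if_pos ⟨this.1, h⟩]
        ring_nf
      · rw [if_pos h, if_pos ⟨h, this.2⟩, if_neg fun h' => (h'.2.trans h).false]
        ring_nf
    refine Tendsto.congr' this (Tendsto.const_mul _ (tendsto_finsetSum _ fun i hi =>
      Tendsto.const_mul _ (Tendsto.mul_const _ ?_)))
    refine (hcont _ (h0 i hi)).tendsto.comp ?_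
    have : Continuous fun ε : ℝ =>
        v i + (if 0 < (v i).im then (ε : ℂ) else -ε) * Complex.I := by
      split_ifs <;> fun_prop
    simpa using (this.tendsto 0).mono_left nhdsWithin_le_nhds
  -- This is what the two integrals along the axis leave over. The poles are off the axis, so the
  -- weight is bounded on the segment.
  have hmid := hJ.tendsto_integral (g := fun z => (z ^ 2 - ρ ^ 2) * S z) (a := -ρ) (b := ρ)
    (B := (sSup ((fun x : ℝ => ‖((x : ℂ) ^ 2 - ρ ^ 2) * S x‖) '' Set.Icc (-ρ) ρ))) (by linarith)
    (by
      intro x hx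
      refine le_csSup ?_ ⟨x, hx, rfl⟩
      refine (isCompact_Icc.image_of_continuousOn ?_).bddAbove
      refine (ContinuousOn.mul (by fun_prop) (continuousOn_finsetSum _ fun i hi =>
        continuousOn_const.mul (ContinuousOn.inv₀ (by fun_prop) fun x _ h => h0 i hi ?_))).norm
      have := congrArg Complex.im h
      simpa using this)
  have hfin := (hlim.sub hmid).norm
  rw [sub_zero] at hfin
  have hpi : ‖(2 * Real.pi * Complex.I : ℂ)‖ = 2 * Real.pi := by
    simp [abs_of_pos Real.pi_pos]
  rw [norm_mul, hpi] at hfin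
  refine le_of_tendsto hfin ?_
  filter_upwards [Ioo_mem_nhdsGT hρ] with ε hε
  have iD : ∀ σ : ℝ, σ ≠ 0 → IntervalIntegrable
      (fun x : ℝ => D (x + σ * Complex.I) * ((x ^ 2 - ρ ^ 2) * S x)) volume (-ρ) ρ := by
    intro σ hσ
    refine ContinuousOn.intervalIntegrable ?_
    refine ContinuousOn.mul (fun x _ => ?_) (ContinuousOn.mul (by fun_prop)
      (continuousOn_finsetSum _ fun i hi =>
        continuousOn_const.mul (ContinuousOn.inv₀ (by fun_prop) fun x _ h => h0 i hi ?_)))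
    · refine ((hcont _ ?_).comp (f := fun x : ℝ => (x : ℂ) + σ * Complex.I)
        (by fun_prop)).continuousWithinAt
      simpa using hσ
    · have := congrArg Complex.im h
      simpa using this
  have i1 := iD ε hε.1.ne'
  have i2 := iD (-ε) (neg_ne_zero.2 hε.1.ne')
  have emid : (∫ x in (-ρ)..ρ, (D ((x : ℂ) + ε * Complex.I) - D ((x : ℂ) - ε * Complex.I)) *
      (((x : ℂ) ^ 2 - ρ ^ 2) * S x))
      = (∫ x : ℝ in (-ρ)..ρ, (D (x + (0 : ℝ) * Complex.I + ε * Complex.I)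
          * ((x + (0 : ℝ) * Complex.I) ^ 2 - ρ ^ 2)) * S (x + (0 : ℝ) * Complex.I))
        - ∫ x : ℝ in (-ρ)..ρ, (D (x + (0 : ℝ) * Complex.I - ε * Complex.I)
          * ((x + (0 : ℝ) * Complex.I) ^ 2 - ρ ^ 2)) * S (x + (0 : ℝ) * Complex.I) := by
    simp only [Complex.ofReal_neg, neg_mul, ← sub_eq_add_neg] at i2
    simp only [Complex.ofReal_zero, zero_mul, add_zero]
    simp only [mul_assoc]
    rw [← intervalIntegral.integral_sub i1 i2]
    simp only [sub_mul]
  have hM0 : 0 ≤ M := (by positivity : (0:ℝ) ≤ _).trans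
    (hM ((2 * ρ : ℝ) * Complex.I) (by simp; positivity)
      (by simp [abs_of_pos hρ]; linarith) (by simp [abs_of_pos hρ]; linarith))
  have key : ∀ (x y σ : ℝ), (|x| = ρ ∧ |y| ≤ ρ ∨ |y| = ρ ∧ |x| ≤ ρ) → (|σ| = ε) →
      |y| ≤ |y + σ| → y + σ ≠ 0 →
      ‖D (x + y * Complex.I + σ * Complex.I) * ((x + y * Complex.I) ^ 2 - ρ ^ 2)
        * S (x + y * Complex.I)‖ ≤ 3 * ρ * M * K := by
    intro x y σ hxy hσ hy hyσ
    have hx : |x| ≤ ρ := by rcases hxy with h | h; exacts [h.1.le, h.2]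
    have hy' : |y| ≤ ρ := by rcases hxy with h | h; exacts [h.2, h.1.le]
    have e1 : (x : ℂ) + y * Complex.I + σ * Complex.I = x + (y + σ : ℝ) * Complex.I := by
      push_cast; ring
    have n1 : ‖(x : ℂ) + y * Complex.I‖ ≤ |x| + |y| := by
      simpa using norm_add_le (x : ℂ) (y * Complex.I)
    have n2 : ‖(x : ℂ) + (y + σ : ℝ) * Complex.I‖ ≤ |x| + |y + σ| := by
      simpa only [norm_mul, Complex.norm_I, mul_one, Complex.norm_real, Real.norm_eq_abs] using
      norm_add_le (x : ℂ) ((y + σ : ℝ) * Complex.I)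
    have n3 := Complex.abs_re_le_norm ((x : ℂ) + y * Complex.I)
    have n4 := Complex.abs_im_le_norm ((x : ℂ) + y * Complex.I)
    have n5 := Complex.abs_re_le_norm ((x : ℂ) + (y + σ : ℝ) * Complex.I)
    have n6 := Complex.abs_im_le_norm ((x : ℂ) + (y + σ : ℝ) * Complex.I)
    have n7 := abs_add_le y σ
    have hε2 := hε.2
    simp only [Complex.add_re, Complex.ofReal_re, Complex.mul_re, Complex.I_re, mul_zero,
      Complex.ofReal_im, Complex.I_im, Complex.add_im, Complex.mul_im, zero_add,
      add_zero, mul_one, sub_self] at n3 n4 n5 n6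
    rw [e1]
    refine norm_mul_sq_sub_le hρ (hM _ ?_ ?_ ?_) (hK _ ?_ ?_) ?_ ?_
    · simpa using hyσ
    · rcases hxy with h | h <;> linarith
    · linarith
    · rcases hxy with h | h <;> linarith
    · linarith
    · simpa using hy
    · have : ((x : ℂ) + y * Complex.I).im = y := by simp
      rw [this]
      rcases hxy with h | h
      · exact norm_sq_sub_le_vertical h.2 (by rw [← sq_abs, h.1]) h.1
      · exact norm_sq_sub_le_horizontal h.1 h.2
  have hK0 : 0 ≤ 3 * ρ * M * K := by
    refine (norm_nonneg _).trans (key ρ ρ ε (Or.inl ⟨abs_of_pos hρ, (abs_of_pos hρ).le⟩)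
      (abs_of_pos hε.1) ?_ (by linarith [hε.1]))
    rw [abs_of_pos hρ, abs_of_pos (by linarith [hε.1])]; linarith [hε.1]
  have eε : ∀ z : ℂ, z - ε * Complex.I = z + (-ε : ℝ) * Complex.I := fun z => by
    push_cast; ring
  have hεa : |ε| = ε := abs_of_pos hε.1
  have hεa' : |-ε| = ε := by rw [abs_neg, hεa]
  have hρa : |ρ| = ρ := abs_of_pos hρ
  have hρa' : |-ρ| = ρ := by rw [abs_neg, hρa]
  have up : ∀ y, 0 ≤ y → |y| ≤ |y + ε| ∧ y + ε ≠ 0 := fun y hy => by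
    have := hε.1
    rw [abs_of_nonneg hy, abs_of_pos (by linarith)]; constructor <;> linarith
  have dn : ∀ y, y ≤ 0 → |y| ≤ |y + -ε| ∧ y + -ε ≠ 0 := fun y hy => by
    have := hε.1
    rw [abs_of_nonpos hy, abs_of_neg (by linarith)]; constructor <;> linarith
  have hx' : ∀ x ∈ Set.uIoc (-ρ) ρ, |x| ≤ ρ := fun x hx => by
    rw [Set.uIoc_of_le (by linarith)] at hx; exact abs_le.2 ⟨hx.1.le, hx.2⟩
  have hyp : ∀ y ∈ Set.uIoc 0 ρ, |y| ≤ ρ ∧ 0 ≤ y := fun x hx => by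
    rw [Set.uIoc_of_le (by linarith)] at hx
    exact ⟨abs_le.2 ⟨by linarith [hx.1], hx.2⟩, hx.1.le⟩
  have hym : ∀ y ∈ Set.uIoc (-ρ) 0, |y| ≤ ρ ∧ y ≤ 0 := fun x hx => by
    rw [Set.uIoc_of_le (by linarith)] at hx
    exact ⟨abs_le.2 ⟨hx.1.le, by linarith [hx.2]⟩, hx.2⟩
  have b1 := intervalIntegral.norm_integral_le_of_norm_le_const (a := -ρ) (b := ρ)
    fun x hx => key x ρ ε (Or.inr ⟨hρa, hx' x hx⟩) hεa (up ρ hρ.le).1 (up ρ hρ.le).2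
  have b2 := intervalIntegral.norm_integral_le_of_norm_le_const (a := -ρ) (b := ρ)
    fun x hx => key x (-ρ) (-ε) (Or.inr ⟨hρa', hx' x hx⟩) hεa' (dn _ (by linarith)).1
      (dn _ (by linarith)).2
  have b3 := intervalIntegral.norm_integral_le_of_norm_le_const (a := 0) (b := ρ)
    fun y hy => key ρ y ε (Or.inl ⟨hρa, (hyp y hy).1⟩) hεa (up _ (hyp y hy).2).1
      (up _ (hyp y hy).2).2
  have b4 := intervalIntegral.norm_integral_le_of_norm_le_const (a := 0) (b := ρ)
    fun y hy => key (-ρ) y ε (Or.inl ⟨hρa', (hyp y hy).1⟩) hεa (up _ (hyp y hy).2).1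
      (up _ (hyp y hy).2).2
  have b5 := intervalIntegral.norm_integral_le_of_norm_le_const (a := -ρ) (b := 0)
    fun y hy => key ρ y (-ε) (Or.inl ⟨hρa, (hym y hy).1⟩) hεa' (dn _ (hym y hy).2).1
      (dn _ (hym y hy).2).2
  have b6 := intervalIntegral.norm_integral_le_of_norm_le_const (a := -ρ) (b := 0)
    fun y hy => key (-ρ) y (-ε) (Or.inl ⟨hρa', (hym y hy).1⟩) hεa' (dn _ (hym y hy).2).1
      (dn _ (hym y hy).2).2
  rw [abs_of_pos (by linarith)] at b1 b2 b3 b4 b5 b6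
  rw [emid, hTp, hTm]
  simp only [rectInt, eε]
  have n6 : ∀ m1 m2 t1 t2 t3 t4 t5 t6 : ℂ,
      m1 - t1 + Complex.I * t3 - Complex.I * t4 + (t2 - m2 + Complex.I * t5 - Complex.I * t6)
        - (m1 - m2) = -t1 + t2 + (Complex.I * t3 - Complex.I * t4)
          + (Complex.I * t5 - Complex.I * t6) := by intros; ring
  rw [n6]
  refine (norm_add₃_le).trans ?_
  have c1 := norm_add_le (-(∫ x : ℝ in (-ρ)..ρ, D (x + ρ * Complex.I + ε * Complex.I)
    * ((x + ρ * Complex.I) ^ 2 - ρ ^ 2) * S (x + ρ * Complex.I)))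
    (∫ x : ℝ in (-ρ)..ρ, D (x + (-ρ : ℝ) * Complex.I + (-ε : ℝ) * Complex.I)
    * ((x + (-ρ : ℝ) * Complex.I) ^ 2 - ρ ^ 2) * S (x + (-ρ : ℝ) * Complex.I))
  rw [norm_neg] at c1
  have c2 : ∀ t t' : ℂ, ‖Complex.I * t - Complex.I * t'‖ ≤ ‖t‖ + ‖t'‖ := fun t t' => by
    simpa using norm_sub_le (Complex.I * t) (Complex.I * t')
  -- Two sides of length `2ρ` and four of length `ρ`, with integrands at most `3ρMK`, give `24ρ²MK`.
  refine (add_le_add (add_le_add (c1.trans (add_le_add b1 b2)) ((c2 _ _).trans (add_le_add b3 b4)))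
    ((c2 _ _).trans (add_le_add b5 b6))).trans (le_of_eq (by ring))

/-- Partial fractions of a kernel that decays like `ζ^(-n-1)`. The barycentric formula for the
constant `1` expands the reciprocal of the nodal polynomial; it needs at least one node, so `n = 0`
is separate. -/
theorem partialFraction_nodal {n : ℕ} {v : ℕ → ℂ} (hv : Set.InjOn v (Finset.range n)) {w ζ : ℂ}
    (hw : ∀ i ∈ Finset.range n, w ≠ v i) (hζ : ∀ i ∈ Finset.range n, ζ ≠ v i) (hζw : ζ ≠ w) :
    ((Lagrange.nodal (Finset.range n) v).eval w)⁻¹ * (ζ - w)⁻¹ +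
      ∑ i ∈ Finset.range n, Lagrange.nodalWeight (Finset.range n) v i * (v i - w)⁻¹ * (ζ - v i)⁻¹
      = (ζ - w)⁻¹ * ((Lagrange.nodal (Finset.range n) v).eval ζ)⁻¹ := by
  have key : ∀ x : ℂ, (∀ i ∈ Finset.range n, x ≠ v i) → n ≠ 0 →
      ((Lagrange.nodal (Finset.range n) v).eval x)⁻¹
        = ∑ i ∈ Finset.range n, Lagrange.nodalWeight (Finset.range n) v i * (x - v i)⁻¹ := by
    intro x hx hn
    have h1 := Lagrange.eval_interpolate_not_at_node (r := fun _ => (1 : ℂ)) hx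
    have h2 : Lagrange.interpolate (Finset.range n) v (fun _ => (1 : ℂ)) = 1 :=
      Lagrange.interpolate_one hv (by simpa using hn)
    rw [h2] at h1
    simp only [Polynomial.eval_one, mul_one] at h1
    exact inv_eq_of_mul_eq_one_right h1.symm
  rcases eq_or_ne n 0 with rfl | hn
  · simp
  rw [key w hw hn, key ζ hζ hn, Finset.sum_mul, ← Finset.sum_add_distrib, Finset.mul_sum]
  refine Finset.sum_congr rfl fun i hi => ?_
  have h1 := sub_ne_zero.2 (hw i hi)
  have h1' := sub_ne_zero.2 (hw i hi).symm
  have h2 := sub_ne_zero.2 (hζ i hi)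
  have h3 := sub_ne_zero.2 hζw
  field_simp
  ring

/-- A function that is holomorphic off the real line, has no jump there, and grows polynomially
is a polynomial. -/
theorem NoJump.eq_polynomial {D : ℂ → ℂ} (hJ : NoJump D) (hD : DifferentiableOn ℂ D offReal)
    {n : ℕ} (hO : D =O[Bornology.cobounded ℂ ⊓ 𝓟 offReal] fun z => ‖z‖ ^ n * |z.im|⁻¹) :
    ∃ P : ℂ[X], P.degree < n ∧ ∀ z ∈ offReal, D z = P.eval z := by
  -- Any `n` distinct nodes off the real axis would do: the claim is that `D` coincides with its own
  -- interpolation polynomial.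
  set v : ℕ → ℂ := fun i => (i + 1 : ℝ) * Complex.I with hv
  have hinj : Function.Injective v := by
    intro i j h
    have := congrArg Complex.im h
    simpa [hv] using this
  set s := Finset.range n with hs
  refine ⟨Lagrange.interpolate s v fun i => D (v i), ?_, fun w hw => ?_⟩
  · simpa [hs] using Lagrange.degree_interpolate_lt (s := s) (fun i => D (v i)) hinj.injOn
  by_cases hwv : ∃ i ∈ s, w = v i
  · obtain ⟨i, hi, rfl⟩ := hwv
    rw [Lagrange.eval_interpolate_at_node _ hinj.injOn hi]
  push Not at hwv
  rw [Lagrange.eval_interpolate_not_at_node _ hwv]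
  set V : Option ℕ → ℂ := fun o => o.elim w v with hV
  -- These are the partial fraction coefficients of `1 / ((ζ - w) ∏ (ζ - vᵢ))`. This kernel is
  -- `O(ρ^(-n-1))` on the contour and beats the growth `ρ^n` of `D`.
  set k : Option ℕ → ℂ := fun o => o.elim ((Lagrange.nodal s v).eval w)⁻¹
    fun i => Lagrange.nodalWeight s v i * (v i - w)⁻¹ with hk
  have hVs : ∀ o ∈ Finset.insertNone s, ‖V o‖ ≤ ‖w‖ + n ∧ (V o).im ≠ 0 := by
    intro o ho
    cases o with
    | none => exact ⟨by simp [hV], hw⟩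
    | some i =>
      have hi : i < n := by simpa [hs] using ho
      have hi' : (i : ℝ) + 1 ≤ n := by exact_mod_cast hi
      have h0 : (0 : ℝ) < i + 1 := by positivity
      refine ⟨?_, ?_⟩
      · simp only [hV, hv, Option.elim, norm_mul, Complex.norm_real, Complex.norm_I, mul_one,
          Real.norm_eq_abs, abs_of_pos h0]
        linarith [norm_nonneg w]
      · simpa [hV, hv] using h0.ne'
  obtain ⟨C, hC⟩ := hO.bound
  rw [eventually_inf_principal] at hC
  obtain ⟨R, -, hR⟩ := (hasBasis_cobounded_norm (E := ℂ)).eventually_iff.1 hC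
  -- The contour estimate says `X - ρ² Z = O(ρ)`. Since `X` and `Z` do not depend on `ρ`, dividing
  -- by `ρ²` forces `Z = 0`.
  set X : ℂ := ∑ o ∈ Finset.insertNone s, k o * (D (V o) * V o ^ 2) with hX
  set Z : ℂ := ∑ o ∈ Finset.insertNone s, k o * D (V o) with hZ
  set c : ℝ := 24 * (|C| * 4 ^ n * 2 ^ (n + 1)) with hc
  have main : ∀ᶠ ρ : ℝ in atTop, ‖Z‖ ≤ c * ρ⁻¹ + ‖X‖ * (ρ⁻¹) ^ 2 := by
    filter_upwards [eventually_ge_atTop R, eventually_gt_atTop (2 * (‖w‖ + n)),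
      eventually_gt_atTop 0] with ρ hρR hρ2 hρ
    have hb := norm_sum_le_of_noJump (Finset.insertNone s) hD hJ (M := |C| * (4 * ρ) ^ n)
      (K := (2 * ρ⁻¹) ^ (n + 1)) hρ V k
      (fun o ho => (Complex.abs_re_le_norm _).trans_lt (by
        have := (hVs o ho).1; have := norm_nonneg (V o); linarith))
      (fun o ho => (Complex.abs_im_le_norm _).trans_lt (by
        have := (hVs o ho).1; have := norm_nonneg (V o); linarith))
      (fun o ho => (hVs o ho).2) ?_ ?_
    · have e : ∑ o ∈ Finset.insertNone s, k o * (D (V o) * (V o ^ 2 - (ρ : ℂ) ^ 2))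
          = X - (ρ : ℂ) ^ 2 * Z := by
        rw [hX, hZ, Finset.mul_sum, ← Finset.sum_sub_distrib]
        exact Finset.sum_congr rfl fun _ _ => by ring
      rw [e] at hb
      have h1 : ρ ^ 2 * ‖Z‖ ≤ ‖X‖ + ‖X - (ρ : ℂ) ^ 2 * Z‖ := by
        have h2 := norm_sub_le X (X - (ρ : ℂ) ^ 2 * Z)
        rw [sub_sub_cancel, norm_mul] at h2
        simpa [abs_of_pos hρ] using h2
      have h3 : ‖X - (ρ : ℂ) ^ 2 * Z‖ ≤ 2 * Real.pi * ‖X - (ρ : ℂ) ^ 2 * Z‖ := by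
        have := Real.pi_gt_three
        nlinarith [norm_nonneg (X - (ρ : ℂ) ^ 2 * Z)]
      have h4 : 24 * ρ ^ 2 * (|C| * (4 * ρ) ^ n) * (2 * ρ⁻¹) ^ (n + 1) = c * ρ := by
        rw [hc, mul_pow, mul_pow, inv_pow]; field_simp; ring
      rw [h4] at hb
      have h5 : ρ ^ 2 * ‖Z‖ ≤ ‖X‖ + c * ρ := by linarith
      have : c * ρ⁻¹ + ‖X‖ * (ρ⁻¹) ^ 2 = (‖X‖ + c * ρ) / ρ ^ 2 := by field_simp; ring
      rw [this, le_div_iff₀ (by positivity)]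
      linarith
    · intro ζ hζ h1 h2
      have h3 := hR (x := ζ) (by simp; linarith) hζ
      have hp : 0 < |ζ.im| := abs_pos.2 hζ
      rw [norm_mul, norm_pow, norm_norm, norm_inv, Real.norm_eq_abs, abs_abs] at h3
      calc ‖D ζ‖ * |ζ.im| ≤ C * (‖ζ‖ ^ n * |ζ.im|⁻¹) * |ζ.im| := by gcongr
        _ = C * ‖ζ‖ ^ n := by field_simp
        _ ≤ |C| * (4 * ρ) ^ n := by gcongr; exact le_abs_self C
    · intro ζ h1 h2
      have hfar : ∀ u : ℂ, ‖u‖ ≤ ‖w‖ + n → ζ ≠ u ∧ ‖(ζ - u)⁻¹‖ ≤ 2 * ρ⁻¹ := by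
        intro u hu
        have h3 : ρ / 2 ≤ ‖ζ - u‖ := by have := norm_sub_norm_le ζ u; linarith
        have h4 : 0 < ‖ζ - u‖ := by linarith
        refine ⟨sub_ne_zero.1 (norm_pos_iff.1 h4), ?_⟩
        rw [norm_inv, show 2 * ρ⁻¹ = (ρ / 2)⁻¹ by field_simp]
        gcongr
      have hvi : ∀ i ∈ s, ‖v i‖ ≤ ‖w‖ + n := fun i hi =>
        (hVs (some i) (by simpa using hi)).1
      rw [Finset.sum_insertNone]
      simp only [hk, hV, Option.elim]
      rw [partialFraction_nodal hinj.injOn hwv (fun i hi => (hfar _ (hvi i hi)).1)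
        (hfar w (by simp)).1, Lagrange.eval_nodal, ← Finset.prod_inv_distrib, norm_mul, norm_prod,
        pow_succ']
      gcongr
      · exact (hfar w (by simp)).2
      · calc _ ≤ ∏ i ∈ s, 2 * ρ⁻¹ := Finset.prod_le_prod (fun _ _ => norm_nonneg _)
              fun i hi => (hfar _ (hvi i hi)).2
          _ = _ := by simp [hs]
  have hZ0 : Z = 0 := by
    rw [← norm_le_zero_iff]
    have ht : Tendsto (fun ρ : ℝ => c * ρ⁻¹ + ‖X‖ * (ρ⁻¹) ^ 2) atTop (𝓝 0) := by
      simpa using (tendsto_inv_atTop_zero.const_mul c).add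
        ((tendsto_inv_atTop_zero (𝕜 := ℝ).pow 2).const_mul ‖X‖)
    exact ge_of_tendsto ht main
  -- Solved for `D w`, the relation `Z = 0` is the barycentric form of Lagrange interpolation.
  rw [hZ, Finset.sum_insertNone] at hZ0
  simp only [hk, hV, Option.elim] at hZ0
  have hn0 : (Lagrange.nodal s v).eval w ≠ 0 := Lagrange.eval_nodal_not_at_node hwv
  have e2 : ∑ i ∈ s, Lagrange.nodalWeight s v i * (w - v i)⁻¹ * D (v i)
      = - ∑ i ∈ s, Lagrange.nodalWeight s v i * (v i - w)⁻¹ * D (v i) := by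
    rw [← Finset.sum_neg_distrib]
    refine Finset.sum_congr rfl fun i hi => ?_
    rw [← neg_sub (v i) w, inv_neg]; ring
  rw [e2, ← eq_neg_of_add_eq_zero_left hZ0]
  field_simp

/-! ### The Cauchy transform -/

/-- The Cauchy transform (without the factor `1 / (2πi)`). -/
noncomputable def cauchyT (f : ℝ → ℂ) (z : ℂ) : ℂ := ∫ x : ℝ, f x / ((x : ℂ) - z)

theorem abs_im_le_norm_ofReal_sub (x : ℝ) (z : ℂ) : |z.im| ≤ ‖(x : ℂ) - z‖ := by
  simpa using Complex.abs_im_le_norm ((x : ℂ) - z)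

theorem ofReal_sub_ne_zero {z : ℂ} (hz : z ∈ offReal) (x : ℝ) : (x : ℂ) - z ≠ 0 :=
  norm_pos_iff.1 ((abs_pos.2 hz).trans_le (abs_im_le_norm_ofReal_sub x z))

theorem norm_div_ofReal_sub_le {z : ℂ} (hz : z ∈ offReal) (x : ℝ) (c : ℂ) :
    ‖c / ((x : ℂ) - z)‖ ≤ ‖c‖ * |z.im|⁻¹ := by
  rw [norm_div, div_eq_mul_inv]
  have := abs_im_le_norm_ofReal_sub x z
  have := abs_pos.2 (mem_offReal.1 hz)
  gcongr

theorem aestronglyMeasurable_inv_ofReal_sub (z : ℂ) :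
    AEStronglyMeasurable (fun x : ℝ => ((x : ℂ) - z)⁻¹) volume :=
  (by fun_prop : Measurable fun x : ℝ => ((x : ℂ) - z)⁻¹).aestronglyMeasurable

theorem integrable_cauchy {f : ℝ → ℂ} (hf : Integrable f) {z : ℂ} (hz : z ∈ offReal) :
    Integrable fun x : ℝ => f x / ((x : ℂ) - z) := by
  refine (hf.norm.mul_const |z.im|⁻¹).mono' ?_
    (Eventually.of_forall fun x => norm_div_ofReal_sub_le hz x _)
  simp only [div_eq_mul_inv]
  exact hf.1.mul (aestronglyMeasurable_inv_ofReal_sub z)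

theorem norm_cauchyT_le {f : ℝ → ℂ} (hf : Integrable f) {z : ℂ} (hz : z ∈ offReal) :
    ‖cauchyT f z‖ ≤ (∫ x, ‖f x‖) * |z.im|⁻¹ := by
  rw [← integral_mul_const]
  exact norm_integral_le_of_norm_le (hf.norm.mul_const _)
    (Eventually.of_forall fun x => norm_div_ofReal_sub_le hz x _)

theorem cauchyT_add {f g : ℝ → ℂ} (hf : Integrable f) (hg : Integrable g) {z : ℂ}
    (hz : z ∈ offReal) : cauchyT (fun x => f x + g x) z = cauchyT f z + cauchyT g z := by
  simp only [cauchyT, add_div]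
  exact integral_add (integrable_cauchy hf hz) (integrable_cauchy hg hz)

theorem cauchyT_const_mul (c : ℂ) (f : ℝ → ℂ) (z : ℂ) :
    cauchyT (fun x => c * f x) z = c * cauchyT f z := by
  simp only [cauchyT, mul_div_assoc]
  exact integral_const_mul _ _

theorem cauchyT_sum {ι : Type*} (s : Finset ι) {f : ι → ℝ → ℂ}
    (hf : ∀ i ∈ s, Integrable (f i)) {z : ℂ} (hz : z ∈ offReal) :
    cauchyT (fun x => ∑ i ∈ s, f i x) z = ∑ i ∈ s, cauchyT (f i) z := by
  simp only [cauchyT, Finset.sum_div]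
  exact integral_finsetSum _ fun i hi => integrable_cauchy (hf i hi) hz

/-- Differentiation under the integral sign on a ball of radius `|Im z|/2`, where the kernel stays
uniformly away from its pole. -/
theorem differentiableOn_cauchyT {f : ℝ → ℂ} (hf : Integrable f) :
    DifferentiableOn ℂ (cauchyT f) offReal := by
  intro z hz
  have hp : 0 < |z.im| := abs_pos.2 hz
  have him : ∀ w ∈ Metric.ball z (|z.im| / 2), |z.im| / 2 ≤ |w.im| := by
    intro w hw
    have h1 := Complex.abs_im_le_norm (w - z)
    rw [Metric.mem_ball, dist_eq_norm] at hw
    have h2 := abs_sub_abs_le_abs_sub z.im w.im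
    rw [abs_sub_comm] at h2
    simp only [Complex.sub_im] at h1
    linarith
  have hoff : ∀ w ∈ Metric.ball z (|z.im| / 2), w ∈ offReal := fun w hw =>
    abs_pos.1 (lt_of_lt_of_le (by positivity) (him w hw))
  have key := hasDerivAt_integral_of_dominated_loc_of_deriv_le (μ := volume) (𝕜 := ℂ)
    (F := fun w (x : ℝ) => f x / ((x : ℂ) - w)) (F' := fun w (x : ℝ) => f x / ((x : ℂ) - w) ^ 2)
    (x₀ := z) (bound := fun x => ‖f x‖ * ((|z.im| / 2) ^ 2)⁻¹)
    (Metric.ball_mem_nhds z (by positivity : 0 < |z.im| / 2))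
    ?_ (integrable_cauchy hf hz) ?_ ?_ (hf.norm.mul_const _) ?_
  · exact key.2.differentiableAt.differentiableWithinAt
  · filter_upwards [Metric.ball_mem_nhds z (by positivity : 0 < |z.im| / 2)] with w hw
    exact (integrable_cauchy hf (hoff w hw)).1
  · simp only [div_eq_mul_inv]
    refine hf.1.mul ?_
    exact (by fun_prop : Measurable fun x : ℝ => (((x : ℂ) - z) ^ 2)⁻¹).aestronglyMeasurable
  · refine Eventually.of_forall fun x w hw => ?_
    rw [norm_div, div_eq_mul_inv, norm_pow]
    have := (him w hw).trans (abs_im_le_norm_ofReal_sub x w)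
    gcongr
  · refine Eventually.of_forall fun x w hw => ?_
    have h := ((hasDerivAt_id w).const_sub (x : ℂ)).inv (ofReal_sub_ne_zero (hoff w hw) x)
    have h2 := h.const_mul (f x)
    simp only [neg_neg, one_div, id] at h2
    exact h2

theorem mul_cauchyT {f : ℝ → ℂ} (hf : Integrable f) (hf' : Integrable fun x : ℝ => (x : ℂ) * f x)
    {z : ℂ} (hz : z ∈ offReal) :
    z * cauchyT f z = cauchyT (fun x => (x : ℂ) * f x) z - ∫ x, f x := by
  simp only [cauchyT]
  rw [← integral_sub (integrable_cauchy hf' hz) hf, ← integral_const_mul]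
  refine integral_congr_ae (Eventually.of_forall fun x => ?_)
  have := ofReal_sub_ne_zero hz x
  dsimp only
  field_simp
  ring

/-- Iteration of `z/(x - z) = x/(x - z) - 1`. It is an exact finite expansion at infinity whose
coefficients are the moments and whose remainder is again a Cauchy transform. -/
theorem pow_mul_cauchyT {f : ℝ → ℂ} {m : ℕ}
    (hf : ∀ j ≤ m, Integrable fun x : ℝ => (x : ℂ) ^ j * f x) {z : ℂ} (hz : z ∈ offReal) :
    z ^ m * cauchyT f z = cauchyT (fun x => (x : ℂ) ^ m * f x) z
      - ∑ j ∈ Finset.range m, z ^ (m - 1 - j) * ∫ x : ℝ, (x : ℂ) ^ j * f x := by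
  induction m with
  | zero => simp
  | succ m ih =>
    have hf1 : Integrable fun x : ℝ => (x : ℂ) * ((x : ℂ) ^ m * f x) := by
      simpa only [pow_succ', mul_assoc] using hf (m + 1) le_rfl
    have h1 := mul_cauchyT (hf m (by simp)) hf1 hz
    rw [pow_succ', mul_assoc, ih fun j hj => hf j (by omega), mul_sub, h1, Finset.mul_sum,
      Finset.sum_range_succ]
    have h2 : ∀ j ∈ Finset.range m, z * (z ^ (m - 1 - j) * (∫ x : ℝ, (x : ℂ) ^ j * f x))
        = z ^ (m + 1 - 1 - j) * ∫ x : ℝ, (x : ℂ) ^ j * f x := by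
      intro j hj
      have : m + 1 - 1 - j = (m - 1 - j) + 1 := by have := Finset.mem_range.1 hj; omega
      rw [this, pow_succ']; ring
    rw [Finset.sum_congr rfl h2]
    simp only [Nat.add_sub_cancel, Nat.sub_self, pow_zero, one_mul, pow_succ', mul_assoc]
    ring

theorem tendsto_mul_cauchyT {f : ℝ → ℂ} (hf : Integrable f) :
    Tendsto (fun y : ℝ => (y * Complex.I) * cauchyT f (y * Complex.I)) atTop
      (𝓝 (-∫ x, f x)) := by
  simp only [cauchyT, ← integral_const_mul, ← integral_neg]
  refine tendsto_integral_filter_of_dominated_convergence (fun x => ‖f x‖) ?_ ?_ hf.norm ?_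
  · refine Eventually.of_forall fun y => ?_
    simp only [div_eq_mul_inv]
    exact (hf.1.mul (aestronglyMeasurable_inv_ofReal_sub _)).const_mul _
  · filter_upwards [eventually_gt_atTop 0] with y hy
    refine Eventually.of_forall fun x => ?_
    have hz : (y * Complex.I : ℂ) ∈ offReal := by simpa [mem_offReal] using hy.ne'
    have := norm_div_ofReal_sub_le hz x (f x)
    rw [norm_mul]
    calc _ ≤ ‖(y * Complex.I : ℂ)‖ * (‖f x‖ * |(y * Complex.I : ℂ).im|⁻¹) := by gcongr
      _ = ‖f x‖ := by simp; field_simp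
  · refine Eventually.of_forall fun x => ?_
    have h1 : Tendsto (fun y : ℝ => ((x : ℂ) / (y * Complex.I))) atTop (𝓝 0) := by
      rw [tendsto_zero_iff_norm_tendsto_zero]
      simp only [norm_div, norm_mul, Complex.norm_I, mul_one, Complex.norm_real]
      exact tendsto_const_nhds.div_atTop tendsto_norm_atTop_atTop
    have h2 : Tendsto (fun y : ℝ => f x / ((x : ℂ) / (y * Complex.I) - 1)) atTop
        (𝓝 (f x / (0 - 1))) := tendsto_const_nhds.div (h1.sub_const 1) (by simp)
    rw [show -f x = f x / (0 - 1) by ring]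
    refine h2.congr' ?_
    filter_upwards [eventually_gt_atTop 0] with y hy
    have hz : (y * Complex.I : ℂ) ∈ offReal := by simpa [mem_offReal] using hy.ne'
    have h3 := ofReal_sub_ne_zero hz x
    have h4 : (y * Complex.I : ℂ) ≠ 0 := by simp [hy.ne']
    have h5 : (x : ℂ) / (y * Complex.I) - 1 = (x - y * Complex.I) / (y * Complex.I) := by
      rw [sub_div, div_self h4]
    rw [h5, div_div_eq_mul_div]
    ring

/-- Fast decay of the Cauchy transform along the imaginary axis forces moments to vanish. -/
theorem integral_pow_mul_eq_zero {f : ℝ → ℂ} {m : ℕ}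
    (hf : ∀ j < m, Integrable fun x : ℝ => (x : ℂ) ^ j * f x) {C : ℝ}
    (hC : ∀ᶠ y : ℝ in atTop, ‖cauchyT f (y * Complex.I)‖ ≤ C * (y⁻¹) ^ (m + 1)) :
    ∀ j < m, ∫ x : ℝ, (x : ℂ) ^ j * f x = 0 := by
  intro j
  induction j using Nat.strong_induction_on with
  | _ j ih =>
  intro hj
  have h1 := tendsto_mul_cauchyT (hf j hj)
  have h2 : Tendsto (fun y : ℝ => (y * Complex.I) *
      cauchyT (fun x => (x : ℂ) ^ j * f x) (y * Complex.I)) atTop (𝓝 0) := by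
    have h0 : Tendsto (fun y : ℝ => C * y⁻¹) atTop (𝓝 0) := by
      simpa using tendsto_inv_atTop_zero.const_mul C
    refine squeeze_zero_norm' ?_ h0
    filter_upwards [hC, eventually_ge_atTop 1] with y hy hy1
    have hy0 : 0 < y := by linarith
    have hz : (y * Complex.I : ℂ) ∈ offReal := by simpa [mem_offReal] using hy0.ne'
    -- The lower moments vanish by induction, so multiplying by `z^j` commutes with the Cauchy
    -- transform here. The hypothesis still leaves a decay `1/y` after multiplication by `y^(j+1)`,
    -- as `j < m`.
    have h3 := pow_mul_cauchyT (m := j) (fun i hi => hf i (by omega)) hz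
    rw [Finset.sum_eq_zero, sub_zero] at h3
    · rw [← h3, norm_mul, norm_mul (_ ^ j), norm_pow]
      have e : ‖(y * Complex.I : ℂ)‖ = y := by simp [abs_of_pos hy0]
      have hC0 : 0 ≤ C := by
        have := (norm_nonneg _).trans hy
        exact nonneg_of_mul_nonneg_left this (by positivity)
      rw [e]
      calc y * (y ^ j * ‖cauchyT f (y * Complex.I)‖)
          ≤ y * (y ^ j * (C * (y⁻¹) ^ (m + 1))) := by gcongr
        _ = C * ((y⁻¹) ^ (m + 1) * y ^ (j + 1)) := by ring
        _ ≤ C * ((y⁻¹) ^ (m + 1) * y ^ m) := by gcongr; omega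
        _ = C * y⁻¹ := by rw [pow_succ, inv_pow]; field_simp
    · intro i hi
      have := Finset.mem_range.1 hi
      rw [ih i this (by omega), mul_zero]
  exact neg_eq_zero.1 (tendsto_nhds_unique h1 h2)

/-! ### The Poisson kernel -/

/-- The Poisson kernel of the upper half-plane (without the factor `1 / π`). -/
noncomputable def poisson (ε s : ℝ) : ℝ := ε / (s ^ 2 + ε ^ 2)

theorem poisson_nonneg {ε : ℝ} (hε : 0 ≤ ε) (s : ℝ) : 0 ≤ poisson ε s := by
  unfold poisson; positivity

theorem continuous_poisson {ε : ℝ} (hε : 0 < ε) : Continuous (poisson ε) := by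
  unfold poisson
  exact continuous_const.div (by fun_prop) fun s => by positivity

theorem poisson_le {ε : ℝ} (hε : 0 < ε) (s : ℝ) : poisson ε s ≤ ε⁻¹ := by
  unfold poisson
  rw [div_le_iff₀ (by positivity)]
  have : ε⁻¹ * ε = 1 := inv_mul_cancel₀ hε.ne'
  nlinarith [mul_nonneg (inv_nonneg.2 hε.le) (sq_nonneg s)]

theorem poisson_eq {ε : ℝ} (hε : 0 < ε) (s : ℝ) :
    poisson ε s = ε⁻¹ * (1 + (ε⁻¹ * s) ^ 2)⁻¹ := by
  unfold poisson
  field_simp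
  ring

theorem integrable_poisson {ε : ℝ} (hε : 0 < ε) : Integrable (poisson ε) := by
  have := (integrable_inv_one_add_sq.comp_mul_left' (inv_ne_zero hε.ne')).const_mul ε⁻¹
  exact this.congr (Eventually.of_forall fun s => (poisson_eq hε s).symm)

theorem integral_poisson {ε : ℝ} (hε : 0 < ε) : ∫ s, poisson ε s = Real.pi := by
  simp only [poisson_eq hε, integral_const_mul]
  rw [Measure.integral_comp_mul_left (fun s => (1 + s ^ 2)⁻¹) ε⁻¹, integral_univ_inv_one_add_sq]
  simp [abs_of_pos hε]
  field_simp

theorem integral_poisson_sub {ε : ℝ} (hε : 0 < ε) (x : ℝ) :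
    ∫ t, poisson ε (t - x) = Real.pi := by
  rw [integral_sub_right_eq_self (poisson ε), integral_poisson hε]

theorem inv_sub_sub_inv_sub (t x : ℝ) {ε : ℝ} (hε : 0 < ε) :
    ((t : ℂ) - (x + ε * Complex.I))⁻¹ - ((t : ℂ) - (x - ε * Complex.I))⁻¹
      = 2 * Complex.I * (poisson ε (t - x) : ℝ) := by
  have h1 : (t : ℂ) - (x + ε * Complex.I) ≠ 0 :=
    ofReal_sub_ne_zero (by simpa [mem_offReal] using hε.ne') t
  have h2 : (t : ℂ) - (x - ε * Complex.I) ≠ 0 :=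
    ofReal_sub_ne_zero (by simpa [mem_offReal] using hε.ne') t
  have h3 : (((t - x) ^ 2 + ε ^ 2 : ℝ) : ℂ)
      = ((t : ℂ) - (x + ε * Complex.I)) * ((t : ℂ) - (x - ε * Complex.I)) := by
    push_cast; linear_combination ε ^ 2 * Complex.I_sq
  rw [poisson, Complex.ofReal_div, h3]
  field_simp
  ring

/-- Turns questions about the jump into questions about an approximate identity. -/
theorem cauchyT_sub_cauchyT {f : ℝ → ℂ} (hf : Integrable f) (x : ℝ) {ε : ℝ} (hε : 0 < ε) :
    cauchyT f (x + ε * Complex.I) - cauchyT f (x - ε * Complex.I)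
      = 2 * Complex.I * ∫ t, f t * (poisson ε (t - x) : ℝ) := by
  simp only [cauchyT]
  rw [← integral_sub (integrable_cauchy hf (by simpa [mem_offReal] using hε.ne'))
    (integrable_cauchy hf (by simpa [mem_offReal] using hε.ne')), ← integral_const_mul]
  refine integral_congr_ae (Eventually.of_forall fun t => ?_)
  have := inv_sub_sub_inv_sub t x hε
  dsimp only
  rw [div_eq_mul_inv, div_eq_mul_inv, ← mul_sub, this]
  ring

/-- The kernel decreases in `|s|` to `0`, so it is the integral of minus its radial derivative. This
is the layer-cake form: a superposition of indicators of balls. -/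
theorem ofReal_poisson_le_lintegral {ε : ℝ} (hε : 0 < ε) (s : ℝ) :
    ENNReal.ofReal (poisson ε s) ≤
      ∫⁻ r in Set.Ioi |s|, ENNReal.ofReal (2 * ε * r / (r ^ 2 + ε ^ 2) ^ 2) := by
  have hd : ∀ r ∈ Set.Ici |s|, HasDerivAt (fun r => -poisson ε r)
      (2 * ε * r / (r ^ 2 + ε ^ 2) ^ 2) r := by
    intro r _
    have h1 : HasDerivAt (fun r : ℝ => r ^ 2 + ε ^ 2) (2 * r) r := by
      simpa using (hasDerivAt_pow 2 r).add_const (ε ^ 2)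
    have h2 := ((h1.inv (by positivity)).const_mul ε).neg
    have e : (fun r => -poisson ε r) = fun r => -(ε * (r ^ 2 + ε ^ 2)⁻¹) := by
      funext r
      rw [poisson, div_eq_mul_inv]
    rw [e]
    refine h2.congr_deriv ?_
    field_simp
  have ht : Tendsto (fun r => -poisson ε r) atTop (𝓝 (-0)) := by
    refine Tendsto.neg ?_
    unfold poisson
    refine tendsto_const_nhds.div_atTop (tendsto_atTop_add_const_right _ _
      (tendsto_pow_atTop (by norm_num)))
  have h0 : ∀ r ∈ Set.Ioi |s|, 0 ≤ 2 * ε * r / (r ^ 2 + ε ^ 2) ^ 2 := fun r hr => by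
    have : 0 < r := (abs_nonneg s).trans_lt hr
    positivity
  have hi := integrableOn_Ioi_deriv_of_nonneg' hd h0 ht
  have he := integral_Ioi_of_hasDerivAt_of_nonneg' hd h0 ht
  rw [← ofReal_integral_eq_lintegral_ofReal hi (by
    filter_upwards [ae_restrict_mem measurableSet_Ioi] with r hr using h0 r hr), he]
  simp [poisson, sq_abs]

theorem lintegral_poisson {ε : ℝ} (hε : 0 < ε) :
    ∫⁻ s, ENNReal.ofReal (poisson ε s) = ENNReal.ofReal Real.pi := by
  rw [← ofReal_integral_eq_lintegral_ofReal (integrable_poisson hε)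
    (Eventually.of_forall (poisson_nonneg hε.le)), integral_poisson hε]

/-- By the layer-cake form and Tonelli only the ball integrals `Φ r` matter. Small radii contribute
a multiple of `η`; large radii contribute `O(ε)` by linear growth. It serves both for Lebesgue
points and for the `L¹` modulus of continuity. -/
theorem tendsto_lintegral_mul_poisson {g : ℝ → ℝ≥0∞} (hg : AEMeasurable g) {x : ℝ}
    (h1 : ∀ η : ℝ≥0, 0 < η → ∃ δ > 0, ∀ r : ℝ, 0 < r → r < δ →
      ∫⁻ t in Metric.closedBall x r, g t ≤ η * ENNReal.ofReal r)
    (h2 : ∀ δ : ℝ, 0 < δ → ∃ B : ℝ≥0, ∀ r : ℝ, δ ≤ r →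
      ∫⁻ t in Metric.closedBall x r, g t ≤ B * ENNReal.ofReal r) :
    Tendsto (fun ε : ℝ => ∫⁻ t, g t * ENNReal.ofReal (poisson ε (t - x))) (𝓝[>] 0) (𝓝 0) := by
  set Φ : ℝ → ℝ≥0∞ := fun r => ∫⁻ t in Metric.closedBall x r, g t with hΦ
  have step : ∀ ε : ℝ, 0 < ε → ∫⁻ t, g t * ENNReal.ofReal (poisson ε (t - x)) ≤
      ∫⁻ r in Set.Ioi 0, ENNReal.ofReal (2 * ε * r / (r ^ 2 + ε ^ 2) ^ 2) * Φ r := by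
    intro ε hε
    set k : ℝ → ℝ≥0∞ := fun r => ENNReal.ofReal (2 * ε * r / (r ^ 2 + ε ^ 2) ^ 2) with hk
    have hkm : Measurable k := by rw [hk]; fun_prop
    have hS : MeasurableSet {q : ℝ × ℝ | |q.1 - x| ≤ q.2} :=
      (isClosed_le (by fun_prop) (by fun_prop)).measurableSet
    calc ∫⁻ t, g t * ENNReal.ofReal (poisson ε (t - x))
        ≤ ∫⁻ t, g t * ∫⁻ r in Set.Ioi |t - x|, k r := by
          refine lintegral_mono fun t => ?_
          gcongr
          exact ofReal_poisson_le_lintegral hε _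
      _ ≤ ∫⁻ t, ∫⁻ r in Set.Ioi 0, g t * (if |t - x| ≤ r then k r else 0) := by
          refine lintegral_mono fun t => ?_
          rw [lintegral_const_mul _ (Measurable.ite measurableSet_Ici hkm measurable_const)]
          refine mul_le_mul' le_rfl ?_
          rw [← lintegral_indicator measurableSet_Ioi, ← lintegral_indicator measurableSet_Ioi]
          refine lintegral_mono fun r => ?_
          by_cases h : |t - x| < r
          · have h0 : 0 < r := (abs_nonneg _).trans_lt h
            simp [Set.indicator, h, h0, h.le]
          · simp [Set.indicator, h]
      _ = ∫⁻ r in Set.Ioi 0, ∫⁻ t, g t * (if |t - x| ≤ r then k r else 0) := by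
          refine lintegral_lintegral_swap (AEMeasurable.mul hg.comp_fst ?_)
          exact (Measurable.ite hS (hkm.comp measurable_snd) measurable_const).aemeasurable
      _ = _ := by
          refine lintegral_congr fun r => ?_
          rw [hΦ, mul_comm]
          dsimp only
          rw [← lintegral_indicator Metric.isClosed_closedBall.measurableSet,
            ← lintegral_mul_const' _ _ ENNReal.ofReal_ne_top]
          refine lintegral_congr fun t => ?_
          simp only [Set.indicator, Metric.mem_closedBall, Real.dist_eq]
          split_ifs <;> simp [hk]
  rw [ENNReal.tendsto_nhds_zero]
  intro η' hη'
  obtain ⟨η, hη, hηη⟩ : ∃ η : ℝ≥0, 0 < η ∧ 4 * ENNReal.ofReal Real.pi * η ≤ η' := by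
    have ht : Tendsto (fun η : ℝ≥0 => 4 * ENNReal.ofReal Real.pi * (η : ℝ≥0∞)) (𝓝[>] 0) (𝓝 0) := by
      have := ENNReal.Tendsto.const_mul (f := 𝓝[>] (0 : ℝ≥0)) (a := 4 * ENNReal.ofReal Real.pi)
        ((ENNReal.continuous_coe.tendsto (0 : ℝ≥0)).mono_left nhdsWithin_le_nhds)
        (Or.inr (by finiteness))
      simpa using this
    obtain ⟨η, h⟩ := ((ENNReal.tendsto_nhds_zero.1 ht η' hη').and self_mem_nhdsWithin).exists
    exact ⟨η, h.2, h.1⟩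
  obtain ⟨δ, hδ, hs⟩ := h1 η hη
  obtain ⟨B, hB⟩ := h2 δ hδ
  have hev : ∀ᶠ ε : ℝ in 𝓝[>] 0, ENNReal.ofReal (ε * (2 * (1 + (δ ^ 2)⁻¹) * Real.pi)) * B
      ≤ 2 * ENNReal.ofReal Real.pi * η := by
    have ht : Tendsto (fun ε : ℝ => ENNReal.ofReal (ε * (2 * (1 + (δ ^ 2)⁻¹) * Real.pi)) * B)
        (𝓝[>] 0) (𝓝 0) := by
      have h0 : Tendsto (fun ε : ℝ => ENNReal.ofReal (ε * (2 * (1 + (δ ^ 2)⁻¹) * Real.pi)))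
          (𝓝[>] 0) (𝓝 (ENNReal.ofReal (0 * (2 * (1 + (δ ^ 2)⁻¹) * Real.pi)))) :=
        ((ENNReal.continuous_ofReal.comp (by fun_prop)).tendsto 0).mono_left nhdsWithin_le_nhds
      have := ENNReal.Tendsto.mul_const (b := (B : ℝ≥0∞)) h0 (Or.inr ENNReal.coe_ne_top)
      simpa using this
    refine ENNReal.tendsto_nhds_zero.1 ht _ ?_
    have : 0 < ENNReal.ofReal Real.pi := ENNReal.ofReal_pos.2 Real.pi_pos
    have : (0 : ℝ≥0∞) < η := by exact_mod_cast hη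
    positivity
  filter_upwards [hev, self_mem_nhdsWithin] with ε hε1 hε
  have hε : 0 < ε := hε
  refine (step ε hε).trans ?_
  -- Integrating the layer density against `r` thus costs only twice the mass of the kernel.
  have hkr : ∀ r : ℝ, 0 < r → 2 * ε * r / (r ^ 2 + ε ^ 2) ^ 2 * r ≤ 2 * poisson ε r := by
    intro r hr
    unfold poisson
    rw [div_mul_eq_mul_div, ← mul_div_assoc, div_le_div_iff₀ (by positivity) (by positivity)]
    have : 0 < 2 * ε * (r ^ 2 + ε ^ 2) := by positivity
    nlinarith [mul_pos this (pow_pos hε 2)]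
  have hpt : ∀ r ∈ Set.Ioi (0 : ℝ), ENNReal.ofReal (2 * ε * r / (r ^ 2 + ε ^ 2) ^ 2) * Φ r ≤
      ENNReal.ofReal (poisson ε r) * (2 * η) +
        ENNReal.ofReal (ε * (2 * (1 + (δ ^ 2)⁻¹)) * (1 + r ^ 2)⁻¹) * B := by
    intro r hr
    have hr : 0 < r := hr
    have hmul : ENNReal.ofReal (2 * ε * r / (r ^ 2 + ε ^ 2) ^ 2) * ENNReal.ofReal r
        ≤ ENNReal.ofReal (2 * poisson ε r) := by
      rw [← ENNReal.ofReal_mul (by positivity)]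
      exact ENNReal.ofReal_le_ofReal (hkr r hr)
    rcases lt_or_ge r δ with h | h
    · refine le_trans ?_ le_self_add
      calc _ ≤ ENNReal.ofReal (2 * ε * r / (r ^ 2 + ε ^ 2) ^ 2) * (η * ENNReal.ofReal r) := by
            gcongr; exact hs r hr h
        _ = ENNReal.ofReal (2 * ε * r / (r ^ 2 + ε ^ 2) ^ 2) * ENNReal.ofReal r * η := by ring
        _ ≤ ENNReal.ofReal (2 * poisson ε r) * η := by gcongr
        _ = _ := by
          rw [ENNReal.ofReal_mul (by norm_num)]
          simp; ring
    · refine le_trans ?_ le_add_self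
      calc _ ≤ ENNReal.ofReal (2 * ε * r / (r ^ 2 + ε ^ 2) ^ 2) * (B * ENNReal.ofReal r) := by
            gcongr; exact hB r h
        _ = ENNReal.ofReal (2 * ε * r / (r ^ 2 + ε ^ 2) ^ 2) * ENNReal.ofReal r * B := by ring
        _ ≤ ENNReal.ofReal (2 * poisson ε r) * B := by gcongr
        _ ≤ _ := by
          refine mul_le_mul' (ENNReal.ofReal_le_ofReal ?_) le_rfl
          have e1 : (δ ^ 2)⁻¹ * δ ^ 2 = 1 := inv_mul_cancel₀ (by positivity)
          have e2 : δ ^ 2 ≤ r ^ 2 := by gcongr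
          have e3 : 1 ≤ (δ ^ 2)⁻¹ * r ^ 2 := by
            rw [← e1]; gcongr
          have e4 : poisson ε r ≤ ε * ((1 + (δ ^ 2)⁻¹) * (1 + r ^ 2)⁻¹) := by
            unfold poisson
            rw [div_eq_mul_inv]
            gcongr
            rw [← div_eq_mul_inv, le_div_iff₀ (by positivity), inv_mul_le_iff₀ (by positivity)]
            nlinarith [mul_nonneg (inv_nonneg.2 (sq_nonneg δ)) (sq_nonneg ε), sq_nonneg ε]
          linarith
  calc ∫⁻ r in Set.Ioi 0, ENNReal.ofReal (2 * ε * r / (r ^ 2 + ε ^ 2) ^ 2) * Φ r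
      ≤ ∫⁻ r in Set.Ioi 0, (ENNReal.ofReal (poisson ε r) * (2 * η) +
        ENNReal.ofReal (ε * (2 * (1 + (δ ^ 2)⁻¹)) * (1 + r ^ 2)⁻¹) * B) :=
        setLIntegral_mono' measurableSet_Ioi hpt
    _ ≤ ∫⁻ r, (ENNReal.ofReal (poisson ε r) * (2 * η) +
        ENNReal.ofReal (ε * (2 * (1 + (δ ^ 2)⁻¹)) * (1 + r ^ 2)⁻¹) * B) := setLIntegral_le_lintegral _ _
    _ = ENNReal.ofReal Real.pi * (2 * η) +
        ENNReal.ofReal (ε * (2 * (1 + (δ ^ 2)⁻¹) * Real.pi)) * B := by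
        rw [lintegral_add_left' (((continuous_poisson hε).measurable.ennreal_ofReal).mul_const
            _).aemeasurable, lintegral_mul_const' _ _ (by finiteness),
          lintegral_mul_const' _ _ (by finiteness), lintegral_poisson hε,
          ← ofReal_integral_eq_lintegral_ofReal (integrable_inv_one_add_sq.const_mul _)
            (Eventually.of_forall fun r => by positivity), integral_const_mul,
          integral_univ_inv_one_add_sq]
        ring_nf
    _ ≤ ENNReal.ofReal Real.pi * (2 * η) + 2 * ENNReal.ofReal Real.pi * η := by gcongr
    _ = 4 * ENNReal.ofReal Real.pi * η := by ring
    _ ≤ η' := hηη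

/-- The Poisson integral of `f` converges to `π f` almost everywhere. -/
theorem ae_tendsto_integral_mul_poisson {f : ℝ → ℂ} (hf : LocallyIntegrable f) {M : ℝ≥0}
    (hM : ∀ x r : ℝ, 1 ≤ r → ∫⁻ t in Metric.closedBall x r, ‖f t‖ₑ ≤ M * ENNReal.ofReal r)
    (hi : ∀ x ε : ℝ, 0 < ε → Integrable fun t => f t * (poisson ε (t - x) : ℝ)) :
    ∀ᵐ x : ℝ, Tendsto (fun ε : ℝ => ∫ t, f t * (poisson ε (t - x) : ℝ)) (𝓝[>] 0)
      (𝓝 (Real.pi * f x)) := by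
  -- Convergence holds at each Lebesgue point of `f`.
  filter_upwards [IsUnifLocDoublingMeasure.ae_tendsto_average_norm_sub volume hf 1] with x hx
  have hloc : ∀ r, IntegrableOn (fun t => f t - f x) (Metric.closedBall x r) := fun r =>
    (hf.integrableOn_isCompact (isCompact_closedBall x r)).sub
      (integrableOn_const (by rw [Real.volume_closedBall]; exact ENNReal.ofReal_ne_top))
  have key := tendsto_lintegral_mul_poisson (g := fun t => ‖f t - f x‖ₑ) (x := x)
    (hf.aestronglyMeasurable.sub aestronglyMeasurable_const).enorm ?_ ?_
  · rw [tendsto_iff_norm_sub_tendsto_zero, ← tendsto_zero_iff_norm_tendsto_zero,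
      tendsto_zero_iff_enorm_tendsto_zero]
    refine tendsto_of_tendsto_of_tendsto_of_le_of_le' tendsto_const_nhds key
      (Eventually.of_forall fun _ => zero_le) ?_
    filter_upwards [self_mem_nhdsWithin] with ε hε
    have hε : 0 < ε := hε
    have hp : Integrable fun t => f x * (poisson ε (t - x) : ℝ) :=
      (((integrable_poisson hε).comp_sub_right x).ofReal (𝕜 := ℂ)).const_mul _
    have e : (Real.pi : ℂ) * f x = ∫ t, f x * (poisson ε (t - x) : ℝ) := by
      rw [integral_const_mul, integral_complex_ofReal, integral_poisson_sub hε, mul_comm]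
    rw [e, ← integral_sub (hi x ε hε) hp]
    refine (enorm_integral_le_lintegral_enorm _).trans (lintegral_mono fun t => ?_)
    rw [← sub_mul, enorm_mul]
    gcongr
    rw [← ofReal_norm, Complex.norm_real, Real.norm_of_nonneg (poisson_nonneg hε.le _)]
  · intro η hη
    have h1 := hx (l := 𝓝[>] (0 : ℝ)) (fun _ => x) id tendsto_id (by
      filter_upwards [self_mem_nhdsWithin] with r hr
      simpa using le_of_lt hr)
    -- Half of `η`, because the ball of radius `r` has length `2r`.
    have h2 := h1.eventually (gt_mem_nhds (show (0 : ℝ) < η / 2 by positivity))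
    obtain ⟨δ, hδ, h3⟩ := mem_nhdsGT_iff_exists_Ioo_subset.1 h2
    refine ⟨δ, hδ, fun r hr hrδ => ?_⟩
    have h4 : (⨍ y in Metric.closedBall x r, ‖f y - f x‖) < η / 2 := h3 ⟨hr, hrδ⟩
    rw [← ofReal_integral_norm_eq_lintegral_enorm (hloc r)]
    have h5 : ∫ y in Metric.closedBall x r, ‖f y - f x‖
        = 2 * r * ⨍ y in Metric.closedBall x r, ‖f y - f x‖ := by
      rw [setAverage_eq, smul_eq_mul, measureReal_def, Real.volume_closedBall,
        ENNReal.toReal_ofReal (by positivity)]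
      field_simp
    rw [h5, ← ENNReal.ofReal_coe_nnreal, ← ENNReal.ofReal_mul η.coe_nonneg]
    refine ENNReal.ofReal_le_ofReal ?_
    nlinarith
  · intro δ hδ
    -- The growth bound is only available for radii at least `1`, so the ball is enlarged by the
    -- factor `1 + δ⁻¹`.
    refine ⟨M * (1 + δ⁻¹).toNNReal + 2 * ‖f x‖₊, fun r hr => ?_⟩
    have hr0 : 0 < r := hδ.trans_le hr
    calc ∫⁻ t in Metric.closedBall x r, ‖f t - f x‖ₑ
        ≤ ∫⁻ t in Metric.closedBall x r, (‖f t‖ₑ + ‖f x‖ₑ) :=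
          lintegral_mono fun t => enorm_sub_le
      _ = (∫⁻ t in Metric.closedBall x r, ‖f t‖ₑ) + ‖f x‖ₑ * ENNReal.ofReal (2 * r) := by
          rw [lintegral_add_right' _ aemeasurable_const, setLIntegral_const, Real.volume_closedBall]
      _ ≤ M * ENNReal.ofReal ((1 + δ⁻¹) * r) + ‖f x‖ₑ * ENNReal.ofReal (2 * r) := by
          gcongr
          have e3 : 1 ≤ δ⁻¹ * r := by
            rw [← inv_mul_cancel₀ hδ.ne']; gcongr
          refine le_trans ?_ (hM x ((1 + δ⁻¹) * r) (by linarith))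
          exact lintegral_mono_set (Metric.closedBall_subset_closedBall (by linarith))
      _ = _ := by
          rw [ENNReal.ofReal_mul (by positivity), ENNReal.ofReal_mul (by norm_num)]
          push_cast
          rw [ENNReal.ofReal_ofNat, ← enorm_eq_nnnorm]
          simp only [ENNReal.ofReal]
          ring

/-! ### Fatou's theorem for the upper half-plane -/

/-- The closed upper half-plane. -/
def closedUpper : Set ℂ := {z | 0 ≤ z.im}

/-- Cauchy's theorem on `[-R, R] × [0, R]`: the three sides off the axis have total length `4R` and
integrand `O(R⁻²)`. -/
theorem integral_eq_zero_of_differentiableOn_closedUpper {k : ℂ → ℂ}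
    (hk : DifferentiableOn ℂ k closedUpper) (hi : Integrable fun x : ℝ => k x) {C R₀ : ℝ}
    (hC : ∀ z ∈ closedUpper, R₀ ≤ ‖z‖ → ‖k z‖ ≤ C * (‖z‖ ^ 2)⁻¹) : ∫ x : ℝ, k x = 0 := by
  have h1 : Tendsto (fun R : ℝ => ∫ x : ℝ in (-R)..R, k x) atTop (𝓝 (∫ x : ℝ, k x)) :=
    intervalIntegral_tendsto_integral hi tendsto_neg_atTop_atBot tendsto_id
  refine tendsto_nhds_unique h1 ?_
  have h0 : Tendsto (fun R : ℝ => (4 * |C|) * R⁻¹) atTop (𝓝 0) := by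
    simpa using tendsto_inv_atTop_zero.const_mul (4 * |C|)
  refine squeeze_zero_norm' ?_ h0
  filter_upwards [eventually_ge_atTop R₀, eventually_gt_atTop 0] with R hR hR0
  have hz := rectInt_eq_zero (a := -R) (b := R) (c := 0) (d := R) (by linarith) hR0.le
    (hk.mono fun z hz => hz.2.1)
  have hb : ∀ z ∈ closedUpper, R ≤ ‖z‖ → ‖k z‖ ≤ |C| * (R ^ 2)⁻¹ := by
    intro z hz hzR
    refine (hC z hz (hR.trans hzR)).trans ?_
    gcongr
    exact le_abs_self C
  have n1 : ∀ x y : ℝ, |x| ≤ ‖(x : ℂ) + y * Complex.I‖ := fun x y => by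
    simpa using Complex.abs_re_le_norm ((x : ℂ) + y * Complex.I)
  have n2 : ∀ x y : ℝ, |y| ≤ ‖(x : ℂ) + y * Complex.I‖ := fun x y => by
    simpa using Complex.abs_im_le_norm ((x : ℂ) + y * Complex.I)
  have m : ∀ x y : ℝ, 0 ≤ y → (x : ℂ) + y * Complex.I ∈ closedUpper := fun x y hy => by
    simpa [closedUpper] using hy
  have hRa : |R| = R := abs_of_pos hR0
  have b1 := intervalIntegral.norm_integral_le_of_norm_le_const (a := -R) (b := R)
    fun x _ => hb _ (m x R hR0.le) (by simpa [hRa] using n2 x R)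
  have b2 := intervalIntegral.norm_integral_le_of_norm_le_const (a := 0) (b := R)
    fun y hy => hb _ (m R y (by rw [Set.uIoc_of_le hR0.le] at hy; exact hy.1.le))
      (by simpa [hRa] using n1 R y)
  have b3 := intervalIntegral.norm_integral_le_of_norm_le_const (a := 0) (b := R)
    fun y hy => hb _ (m (-R) y (by rw [Set.uIoc_of_le hR0.le] at hy; exact hy.1.le))
      (by simpa only [abs_neg, hRa] using n1 (-R) y)
  rw [sub_neg_eq_add, abs_of_pos (add_pos hR0 hR0)] at b1
  rw [sub_zero, hRa] at b2 b3
  simp only [rectInt, Complex.ofReal_zero, zero_mul, add_zero] at hz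
  have e : ∫ x : ℝ in (-R)..R, k x = (∫ x : ℝ in (-R)..R, k (x + R * Complex.I))
      - Complex.I * (∫ y : ℝ in (0)..R, k (R + y * Complex.I))
      + Complex.I * (∫ y : ℝ in (0)..R, k ((-R : ℝ) + y * Complex.I)) := by
    linear_combination hz
  rw [e]
  refine (norm_add_le _ _).trans ?_
  have c1 := norm_sub_le (∫ x : ℝ in (-R)..R, k (x + R * Complex.I))
    (Complex.I * (∫ y : ℝ in (0)..R, k (R + y * Complex.I)))
  rw [norm_mul, Complex.norm_I, one_mul] at c1 ⊢
  refine (add_le_add (c1.trans (add_le_add b1 b2)) b3).trans (le_of_eq ?_)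
  field_simp
  ring

/-- The Poisson integral formula for bounded holomorphic functions on the upper half-plane. -/
theorem integral_mul_poisson_eq {g : ℂ → ℂ} (hg : DifferentiableOn ℂ g closedUpper) {M : ℝ}
    (hM : ∀ z ∈ closedUpper, ‖g z‖ ≤ M) {x y : ℝ} (hy : 0 < y) :
    ∫ t : ℝ, g t * (poisson y (t - x) : ℝ) = Real.pi * g (x + y * Complex.I) := by
  set z : ℂ := x + y * Complex.I with hz
  have hzi : z.im = y := by simp [hz]
  set zc : ℂ := x - y * Complex.I with hzc
  have hzci : zc.im = -y := by simp [hzc]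
  have hmem : closedUpper ∈ 𝓝 z :=
    mem_of_superset ((isOpen_lt continuous_const Complex.continuous_im).mem_nhds
      (show 0 < z.im by rw [hzi]; exact hy)) fun w (hw : 0 < w.im) => hw.le
  have hne : ∀ ζ ∈ closedUpper, ζ - zc ≠ 0 := fun ζ hζ h0 => by
    have h1 : 0 ≤ ζ.im := hζ
    rw [sub_eq_zero.1 h0, hzci] at h1; linarith
  -- Subtracting `g z` removes the pole at `z`, and the other pole `zc` is in the lower half-plane.
  -- On the real line `k` is the Poisson kernel times `(g t - g z)/y`, and at infinity it decays
  -- quadratically, so no residue has to be computed.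
  set k : ℂ → ℂ := fun ζ => dslope g z ζ * (ζ - zc)⁻¹ with hk
  have hkd : DifferentiableOn ℂ k closedUpper :=
    ((Complex.differentiableOn_dslope hmem).2 hg).mul
      (DifferentiableOn.inv (by fun_prop) hne)
  have hkt : ∀ t : ℝ, k t = (y : ℂ)⁻¹ * ((g t - g z) * (poisson y (t - x) : ℝ)) := by
    intro t
    have h1 : (t : ℂ) - z ≠ 0 := ofReal_sub_ne_zero (by rw [mem_offReal, hzi]; exact hy.ne') t
    have h2 : (t : ℂ) - zc ≠ 0 :=
      ofReal_sub_ne_zero (by rw [mem_offReal, hzci]; exact neg_ne_zero.2 hy.ne') t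
    have h3 : (((t - x) ^ 2 + y ^ 2 : ℝ) : ℂ) = ((t : ℂ) - z) * ((t : ℂ) - zc) := by
      rw [hz, hzc]; push_cast; linear_combination y ^ 2 * Complex.I_sq
    have h4 : (y : ℂ) ≠ 0 := by exact_mod_cast hy.ne'
    simp only [hk]
    rw [dslope_of_ne _ (sub_ne_zero.1 h1), slope_def_field, poisson, Complex.ofReal_div, h3]
    field_simp
  have hgc : Continuous fun t : ℝ => g t :=
    hg.continuousOn.comp_continuous Complex.continuous_ofReal fun t => by simp [closedUpper]
  have hP : Integrable fun t : ℝ => ((poisson y (t - x) : ℝ) : ℂ) :=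
    ((integrable_poisson hy).comp_sub_right x).ofReal
  have hI1 : Integrable fun t : ℝ => g t * (poisson y (t - x) : ℝ) :=
    hP.bdd_mul hgc.aestronglyMeasurable (Eventually.of_forall fun t => hM t (by simp [closedUpper]))
  have hI2 : Integrable fun t : ℝ => g z * (poisson y (t - x) : ℝ) := hP.const_mul _
  have hI : Integrable fun t : ℝ => k t := by
    simp only [hkt, sub_mul]
    exact (hI1.sub hI2).const_mul _
  have h0 := integral_eq_zero_of_differentiableOn_closedUpper hkd hI (R₀ := 2 * ‖z‖ + 1)
    (C := 2 * M * 4) ?_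
  · have hyc : (y : ℂ)⁻¹ ≠ 0 := inv_ne_zero (by exact_mod_cast hy.ne')
    simp only [hkt, integral_const_mul, sub_mul, integral_sub hI1 hI2] at h0
    have h5 := (mul_eq_zero.1 h0).resolve_left hyc
    rw [integral_complex_ofReal, integral_poisson_sub hy, sub_eq_zero] at h5
    rw [h5, mul_comm]
  · intro ζ hζ hR
    have hzz : ‖zc‖ = ‖z‖ := by
      have : zc = (starRingEnd ℂ) z := by simp [hz, hzc, sub_eq_add_neg]
      rw [this, Complex.norm_conj]
    have hpos : 0 < ‖ζ‖ := by linarith [norm_nonneg z]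
    have d1 : ‖ζ‖ / 2 ≤ ‖ζ - z‖ := by have := norm_sub_norm_le ζ z; linarith
    have d2 : ‖ζ‖ / 2 ≤ ‖ζ - zc‖ := by have := norm_sub_norm_le ζ zc; linarith
    have hζz : ζ ≠ z := sub_ne_zero.1 (norm_pos_iff.1 (by linarith))
    have hM0 : 0 ≤ M := (norm_nonneg _).trans (hM ζ hζ)
    simp only [hk]
    rw [dslope_of_ne _ hζz, slope_def_field, norm_mul, norm_div, norm_inv]
    calc ‖g ζ - g z‖ / ‖ζ - z‖ * ‖ζ - zc‖⁻¹ ≤ (M + M) / (‖ζ‖ / 2) * (‖ζ‖ / 2)⁻¹ := by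
          gcongr
          exact (norm_sub_le _ _).trans (add_le_add (hM ζ hζ) (hM z (mem_of_mem_nhds hmem)))
      _ = _ := by field_simp; ring

theorem memLp_poisson {y : ℝ} (hy : 0 < y) (x : ℝ) :
    MemLp (fun t : ℝ => ((poisson y (t - x) : ℝ) : ℂ)) 2 := by
  have hc : Continuous fun t : ℝ => poisson y (t - x) :=
    (continuous_poisson hy).comp (by fun_prop)
  have hc' : Continuous fun t : ℝ => ((poisson y (t - x) : ℝ) : ℂ) :=
    Complex.continuous_ofReal.comp hc
  rw [memLp_two_iff_integrable_sq_norm hc'.aestronglyMeasurable]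
  have := (((integrable_poisson hy).comp_sub_right x).bdd_mul (f := fun t => poisson y (t - x))
    (c := y⁻¹) hc.aestronglyMeasurable (Eventually.of_forall fun t => ?_))
  · simpa [Complex.norm_real, sq_abs, pow_two] using this
  · rw [Real.norm_of_nonneg (poisson_nonneg hy.le _)]; exact poisson_le hy _

/-- A holomorphic function on the upper half-plane which is dominated by `(1 + t²)^(-1/2)` is the
Poisson integral of a function in `L²`. -/
theorem exists_poisson_representation {G : ℂ → ℂ} (hG : DifferentiableOn ℂ G {z | 0 < z.im})
    (hb : ∀ t s : ℝ, 0 < s → ‖G (t + s * Complex.I)‖ ≤ ‖((t : ℂ) + Complex.I)⁻¹‖) :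
    ∃ g : Lp ℂ 2 (volume : Measure ℝ), ∀ x y : ℝ, 0 < y →
      ∫ t : ℝ, g t * (poisson y (t - x) : ℝ) = Real.pi * G (x + y * Complex.I) := by
  have hne : ∀ t : ℝ, (t : ℂ) + Complex.I ≠ 0 := fun t h => by
    simpa using congrArg Complex.im h
  have hbc : Continuous fun t : ℝ => ((t : ℂ) + Complex.I)⁻¹ :=
    Continuous.inv₀ (by fun_prop) hne
  have hsq : ∀ t : ℝ, ‖((t : ℂ) + Complex.I)⁻¹‖ ^ 2 = (1 + t ^ 2)⁻¹ := fun t => by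
    rw [norm_inv, inv_pow, Complex.sq_norm, Complex.normSq_apply]
    simp; ring
  have hbm : MemLp (fun t : ℝ => ((t : ℂ) + Complex.I)⁻¹) 2 := by
    rw [memLp_two_iff_integrable_sq_norm hbc.aestronglyMeasurable]
    simpa only [hsq] using integrable_inv_one_add_sq
  have hle1 : ∀ t : ℝ, ‖((t : ℂ) + Complex.I)⁻¹‖ ≤ 1 := fun t => by
    rw [← pow_le_one_iff_of_nonneg (norm_nonneg _) two_ne_zero, hsq]
    exact inv_le_one_of_one_le₀ (by nlinarith [sq_nonneg t])
  have hGm : ∀ s : ℝ, 0 < s → MemLp (fun t : ℝ => G (t + s * Complex.I)) 2 := fun s hs =>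
    hbm.mono (hG.continuousOn.comp_continuous (by fun_prop)
      fun t => by simpa using hs).aestronglyMeasurable (Eventually.of_forall fun t => hb t s hs)
  classical
  set Gs : ℝ → Lp ℂ 2 (volume : Measure ℝ) := fun s =>
    if h : 0 < s then (hGm s h).toLp _ else 0 with hGs
  have hbd : ∀ s, ‖Gs s‖ ≤ ‖hbm.toLp _‖ := by
    intro s
    simp only [hGs]
    split_ifs with h
    · refine Lp.norm_le_norm_of_ae_le ?_
      filter_upwards [(hGm s h).coeFn_toLp, hbm.coeFn_toLp] with t h1 h2
      rw [h1, h2]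
      exact hb t s h
    · simp
  set φ : ℝ → WeakDual ℂ (Lp ℂ 2 (volume : Measure ℝ)) := fun s =>
    StrongDual.toWeakDual (InnerProductSpace.toDual ℂ _ (Gs s)) with hφ
  have hcpt := WeakDual.isCompact_closedBall (𝕜 := ℂ)
    (0 : StrongDual ℂ (Lp ℂ 2 (volume : Measure ℝ))) ‖hbm.toLp _‖
  -- The restrictions of `G` to horizontal lines are bounded in `L²`; Banach-Alaoglu gives a weak
  -- limit along an ultrafilter, with no need to extract a subsequence.
  set U : Ultrafilter ℝ := Ultrafilter.of (𝓝[>] 0) with hU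
  have hUle : (U : Filter ℝ) ≤ 𝓝[>] 0 := Ultrafilter.of_le _
  obtain ⟨ℓ, -, hℓ⟩ := hcpt.ultrafilter_le_nhds (U.map φ) (by
    rw [le_principal_iff]
    refine Filter.mem_map.2 (Eventually.of_forall fun s => ?_)
    simpa [hφ] using hbd s)
  refine ⟨(InnerProductSpace.toDual ℂ _).symm (WeakDual.toStrongDual ℓ), fun x y hy => ?_⟩
  set g := (InnerProductSpace.toDual ℂ (Lp ℂ 2 (volume : Measure ℝ))).symm
    (WeakDual.toStrongDual ℓ) with hg
  set h := (memLp_poisson hy x).toLp _ with hh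
  have hinner : ∀ f : Lp ℂ 2 (volume : Measure ℝ),
      inner ℂ h f = ∫ t : ℝ, f t * (poisson y (t - x) : ℝ) := by
    intro f
    rw [L2.inner_def]
    refine integral_congr_ae ?_
    filter_upwards [(memLp_poisson hy x).coeFn_toLp] with t ht
    rw [hh, ht]
    simp [mul_comm]
  have ht1 : Tendsto (fun s => inner ℂ h (Gs s)) U (𝓝 (inner ℂ h g)) := by
    have h1 : Tendsto (fun s => φ s h) U (𝓝 (ℓ h)) :=
      ((WeakDual.eval_continuous h).tendsto ℓ).comp hℓ
    have h2 : ∀ s, φ s h = inner ℂ (Gs s) h := fun s => by simp [hφ]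
    have h3 : ℓ h = inner ℂ g h := by
      rw [hg, InnerProductSpace.toDual_symm_apply]; rfl
    simp only [h2, h3] at h1
    have h4 := (Complex.continuous_conj.tendsto _).comp h1
    simpa [Function.comp_def, inner_conj_symm] using h4
  -- The bounded Poisson formula applies to `G` shifted up by `is`; continuity of `G` handles `s →
  -- 0`.
  have ht2 : Tendsto (fun s => inner ℂ h (Gs s)) U (𝓝 (Real.pi * G (x + y * Complex.I))) := by
    have h1 : Tendsto (fun s : ℝ => Real.pi * G (x + y * Complex.I + s * Complex.I)) (𝓝[>] 0)
        (𝓝 (Real.pi * G (x + y * Complex.I))) := by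
      refine Tendsto.const_mul _ ?_
      have hca : ContinuousAt G (x + y * Complex.I) :=
        (hG.differentiableAt ((isOpen_lt continuous_const Complex.continuous_im).mem_nhds
          (by simpa using hy))).continuousAt
      refine hca.tendsto.comp ?_
      have : Continuous fun s : ℝ => (x : ℂ) + y * Complex.I + s * Complex.I := by fun_prop
      simpa using (this.tendsto 0).mono_left nhdsWithin_le_nhds
    refine (h1.mono_left hUle).congr' (hUle ?_)
    filter_upwards [self_mem_nhdsWithin] with s hs
    have hs : 0 < s := hs
    rw [hinner, ← integral_mul_poisson_eq (g := fun z => G (z + s * Complex.I)) (M := 1) ?_ ?_ hy]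
    · refine integral_congr_ae ?_
      simp only [hGs, dif_pos hs]
      filter_upwards [(hGm s hs).coeFn_toLp] with t ht
      rw [ht]
    · refine hG.comp (by fun_prop) fun z hz => ?_
      have hz : 0 ≤ z.im := hz
      have : 0 < z.im + s := by linarith
      simpa using this
    · intro z hz
      have hz : 0 ≤ z.im := hz
      have := (hb z.re (z.im + s) (by linarith)).trans (hle1 _)
      have e : z + s * Complex.I = z.re + (z.im + s : ℝ) * Complex.I := by
        apply Complex.ext <;> simp
      rwa [← e] at this
  rw [← hinner, tendsto_nhds_unique ht1 ht2]

/-- Linear growth of ball integrals follows from `|g| ≤ 1 + |g|²`. -/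
theorem ae_tendsto_integral_mul_poisson_of_memLp_two {g : ℝ → ℂ} (hg : MemLp g 2) :
    ∀ᵐ x : ℝ, Tendsto (fun ε : ℝ => ∫ t, g t * (poisson ε (t - x) : ℝ)) (𝓝[>] 0)
      (𝓝 (Real.pi * g x)) := by
  set A : ℝ≥0∞ := ∫⁻ t, ‖g t‖ₑ ^ 2 with hA
  have hAt : A ≠ ∞ := by
    have h1 := (memLp_two_iff_integrable_sq_norm hg.1).1 hg
    have h2 := h1.2
    rw [hasFiniteIntegral_iff_enorm] at h2
    simpa [enorm_pow] using h2.ne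
  refine ae_tendsto_integral_mul_poisson (hg.locallyIntegrable (by norm_num))
    (M := 2 + A.toNNReal) (fun x r hr => ?_) fun x ε hε => ?_
  · calc ∫⁻ t in Metric.closedBall x r, ‖g t‖ₑ
        ≤ ∫⁻ t in Metric.closedBall x r, (1 + ‖g t‖ₑ ^ 2) := by
          refine lintegral_mono fun t => ?_
          rcases le_total ‖g t‖ₑ 1 with h | h
          · exact h.trans le_self_add
          · exact (le_self_pow₀ h two_ne_zero).trans le_add_self
      _ = ENNReal.ofReal (2 * r) + ∫⁻ t in Metric.closedBall x r, ‖g t‖ₑ ^ 2 := by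
          rw [lintegral_add_left measurable_const, setLIntegral_const, one_mul,
            Real.volume_closedBall]
      _ ≤ ENNReal.ofReal (2 * r) + A * ENNReal.ofReal r := by
          gcongr
          refine (setLIntegral_le_lintegral _ _).trans ?_
          have : (1 : ℝ≥0∞) ≤ ENNReal.ofReal r := by simpa using hr
          exact le_mul_of_one_le_right zero_le this
      _ = _ := by
          push_cast
          rw [ENNReal.coe_toNNReal hAt, ENNReal.ofReal_mul (by norm_num), ENNReal.ofReal_ofNat]
          ring
  · exact hg.integrable_mul (memLp_poisson hε x)

theorem integrable_mul_poisson {f : ℝ → ℂ} (hf : Integrable f) (x : ℝ) {ε : ℝ} (hε : 0 < ε) :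
    Integrable fun t => f t * (poisson ε (t - x) : ℝ) := by
  have hc : Continuous fun t : ℝ => ((poisson ε (t - x) : ℝ) : ℂ) :=
    Complex.continuous_ofReal.comp ((continuous_poisson hε).comp (by fun_prop))
  refine hf.mul_bdd (c := ε⁻¹) hc.aestronglyMeasurable (Eventually.of_forall fun t => ?_)
  rw [Complex.norm_real, Real.norm_of_nonneg (poisson_nonneg hε.le _)]
  exact poisson_le hε _

theorem ae_tendsto_integral_mul_poisson_of_integrable {f : ℝ → ℂ} (hf : Integrable f) :
    ∀ᵐ x : ℝ, Tendsto (fun ε : ℝ => ∫ t, f t * (poisson ε (t - x) : ℝ)) (𝓝[>] 0)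
      (𝓝 (Real.pi * f x)) := by
  have hA : ∫⁻ t, ‖f t‖ₑ ≠ ∞ := hf.2.ne
  refine ae_tendsto_integral_mul_poisson hf.locallyIntegrable
    (M := (∫⁻ t, ‖f t‖ₑ).toNNReal) (fun x r hr => ?_)
    fun x ε hε => integrable_mul_poisson hf x hε
  rw [ENNReal.coe_toNNReal hA]
  refine (setLIntegral_le_lintegral _ _).trans ?_
  have : (1 : ℝ≥0∞) ≤ ENNReal.ofReal r := by simpa using hr
  exact le_mul_of_one_le_right zero_le this

/-- **Fatou's theorem**: bounded holomorphic functions on the upper half-plane have vertical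
limits almost everywhere on the real line. -/
theorem ae_exists_tendsto_of_bounded {H : ℂ → ℂ} (hH : DifferentiableOn ℂ H {z | 0 < z.im})
    (hb : ∀ z : ℂ, 0 < z.im → ‖H z‖ ≤ 1) :
    ∀ᵐ x : ℝ, ∃ L, Tendsto (fun ε : ℝ => H (x + ε * Complex.I)) (𝓝[>] 0) (𝓝 L) := by
  have hne : ∀ z : ℂ, 0 < z.im → z + Complex.I ≠ 0 := fun z hz h => by
    have := congrArg Complex.im h
    simp at this; linarith
  -- The factor `1/(z + i)` makes the boundary data square integrable; it is continuous and nonzero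
  -- up to the real line and is divided out at the end.
  obtain ⟨g, hg⟩ := exists_poisson_representation (G := fun z => H z * (z + Complex.I)⁻¹)
    (hH.mul (DifferentiableOn.inv (by fun_prop) hne)) (fun t s hs => by
      have hz : 0 < ((t : ℂ) + s * Complex.I).im := by simpa using hs
      have ht : (0 : ℝ) < ‖(t : ℂ) + Complex.I‖ := norm_pos_iff.2 fun h => by
        simpa using congrArg Complex.im h
      rw [norm_mul, norm_inv, norm_inv]
      refine (mul_le_mul_of_nonneg_right (hb _ hz) (by positivity)).trans ?_
      rw [one_mul]
      gcongr
      rw [← sq_le_sq₀ (norm_nonneg _) (norm_nonneg _), Complex.sq_norm, Complex.sq_norm,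
        Complex.normSq_apply, Complex.normSq_apply]
      simp
      nlinarith)
  filter_upwards [ae_tendsto_integral_mul_poisson_of_memLp_two (Lp.memLp g)] with x hx
  have h1 : Tendsto (fun ε : ℝ => (Real.pi : ℂ)⁻¹ * (∫ t, g t * (poisson ε (t - x) : ℝ)) *
      ((x : ℂ) + ε * Complex.I + Complex.I)) (𝓝[>] 0)
      (𝓝 ((Real.pi : ℂ)⁻¹ * (Real.pi * g x) * ((x : ℂ) + (0 : ℝ) * Complex.I + Complex.I))) := by
    refine (hx.const_mul _).mul ?_
    have : Continuous fun ε : ℝ => (x : ℂ) + ε * Complex.I + Complex.I := by fun_prop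
    exact (this.tendsto 0).mono_left nhdsWithin_le_nhds
  refine ⟨_, h1.congr' ?_⟩
  filter_upwards [self_mem_nhdsWithin] with ε hε
  have hε : 0 < ε := hε
  rw [hg x ε hε]
  have h2 := hne (x + ε * Complex.I) (by simpa using hε)
  have h3 : (Real.pi : ℂ) ≠ 0 := by exact_mod_cast Real.pi_ne_zero
  field_simp

/-- If `exp φ` converges to a nonzero limit at `0+`, then so does `φ`. -/
theorem exists_tendsto_of_tendsto_exp {φ : ℝ → ℂ} (hφ : ContinuousOn φ (Set.Ioi 0)) {L : ℂ}
    (hL : L ≠ 0) (h : Tendsto (fun ε => Complex.exp (φ ε)) (𝓝[>] 0) (𝓝 L)) :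
    ∃ ℓ, Tendsto φ (𝓝[>] 0) (𝓝 ℓ) := by
  set ψ : ℝ → ℂ := fun ε => φ ε - Complex.log L with hψ
  have h1 : Tendsto (fun ε => Complex.exp (ψ ε)) (𝓝[>] 0) (𝓝 1) := by
    simp only [hψ, Complex.exp_sub, Complex.exp_log hL]
    simpa [hL] using h.div_const L
  have hs : ∀ᶠ ε in 𝓝[>] 0, Complex.exp (ψ ε) ∈ Complex.slitPlane :=
    h1.eventually (Complex.isOpen_slitPlane.mem_nhds Complex.one_mem_slitPlane)
  obtain ⟨δ, hδ, hsub⟩ := mem_nhdsGT_iff_exists_Ioo_subset.1 hs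
  have hδ : 0 < δ := hδ
  have hψc : ContinuousOn ψ (Set.Ioo 0 δ) :=
    (hφ.mono Set.Ioo_subset_Ioi_self).sub continuousOn_const
  -- Near `0` this difference is continuous with values in `2πiℤ`, hence constant, so that `ψ`
  -- differs from a convergent function by a constant.
  set κ : ℝ → ℂ := fun ε => ψ ε - Complex.log (Complex.exp (ψ ε)) with hκ
  have hκc : ContinuousOn κ (Set.Ioo 0 δ) :=
    hψc.sub ((Complex.continuous_exp.comp_continuousOn hψc).clog fun ε hε => hsub hε)
  have hκi : ∀ ε, ∃ n : ℤ, κ ε = n * (2 * Real.pi * Complex.I) := by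
    intro ε
    have : Complex.exp (κ ε) = 1 := by
      simp only [hκ]
      rw [Complex.exp_sub, Complex.exp_log (Complex.exp_ne_zero _), div_self (Complex.exp_ne_zero _)]
    exact Complex.exp_eq_one_iff.1 this
  have hconst : ∀ ε ∈ Set.Ioo 0 δ, κ ε = κ (δ / 2) := by
    choose N hN using hκi
    have hre : ContinuousOn (fun ε => ((N ε : ℤ) : ℝ)) (Set.Ioo 0 δ) := by
      have h3 : ContinuousOn (fun ε => (κ ε * (2 * Real.pi * Complex.I)⁻¹).re) (Set.Ioo 0 δ) :=
        Complex.continuous_re.comp_continuousOn (hκc.mul continuousOn_const)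
      refine h3.congr fun ε _ => ?_
      dsimp only
      rw [hN ε, mul_assoc, mul_inv_cancel₀ Complex.two_pi_I_ne_zero]
      simp
    have hN2 : ContinuousOn N (Set.Ioo 0 δ) :=
      (Int.isClosedEmbedding_coe_real.isInducing.continuousOn_iff).2 hre
    intro ε hε
    rw [hN ε, hN (δ / 2), isPreconnected_Ioo.constant hN2 hε (y := δ / 2) ⟨by linarith, by linarith⟩]
  refine ⟨κ (δ / 2) + Complex.log L, ?_⟩
  have h4 : Tendsto (fun ε => Complex.log (Complex.exp (ψ ε))) (𝓝[>] 0) (𝓝 0) := by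
    simpa using h1.clog Complex.one_mem_slitPlane
  have h5 : Tendsto (fun ε => Complex.log (Complex.exp (ψ ε)) + κ (δ / 2) + Complex.log L)
      (𝓝[>] 0) (𝓝 (κ (δ / 2) + Complex.log L)) := by
    simpa using (h4.add_const (κ (δ / 2))).add_const (Complex.log L)
  refine h5.congr' ?_
  filter_upwards [Ioo_mem_nhdsGT hδ] with ε hε
  rw [← hconst ε hε]
  simp [hκ, hψ]

/-! ### Boundary values of Cauchy transforms almost everywhere -/

theorem im_cauchyT_ofReal {f : ℝ → ℝ} (hf : Integrable f) (x : ℝ) {ε : ℝ} (hε : 0 < ε) :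
    (((cauchyT (fun t => (f t : ℂ)) (x + ε * Complex.I)).im : ℝ) : ℂ)
      = ∫ t, (f t : ℂ) * (poisson ε (t - x) : ℝ) := by
  have h1 := cauchyT_sub_cauchyT (f := fun t => (f t : ℂ)) hf.ofReal x hε
  -- For real `f` the Cauchy transform commutes with conjugation, so its jump across the axis is
  -- `2i` times its imaginary part.
  have h2 : cauchyT (fun t => (f t : ℂ)) (x - ε * Complex.I)
      = (starRingEnd ℂ) (cauchyT (fun t => (f t : ℂ)) (x + ε * Complex.I)) := by
    simp only [cauchyT]
    rw [← integral_conj]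
    refine integral_congr_ae (Eventually.of_forall fun t => ?_)
    simp [sub_eq_add_neg]
  rw [h2, Complex.sub_conj] at h1
  have h3 : (2 * Complex.I : ℂ) ≠ 0 := by simp
  refine mul_left_cancel₀ h3 ?_
  rw [← h1]; push_cast; ring

/-- Here `Im F` is a Poisson integral, hence nonnegative, so `exp(iF)` is bounded by `1` and Fatou's
theorem applies. Its modulus tends to `exp(-π f x)`, so the limit is not zero and a logarithm
recovers the limit of `F`. -/
theorem ae_exists_tendsto_cauchyT_of_nonneg {f : ℝ → ℝ} (hf : Integrable f) (h0 : ∀ x, 0 ≤ f x) :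
    ∀ᵐ x : ℝ, ∃ L, Tendsto (fun ε : ℝ => cauchyT (fun t => (f t : ℂ)) (x + ε * Complex.I))
      (𝓝[>] 0) (𝓝 L) := by
  set F := cauchyT fun t => (f t : ℂ) with hF
  have hfc : Integrable fun t => (f t : ℂ) := hf.ofReal
  have hup : {z : ℂ | 0 < z.im} ⊆ offReal := fun z (hz : 0 < z.im) => hz.ne'
  have hFd : DifferentiableOn ℂ F {z | 0 < z.im} := (differentiableOn_cauchyT hfc).mono hup
  have him : ∀ z : ℂ, 0 < z.im → 0 ≤ (F z).im := by
    intro z hz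
    have h1 := im_cauchyT_ofReal hf z.re hz
    rw [Complex.re_add_im] at h1
    have h2 : (F z).im = ∫ t, f t * poisson z.im (t - z.re) := by
      rw [← Complex.ofReal_inj, h1, ← integral_complex_ofReal]
      simp only [Complex.ofReal_mul]
    rw [h2]
    exact integral_nonneg fun t => mul_nonneg (h0 t) (poisson_nonneg hz.le _)
  have hFat := ae_exists_tendsto_of_bounded (H := fun z => Complex.exp (Complex.I * F z))
    ((hFd.const_mul Complex.I).cexp) fun z hz => by
      rw [Complex.norm_exp]
      simpa using him z hz
  filter_upwards [hFat, ae_tendsto_integral_mul_poisson_of_integrable hfc] with x ⟨L, hL⟩ hx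
  have hline : ∀ ε ∈ Set.Ioi (0 : ℝ), (x : ℂ) + ε * Complex.I ∈ {z : ℂ | 0 < z.im} :=
    fun ε (hε : 0 < ε) => by simpa using hε
  have hlim : Tendsto (fun ε : ℝ => ‖Complex.exp (Complex.I * F (x + ε * Complex.I))‖) (𝓝[>] 0)
      (𝓝 (Real.exp (-(Real.pi * f x)))) := by
    have h1 := (Complex.continuous_re.tendsto _).comp hx
    have h2 : Tendsto (fun ε : ℝ => Real.exp (-(F (x + ε * Complex.I)).im)) (𝓝[>] 0)
        (𝓝 (Real.exp (-((Real.pi : ℂ) * f x).re))) := by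
      refine (Real.continuous_exp.tendsto _).comp (Tendsto.neg (h1.congr' ?_))
      filter_upwards [self_mem_nhdsWithin] with ε hε
      simp only [Function.comp_apply]
      rw [← im_cauchyT_ofReal hf x hε, Complex.ofReal_re]
    have h3 : ((Real.pi : ℂ) * f x).re = Real.pi * f x := by simp
    rw [h3] at h2
    refine h2.congr fun ε => ?_
    rw [Complex.norm_exp]; simp
  have hL0 : L ≠ 0 := by
    rintro rfl
    have := tendsto_nhds_unique hlim hL.norm
    rw [norm_zero] at this
    exact (Real.exp_pos _).ne' this
  obtain ⟨ℓ, hℓ⟩ := exists_tendsto_of_tendsto_exp (φ := fun ε : ℝ => Complex.I * F (x + ε * Complex.I))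
    (continuousOn_const.mul (hFd.continuousOn.comp (by fun_prop) hline)) hL0 hL
  refine ⟨-Complex.I * ℓ, (hℓ.const_mul (-Complex.I)).congr fun ε => ?_⟩
  rw [← mul_assoc]; simp

theorem ae_exists_tendsto_cauchyT_ofReal {f : ℝ → ℝ} (hf : Integrable f) :
    ∀ᵐ x : ℝ, ∃ L, Tendsto (fun ε : ℝ => cauchyT (fun t => (f t : ℂ)) (x + ε * Complex.I))
      (𝓝[>] 0) (𝓝 L) := by
  filter_upwards [ae_exists_tendsto_cauchyT_of_nonneg hf.pos_part fun x => le_max_right _ _,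
    ae_exists_tendsto_cauchyT_of_nonneg hf.neg_part fun x => le_max_right _ _] with x ⟨L, hL⟩ ⟨L', hL'⟩
  refine ⟨L - L', (hL.sub hL').congr' ?_⟩
  filter_upwards [self_mem_nhdsWithin] with ε hε
  have hz : (x : ℂ) + ε * Complex.I ∈ offReal := by
    have : 0 < ε := hε
    simpa [mem_offReal] using this.ne'
  have i1 : Integrable fun t => ((max (f t) 0 : ℝ) : ℂ) := hf.pos_part.ofReal
  have i2 : Integrable fun t => ((max (-f t) 0 : ℝ) : ℂ) := hf.neg_part.ofReal
  rw [sub_eq_add_neg, ← neg_one_mul, ← cauchyT_const_mul, ← cauchyT_add i1 (i2.const_mul _) hz]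
  congr 1
  funext t
  have := max_zero_sub_max_neg_zero_eq_self (f t)
  conv_rhs => rw [← this]
  push_cast; ring

/-- The Cauchy transform of an integrable function has boundary values almost everywhere, and they
satisfy the Sokhotski-Plemelj jump formula. -/
theorem ae_exists_tendsto_cauchyT {f : ℝ → ℂ} (hf : Integrable f) :
    ∀ᵐ x : ℝ, ∃ L, Tendsto (fun ε : ℝ => cauchyT f (x + ε * Complex.I)) (𝓝[>] 0) (𝓝 L) ∧
      Tendsto (fun ε : ℝ => cauchyT f (x - ε * Complex.I)) (𝓝[>] 0)
        (𝓝 (L - 2 * Real.pi * Complex.I * f x)) := by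
  filter_upwards [ae_exists_tendsto_cauchyT_ofReal hf.re, ae_exists_tendsto_cauchyT_ofReal hf.im,
    ae_tendsto_integral_mul_poisson_of_integrable hf] with x ⟨L, hL⟩ ⟨L', hL'⟩ hx
  have h1 : Tendsto (fun ε : ℝ => cauchyT f (x + ε * Complex.I)) (𝓝[>] 0)
      (𝓝 (L + Complex.I * L')) := by
    refine (hL.add (hL'.const_mul Complex.I)).congr' ?_
    filter_upwards [self_mem_nhdsWithin] with ε hε
    have hz : (x : ℂ) + ε * Complex.I ∈ offReal := by
      have : 0 < ε := hε
      simpa [mem_offReal] using this.ne'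
    have i1 : Integrable fun t => (((f t).re : ℝ) : ℂ) := hf.re.ofReal
    have i2 : Integrable fun t => (((f t).im : ℝ) : ℂ) := hf.im.ofReal
    rw [← cauchyT_const_mul]
    refine (cauchyT_add i1 (i2.const_mul _) hz).symm.trans ?_
    congr 1
    funext t
    apply Complex.ext <;> simp
  refine ⟨_, h1, ?_⟩
  -- The limit from below comes from the limit from above by subtracting the convergent Poisson
  -- integral.
  have h2 := h1.sub (hx.const_mul (2 * Complex.I))
  rw [show 2 * Complex.I * (Real.pi * f x) = 2 * Real.pi * Complex.I * f x by ring] at h2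
  refine h2.congr' ?_
  filter_upwards [self_mem_nhdsWithin] with ε hε
  rw [← cauchyT_sub_cauchyT hf x hε, sub_sub_cancel]

/-! ### The jump of the Cauchy transform in `L¹` -/

/-- Strong continuity of the translation action on `L¹`. -/
theorem tendsto_lintegral_translate_sub {f : ℝ → ℂ} (hf : Integrable f) :
    Tendsto (fun s : ℝ => ∫⁻ x, ‖f (s + x) - f x‖ₑ) (𝓝 0) (𝓝 0) := by
  have hm := memLp_one_iff_integrable.2 hf
  set F := hm.toLp f with hF
  have : Fact ((1 : ℝ≥0∞) ≠ ∞) := ⟨by norm_num⟩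
  have hc : Continuous fun s : ℝ => DomAddAct.mk s +ᵥ F := by
    have : Continuous fun s : ℝ => DomAddAct.mk s := DomAddAct.continuous_mk
    fun_prop
  have h1 : Tendsto (fun s : ℝ => edist (DomAddAct.mk s +ᵥ F) F) (𝓝 0) (𝓝 0) := by
    have := (hc.edist continuous_const (g := fun _ => F)).tendsto 0
    simpa using this
  refine h1.congr fun s => ?_
  rw [hF, DomAddAct.mk_vadd_toLp, Lp.edist_toLp_toLp, eLpNorm_one_eq_lintegral_enorm]
  rfl

/-- By Tonelli the `L¹` error is at most the Poisson integral at `0` of the translation modulus `ω`,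
which is bounded and tends to `0`. Honest measurability of `f` gives joint measurability of `f (s +
x)`. -/
theorem tendsto_lintegral_poisson_sub_of_measurable {f : ℝ → ℂ} (hf : Integrable f)
    (hfm : Measurable f) :
    Tendsto (fun ε : ℝ => ∫⁻ x, ‖(∫ t, f t * (poisson ε (t - x) : ℝ)) - Real.pi * f x‖ₑ)
      (𝓝[>] 0) (𝓝 0) := by
  set ω : ℝ → ℝ≥0∞ := fun s => ∫⁻ x, ‖f (s + x) - f x‖ₑ with hω
  have hmeas : Measurable fun q : ℝ × ℝ => ‖f (q.1 + q.2) - f q.2‖ₑ := by fun_prop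
  have hωm : Measurable ω := hmeas.lintegral_prod_right'
  have hωb : ∀ s, ω s ≤ 2 * ∫⁻ x, ‖f x‖ₑ := by
    intro s
    calc ω s ≤ ∫⁻ x, (‖f (s + x)‖ₑ + ‖f x‖ₑ) := lintegral_mono fun x => enorm_sub_le
      _ = (∫⁻ x, ‖f (s + x)‖ₑ) + ∫⁻ x, ‖f x‖ₑ := lintegral_add_right _ hfm.enorm
      _ = _ := by rw [lintegral_add_left_eq_self (fun x => ‖f x‖ₑ) s, two_mul]
  have hA : ∫⁻ t, ‖f t‖ₑ ≠ ∞ := hf.2.ne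
  have key := tendsto_lintegral_mul_poisson (g := ω) (x := 0) hωm.aemeasurable ?_ ?_
  · refine tendsto_of_tendsto_of_tendsto_of_le_of_le' tendsto_const_nhds key
      (Eventually.of_forall fun _ => zero_le) ?_
    filter_upwards [self_mem_nhdsWithin] with ε hε
    have hε : 0 < ε := hε
    have hpm : Measurable (poisson ε) := (continuous_poisson hε).measurable
    calc ∫⁻ x, ‖(∫ t, f t * (poisson ε (t - x) : ℝ)) - Real.pi * f x‖ₑ
        ≤ ∫⁻ x, ∫⁻ s, ‖f (s + x) - f x‖ₑ * ENNReal.ofReal (poisson ε (s - 0)) := by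
          refine lintegral_mono fun x => ?_
          have hp : Integrable fun s => f x * (poisson ε s : ℝ) :=
            ((integrable_poisson hε).ofReal (𝕜 := ℂ)).const_mul _
          have e : (Real.pi : ℂ) * f x = ∫ s, f x * (poisson ε s : ℝ) := by
            rw [integral_const_mul, integral_complex_ofReal, integral_poisson hε, mul_comm]
          have h1 := integrable_mul_poisson hf x hε
          have e2 : ∫ t, f t * (poisson ε (t - x) : ℝ) = ∫ s, f (s + x) * (poisson ε s : ℝ) := by
            rw [← integral_add_right_eq_self _ x]
            simp
          have h2 : Integrable fun s => f (s + x) * (poisson ε s : ℝ) := by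
            simpa using h1.comp_add_right x
          rw [e, e2, ← integral_sub h2 hp]
          refine (enorm_integral_le_lintegral_enorm _).trans (lintegral_mono fun t => ?_)
          rw [← sub_mul, enorm_mul, sub_zero]
          gcongr
          rw [← ofReal_norm, Complex.norm_real, Real.norm_of_nonneg (poisson_nonneg hε.le _)]
      _ = ∫⁻ s, ∫⁻ x, ‖f (s + x) - f x‖ₑ * ENNReal.ofReal (poisson ε (s - 0)) := by
          have h3 : Measurable fun q : ℝ × ℝ => ‖f (q.2 + q.1) - f q.1‖ₑ :=
            hmeas.comp measurable_swap
          have h4 : Measurable fun q : ℝ × ℝ => ENNReal.ofReal (poisson ε (q.2 - 0)) := by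
            simp only [sub_zero]; exact (hpm.comp measurable_snd).ennreal_ofReal
          exact lintegral_lintegral_swap (h3.mul h4).aemeasurable
      _ = _ := lintegral_congr fun s => lintegral_mul_const' _ _ ENNReal.ofReal_ne_top
  · intro η hη
    have h1 := ENNReal.tendsto_nhds_zero.1 (tendsto_lintegral_translate_sub hf) ((η / 2 : ℝ≥0) : ℝ≥0∞)
      (by positivity)
    obtain ⟨δ, hδ, h2⟩ := Metric.eventually_nhds_iff.1 h1
    refine ⟨δ, hδ, fun r hr hrδ => ?_⟩
    calc ∫⁻ t in Metric.closedBall 0 r, ω t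
        ≤ ∫⁻ t in Metric.closedBall (0 : ℝ) r, ((η / 2 : ℝ≥0) : ℝ≥0∞) :=
          setLIntegral_mono' Metric.isClosed_closedBall.measurableSet fun t ht =>
            h2 ((Metric.mem_closedBall.1 ht).trans_lt hrδ)
      _ = _ := by
          rw [setLIntegral_const, Real.volume_closedBall, ENNReal.ofReal_mul (by norm_num),
            ENNReal.ofReal_ofNat, ← mul_assoc]
          congr 1
          have : ((η / 2 : ℝ≥0) * 2 : ℝ≥0) = η := by field_simp
          rw [← ENNReal.coe_ofNat, ← ENNReal.coe_mul, this]
  · intro δ hδ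
    refine ⟨4 * (∫⁻ x, ‖f x‖ₑ).toNNReal, fun r hr => ?_⟩
    calc ∫⁻ t in Metric.closedBall 0 r, ω t
        ≤ ∫⁻ t in Metric.closedBall (0 : ℝ) r, 2 * ∫⁻ x, ‖f x‖ₑ :=
          lintegral_mono fun t => hωb t
      _ = _ := by
          rw [setLIntegral_const, Real.volume_closedBall, ENNReal.ofReal_mul (by norm_num),
            ENNReal.ofReal_ofNat]
          push_cast
          rw [ENNReal.coe_toNNReal hA]
          ring

/-- The Sokhotski-Plemelj formula in `L¹`. -/
theorem tendsto_lintegral_cauchyT_jump {f : ℝ → ℂ} (hf : Integrable f) :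
    Tendsto (fun ε : ℝ => ∫⁻ x : ℝ, ‖cauchyT f (x + ε * Complex.I) - cauchyT f (x - ε * Complex.I)
      - 2 * Real.pi * Complex.I * f x‖ₑ) (𝓝[>] 0) (𝓝 0) := by
  have hm : Measurable (hf.1.mk f) := hf.1.stronglyMeasurable_mk.measurable
  have h1 := tendsto_lintegral_poisson_sub_of_measurable (hf.congr hf.1.ae_eq_mk) hm
  have h2 := ENNReal.Tendsto.const_mul (a := ‖(2 * Complex.I : ℂ)‖ₑ) h1 (Or.inr enorm_ne_top)
  rw [mul_zero] at h2
  refine h2.congr' ?_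
  filter_upwards [self_mem_nhdsWithin] with ε hε
  rw [← lintegral_const_mul' _ _ enorm_ne_top]
  refine lintegral_congr_ae ?_
  filter_upwards [hf.1.ae_eq_mk] with x hx
  rw [cauchyT_sub_cauchyT hf x hε, ← enorm_mul, hx]
  congr 1
  have : ∫ t, f t * (poisson ε (t - x) : ℝ) = ∫ t, hf.1.mk f t * (poisson ε (t - x) : ℝ) :=
    integral_congr_ae (by filter_upwards [hf.1.ae_eq_mk] with t ht; rw [ht])
  rw [this]
  ring

/-- Controls the replacement of polynomial entries at `x ± iε` by their values at `x`, against the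
merely integrable entries of the jump matrix; `c` is the sign. -/
theorem tendsto_lintegral_shift_sub_mul {P : ℂ → ℂ} (hP : Continuous P) {v : ℝ → ℂ} {a b : ℝ}
    (hv : IntegrableOn v (Set.Icc a b)) (c : ℝ) :
    Tendsto (fun ε : ℝ => ∫⁻ x in Set.Icc a b, ‖(P (x + c * ε * Complex.I) - P x) * v x‖ₑ)
      (𝓝[>] 0) (𝓝 0) := by
  have hcont : Continuous fun q : ℝ × ℝ => P (q.1 + c * q.2 * Complex.I) - P q.1 := by fun_prop
  obtain ⟨B, hB⟩ := (isCompact_Icc (a := a) (b := b)).prod (isCompact_Icc (a := (0 : ℝ)) (b := 1))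
    |>.exists_bound_of_continuousOn hcont.continuousOn
  have h0 : Tendsto (fun ε : ℝ => ∫⁻ x in Set.Icc a b,
      ‖(P (x + c * ε * Complex.I) - P x) * v x‖ₑ) (𝓝[>] 0) (𝓝 (∫⁻ x in Set.Icc a b, 0)) := by
    refine tendsto_lintegral_filter_of_dominated_convergence' (fun x => ENNReal.ofReal B * ‖v x‖ₑ)
      ?_ ?_ ?_ ?_
    · refine Eventually.of_forall fun ε => ?_
      have : Continuous fun x : ℝ => P (x + c * ε * Complex.I) - P x := by fun_prop
      exact (this.aestronglyMeasurable.mul hv.1).enorm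
    · filter_upwards [Ioc_mem_nhdsGT one_pos] with ε hε
      filter_upwards [ae_restrict_mem measurableSet_Icc] with x hx
      rw [enorm_mul]
      gcongr
      rw [← ofReal_norm]
      exact ENNReal.ofReal_le_ofReal (hB (x, ε) ⟨hx, hε.1.le, hε.2⟩)
    · rw [lintegral_const_mul' _ _ ENNReal.ofReal_ne_top]
      exact ENNReal.mul_ne_top ENNReal.ofReal_ne_top hv.2.ne
    · refine Eventually.of_forall fun x => ?_
      have h1 : Continuous fun ε : ℝ => ‖(P (x + c * ε * Complex.I) - P x) * v x‖ₑ := by fun_prop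
      simpa using (h1.tendsto 0).mono_left nhdsWithin_le_nhds
  simpa using h0

/-! ### The Cauchy transform of Hölder continuous functions -/

theorem integrable_indicator_abs_rpow {α : ℝ} (hα : 0 < α) :
    Integrable fun s : ℝ => if |s| < 1 then |s| ^ (α - 1) else 0 := by
  have h1 : IntegrableOn (fun s : ℝ => |s| ^ (α - 1)) (Set.Ioo 0 1) := by
    refine ((intervalIntegral.integrableOn_Ioo_rpow_iff one_pos).2
      (by linarith : -1 < α - 1)).congr_fun (fun s hs => ?_) measurableSet_Ioo
    simp only [abs_of_pos hs.1]
  have h2 : IntegrableOn (fun s : ℝ => |s| ^ (α - 1)) (Set.Ioo (-1) 0) := by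
    have := (Measure.measurePreserving_neg (volume : Measure ℝ)).integrableOn_comp_preimage
      (Homeomorph.neg ℝ).measurableEmbedding (f := fun s : ℝ => |s| ^ (α - 1)) (s := Set.Ioo 0 1)
    have h3 := this.2 h1
    simpa [Function.comp_def] using h3
  have h4 : IntegrableOn (fun s : ℝ => |s| ^ (α - 1)) (Set.Ioo (-1) 1) := by
    have h5 : IntegrableOn (fun s : ℝ => |s| ^ (α - 1)) {(0 : ℝ)} := integrableOn_singleton
      (by simp) (by rw [Real.volume_singleton]; exact ENNReal.zero_lt_top)
    refine ((h2.union h5).union h1).mono_set fun s hs => ?_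
    rcases lt_trichotomy s 0 with h | h | h
    · exact Or.inl (Or.inl ⟨hs.1, h⟩)
    · exact Or.inl (Or.inr h)
    · exact Or.inr ⟨h, hs.2⟩
  refine (h4.integrable_indicator measurableSet_Ioo).congr (Eventually.of_forall fun s => ?_)
  simp only [Set.indicator, Set.mem_Ioo, abs_lt]

section Holder

variable {g : ℝ → ℂ} {C α : ℝ}

/-- Hölder continuity with real constants. -/
def IsHolder (g : ℝ → ℂ) (C α : ℝ) : Prop := 0 < α ∧ ∀ s t, ‖g s - g t‖ ≤ C * |s - t| ^ α

theorem IsHolder.nonneg (hg : IsHolder g C α) : 0 ≤ C := by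
  simpa using (norm_nonneg _).trans (hg.2 1 0)

theorem IsHolder.continuous (hg : IsHolder g C α) : Continuous g := by
  refine continuous_iff_continuousAt.2 fun x => ?_
  rw [ContinuousAt, tendsto_iff_norm_sub_tendsto_zero]
  refine squeeze_zero (fun _ => norm_nonneg _) (fun t => hg.2 t x) ?_
  have : Continuous fun t : ℝ => C * |t - x| ^ α :=
    continuous_const.mul ((by fun_prop : Continuous fun t : ℝ => |t - x|).rpow_const
      fun _ => Or.inr hg.1.le)
  simpa [Real.zero_rpow hg.1.ne'] using this.tendsto x

/-- Average `|g x| ≤ C + |g t|` over `t` in an interval of length one. -/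
theorem IsHolder.bounded (hg : IsHolder g C α) (hi : Integrable g) (x : ℝ) :
    ‖g x‖ ≤ C + ∫ t, ‖g t‖ := by
  have h1 : ∫ t in Set.Icc x (x + 1), (‖g x‖ - C) ≤ ∫ t in Set.Icc x (x + 1), ‖g t‖ := by
    refine setIntegral_mono_on (integrableOn_const (by simp)) hi.norm.integrableOn
      measurableSet_Icc fun t ht => ?_
    have h2 := hg.2 x t
    have h3 : |x - t| ^ α ≤ 1 := Real.rpow_le_one (abs_nonneg _)
      (abs_le.2 ⟨by linarith [ht.2], by linarith [ht.1]⟩) hg.1.le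
    have h4 := norm_sub_norm_le (g x) (g t)
    nlinarith [hg.nonneg]
  have h2 : ∫ t in Set.Icc x (x + 1), ‖g t‖ ≤ ∫ t, ‖g t‖ :=
    setIntegral_le_integral hi.norm (Eventually.of_forall fun _ => norm_nonneg _)
  simp at h1
  linarith

/-- The part of the Cauchy transform close to the real part of `z`. -/
noncomputable def cauchyNear (g : ℝ → ℂ) (z : ℂ) : ℂ :=
  ∫ s : ℝ, if |s| < 1 then (g (z.re + s) - g z.re) / (s - z.im * Complex.I) else 0

/-- The part of the Cauchy transform away from the real part of `z`. -/
noncomputable def cauchyFar (g : ℝ → ℂ) (z : ℂ) : ℂ :=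
  ∫ t : ℝ, if |t - z.re| < 1 then 0 else g t / (t - z)

theorem IsHolder.norm_near_le (hg : IsHolder g C α) (x y s : ℝ) :
    ‖if |s| < 1 then (g (x + s) - g x) / (s - y * Complex.I) else 0‖
      ≤ C * if |s| < 1 then |s| ^ (α - 1) else 0 := by
  split_ifs with h
  · rcases eq_or_ne s 0 with rfl | h0
    · simp only [add_zero, sub_self, zero_div, norm_zero]
      exact mul_nonneg hg.nonneg (by positivity)
    · have h1 : |s| ≤ ‖(s : ℂ) - y * Complex.I‖ := by
        simpa using Complex.abs_re_le_norm ((s : ℂ) - y * Complex.I)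
      have h2 : 0 < |s| := abs_pos.2 h0
      have h3 := hg.2 (x + s) x
      rw [add_sub_cancel_left] at h3
      rw [norm_div, Real.rpow_sub_one h2.ne', ← mul_div_assoc]
      have := mul_nonneg hg.nonneg (Real.rpow_nonneg h2.le α)
      gcongr
  · simp

theorem measurable_near (hg : Continuous g) (x y : ℝ) : Measurable fun s : ℝ =>
    if |s| < 1 then (g (x + s) - g x) / (s - y * Complex.I) else 0 := by
  refine Measurable.ite (isOpen_lt continuous_abs continuous_const).measurableSet ?_ measurable_const
  have := hg.measurable
  fun_prop

theorem norm_far_le {z : ℂ} (t : ℝ) :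
    ‖if |t - z.re| < 1 then 0 else g t / (t - z)‖ ≤ ‖g t‖ := by
  split_ifs with h
  · simp
  · have h1 : |t - z.re| ≤ ‖(t : ℂ) - z‖ := by
      simpa using Complex.abs_re_le_norm ((t : ℂ) - z)
    rw [norm_div]
    exact div_le_self (norm_nonneg _) (by linarith)

theorem measurable_far (hg : Continuous g) (z : ℂ) : Measurable fun t : ℝ =>
    if |t - z.re| < 1 then 0 else g t / (t - z) := by
  refine Measurable.ite (isOpen_lt (by fun_prop) continuous_const).measurableSet measurable_const ?_
  have := hg.measurable
  fun_prop

/-- Subtracting `g (Re z)` within distance one makes the singularity integrable. The subtracted term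
is an explicit integral and carries the whole jump. -/
theorem IsHolder.cauchyT_eq (hg : IsHolder g C α) (hi : Integrable g) {z : ℂ} (hz : z ∈ offReal) :
    cauchyT g z = cauchyNear g z + cauchyFar g z + g z.re *
      ∫ s : ℝ in (-1)..1, ((s : ℂ) - z.im * Complex.I)⁻¹ := by
  have hne : ∀ s : ℝ, (s : ℂ) - z.im * Complex.I ≠ 0 := fun s =>
    ofReal_sub_ne_zero (by simpa [mem_offReal] using hz) s
  have iF : Integrable fun t : ℝ => if |t - z.re| < 1 then 0 else g t / (t - z) :=
    hi.norm.mono' (measurable_far hg.continuous z).aestronglyMeasurable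
      (Eventually.of_forall fun t => norm_far_le t)
  have iN : Integrable fun s : ℝ =>
      if |s| < 1 then (g (z.re + s) - g z.re) / (s - z.im * Complex.I) else 0 :=
    ((integrable_indicator_abs_rpow hg.1).const_mul C).mono'
      (measurable_near hg.continuous _ _).aestronglyMeasurable
      (Eventually.of_forall fun s => hg.norm_near_le _ _ s)
  have iC : Integrable fun s : ℝ =>
      if |s| < 1 then g z.re * ((s : ℂ) - z.im * Complex.I)⁻¹ else 0 := by
    have hc : Continuous fun s : ℝ => g z.re * ((s : ℂ) - z.im * Complex.I)⁻¹ :=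
      continuous_const.mul (Continuous.inv₀ (by fun_prop) hne)
    refine ((hc.integrableOn_Icc (a := -1) (b := 1)).mono_set Set.Ioo_subset_Icc_self
      |>.integrable_indicator measurableSet_Ioo).congr (Eventually.of_forall fun s => ?_)
    simp only [Set.indicator, Set.mem_Ioo, abs_lt]
  have eC : g z.re * ∫ s : ℝ in (-1)..1, ((s : ℂ) - z.im * Complex.I)⁻¹
      = ∫ s : ℝ, if |s| < 1 then g z.re * ((s : ℂ) - z.im * Complex.I)⁻¹ else 0 := by
    rw [← intervalIntegral.integral_const_mul, intervalIntegral.integral_of_le (by norm_num),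
      integral_Ioc_eq_integral_Ioo, ← integral_indicator measurableSet_Ioo]
    refine integral_congr_ae (Eventually.of_forall fun s => ?_)
    simp only [Set.indicator, Set.mem_Ioo, abs_lt]
  have eN : ∫ t : ℝ, (if |t - z.re| < 1 then g t / (t - z) else 0)
      = cauchyNear g z + g z.re * ∫ s : ℝ in (-1)..1, ((s : ℂ) - z.im * Complex.I)⁻¹ := by
    rw [eC, cauchyNear, ← integral_add iN iC, ← integral_add_left_eq_self _ z.re]
    refine integral_congr_ae (Eventually.of_forall fun s => ?_)
    have e1 : (z.re + s : ℝ) - z = (s : ℂ) - z.im * Complex.I := by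
      apply Complex.ext <;> simp
    simp only [add_sub_cancel_left, e1]
    split_ifs
    · rw [← div_eq_mul_inv, ← add_div, sub_add_cancel]
    · simp
  have iT := integrable_cauchy hi hz
  rw [add_right_comm, ← eN, cauchyFar, ← integral_add _ iF, cauchyT]
  · refine integral_congr_ae (Eventually.of_forall fun t => ?_)
    dsimp only
    split_ifs <;> simp
  · refine (iT.sub iF).congr (Eventually.of_forall fun t => ?_)
    simp only [Pi.sub_apply]
    split_ifs <;> simp

/-- The two logarithms cancel as `y → 0`; the constant `πi` is half of the jump, and below the axis
it changes sign. -/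
theorem integral_inv_sub_eq_of_pos {y : ℝ} (hy : 0 < y) :
    ∫ s : ℝ in (-1)..1, ((s : ℂ) - y * Complex.I)⁻¹
      = Complex.log (1 - y * Complex.I) - Complex.log (1 + y * Complex.I)
        + Real.pi * Complex.I := by
  have h1 := integral_horizontal_inv_sub (a := -1) (b := 1) (y := 0) (w := y * Complex.I)
    (by simpa using hy.ne)
  simp only [Complex.ofReal_zero, zero_mul, add_zero, Complex.ofReal_neg, Complex.ofReal_one] at h1
  have h2 := log_sub_log_neg_of_im_pos (z := 1 + y * Complex.I) (by simpa using hy)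
  rw [neg_add, ← sub_eq_add_neg] at h2
  rw [h1]
  linear_combination h2

theorem integral_inv_sub_eq_of_neg {y : ℝ} (hy : y < 0) :
    ∫ s : ℝ in (-1)..1, ((s : ℂ) - y * Complex.I)⁻¹
      = Complex.log (1 - y * Complex.I) - Complex.log (1 + y * Complex.I)
        - Real.pi * Complex.I := by
  have h1 := integral_horizontal_inv_sub (a := -1) (b := 1) (y := 0) (w := y * Complex.I)
    (by simpa using hy.ne')
  simp only [Complex.ofReal_zero, zero_mul, add_zero, Complex.ofReal_neg, Complex.ofReal_one] at h1
  have h2 := log_sub_log_neg_of_im_pos (z := -1 - y * Complex.I) (by simpa using hy)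
  rw [neg_sub', neg_neg, sub_neg_eq_add] at h2
  rw [h1]
  linear_combination -h2

theorem norm_log_sub_log_le (y : ℝ) :
    ‖Complex.log (1 - y * Complex.I) - Complex.log (1 + y * Complex.I)‖ ≤ 2 * Real.pi := by
  have hn : ‖(1 : ℂ) - y * Complex.I‖ = ‖(1 : ℂ) + y * Complex.I‖ := by
    have : (1 : ℂ) - y * Complex.I = (starRingEnd ℂ) (1 + y * Complex.I) := by
      simp [sub_eq_add_neg]
    rw [this, Complex.norm_conj]
  have : Complex.log (1 - y * Complex.I) - Complex.log (1 + y * Complex.I)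
      = ((Complex.arg (1 - y * Complex.I) - Complex.arg (1 + y * Complex.I) : ℝ) : ℂ)
        * Complex.I := by
    simp only [Complex.log, hn]; push_cast; ring
  rw [this, norm_mul, Complex.norm_I, mul_one, Complex.norm_real, Real.norm_eq_abs]
  have h1 := Complex.abs_arg_le_pi (1 - y * Complex.I)
  have h2 := Complex.abs_arg_le_pi (1 + y * Complex.I)
  rw [abs_le] at *
  constructor <;> linarith [h1.1, h1.2, h2.1, h2.2]

theorem norm_integral_inv_sub_le {y : ℝ} (hy : y ≠ 0) :
    ‖∫ s : ℝ in (-1)..1, ((s : ℂ) - y * Complex.I)⁻¹‖ ≤ 3 * Real.pi := by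
  have h := norm_log_sub_log_le y
  have hp : ‖(Real.pi : ℂ) * Complex.I‖ = Real.pi := by simp [abs_of_pos Real.pi_pos]
  rcases lt_or_gt_of_ne hy with h' | h'
  · rw [integral_inv_sub_eq_of_neg h']
    refine (norm_sub_le _ _).trans ?_
    rw [hp]; linarith
  · rw [integral_inv_sub_eq_of_pos h']
    refine (norm_add_le _ _).trans ?_
    rw [hp]; linarith

/-- The Cauchy transform of an integrable Hölder continuous function is bounded. -/
theorem IsHolder.exists_norm_cauchyT_le (hg : IsHolder g C α) (hi : Integrable g) :
    ∃ B, ∀ z ∈ offReal, ‖cauchyT g z‖ ≤ B := by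
  refine ⟨(∫ s : ℝ, C * if |s| < 1 then |s| ^ (α - 1) else 0) + (∫ t, ‖g t‖) +
    (C + ∫ t, ‖g t‖) * (3 * Real.pi), fun z hz => ?_⟩
  rw [hg.cauchyT_eq hi hz]
  refine (norm_add₃_le).trans ?_
  rw [norm_mul]
  gcongr
  · exact norm_integral_le_of_norm_le ((integrable_indicator_abs_rpow hg.1).const_mul C)
      (Eventually.of_forall fun s => hg.norm_near_le _ _ s)
  · exact norm_integral_le_of_norm_le hi.norm (Eventually.of_forall fun t => norm_far_le t)
  · have := hg.nonneg; have : 0 ≤ ∫ t, ‖g t‖ := integral_nonneg fun _ => norm_nonneg _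
    positivity
  · exact hg.bounded hi _
  · exact norm_integral_inv_sub_le hz

/-- The majorant `C |s|^(α - 1)` does not depend on `z`, so the convergence is across the axis, not
merely from one side. -/
theorem IsHolder.tendsto_cauchyNear (hg : IsHolder g C α) (x : ℝ) :
    Tendsto (cauchyNear g) (𝓝 x) (𝓝 (cauchyNear g x)) := by
  refine tendsto_integral_filter_of_dominated_convergence
    (fun s => C * if |s| < 1 then |s| ^ (α - 1) else 0)
    (Eventually.of_forall fun z => (measurable_near hg.continuous _ _).aestronglyMeasurable)
    (Eventually.of_forall fun z => Eventually.of_forall fun s => hg.norm_near_le _ _ s)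
    ((integrable_indicator_abs_rpow hg.1).const_mul C) ?_
  have h0 : ∀ᵐ s : ℝ, s ≠ 0 := by simp [ae_iff]
  filter_upwards [h0] with s hs
  split_ifs
  · have hc := hg.continuous
    refine Tendsto.div ?_ ?_ ?_
    · have : Continuous fun z : ℂ => g (z.re + s) - g z.re := by fun_prop
      exact this.tendsto _
    · have : Continuous fun z : ℂ => (s : ℂ) - z.im * Complex.I := by fun_prop
      exact this.tendsto _
    · simpa using hs
  · exact tendsto_const_nhds

theorem IsHolder.tendsto_cauchyFar (hg : IsHolder g C α) (hi : Integrable g) (x : ℝ) :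
    Tendsto (cauchyFar g) (𝓝 x) (𝓝 (cauchyFar g x)) := by
  refine tendsto_integral_filter_of_dominated_convergence (fun t => ‖g t‖)
    (Eventually.of_forall fun z => (measurable_far hg.continuous _).aestronglyMeasurable)
    (Eventually.of_forall fun z => Eventually.of_forall fun s => norm_far_le s) hi.norm ?_
  -- The moving cutoff is discontinuous only at the two endpoints `x ± 1`.
  have h0 : ∀ᵐ t : ℝ, t ≠ x + 1 := by simp [ae_iff]
  have h1 : ∀ᵐ t : ℝ, t ≠ x - 1 := by simp [ae_iff]
  filter_upwards [h0, h1] with t ht1 ht2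
  have hc : Continuous fun z : ℂ => |t - z.re| := by fun_prop
  have hne : |t - x| ≠ 1 := by
    intro h
    rcases (abs_eq one_pos.le).1 h with h | h
    · exact ht1 (by linarith)
    · exact ht2 (by linarith)
  rcases lt_or_gt_of_ne hne with h | h
  · have h2 : ∀ᶠ z : ℂ in 𝓝 (x : ℂ), |t - z.re| < 1 :=
      (hc.tendsto (x : ℂ)).eventually (gt_mem_nhds (by simpa using h))
    refine tendsto_const_nhds.congr' ?_
    filter_upwards [h2] with z hz
    simp [hz, h]
  · have h2 : ∀ᶠ z : ℂ in 𝓝 (x : ℂ), 1 < |t - z.re| :=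
      (hc.tendsto (x : ℂ)).eventually (lt_mem_nhds (by simpa using h))
    have h3 : Tendsto (fun z : ℂ => g t / (t - z)) (𝓝 x) (𝓝 (g t / (t - x))) := by
      refine tendsto_const_nhds.div (tendsto_const_nhds.sub tendsto_id) ?_
      intro h0
      have : t = x := by exact_mod_cast sub_eq_zero.1 h0
      rw [this] at h; simp at h; linarith
    have e : (if |t - (x : ℂ).re| < 1 then 0 else g t / (t - x)) = g t / (t - x) :=
      if_neg (by simpa using h.le)
    rw [e]
    refine h3.congr' ?_
    filter_upwards [h2] with z hz
    rw [if_neg hz.not_gt]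

/-- **Plemelj-Privalov**: the Cauchy transform of an integrable Hölder continuous function has
boundary values everywhere, and they satisfy the jump formula. -/
theorem IsHolder.tendsto_cauchyT (hg : IsHolder g C α) (hi : Integrable g) (x : ℝ) :
    ∃ L, Tendsto (cauchyT g) (𝓝[{z : ℂ | 0 < z.im}] (x : ℂ)) (𝓝 (L + Real.pi * Complex.I * g x)) ∧
      Tendsto (cauchyT g) (𝓝[{z : ℂ | z.im < 0}] (x : ℂ)) (𝓝 (L - Real.pi * Complex.I * g x)) := by
  have hlog : Tendsto (fun z : ℂ => Complex.log (1 - z.im * Complex.I)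
      - Complex.log (1 + z.im * Complex.I)) (𝓝 x) (𝓝 0) := by
    have h1 : Tendsto (fun z : ℂ => 1 - (z.im : ℂ) * Complex.I) (𝓝 x) (𝓝 1) := by
      have : Continuous fun z : ℂ => 1 - (z.im : ℂ) * Complex.I := by fun_prop
      simpa using this.tendsto x
    have h2 : Tendsto (fun z : ℂ => 1 + (z.im : ℂ) * Complex.I) (𝓝 x) (𝓝 1) := by
      have : Continuous fun z : ℂ => 1 + (z.im : ℂ) * Complex.I := by fun_prop
      simpa using this.tendsto x
    simpa using (h1.clog Complex.one_mem_slitPlane).sub (h2.clog Complex.one_mem_slitPlane)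
  have hgr : Tendsto (fun z : ℂ => g z.re) (𝓝 x) (𝓝 (g x)) := by
    have hc := hg.continuous
    have : Continuous fun z : ℂ => g z.re := by fun_prop
    simpa using this.tendsto x
  refine ⟨cauchyNear g x + cauchyFar g x, ?_, ?_⟩
  · have h := ((hg.tendsto_cauchyNear x).add (hg.tendsto_cauchyFar hi x)).add
      (hgr.mul (hlog.add_const (Real.pi * Complex.I)))
    rw [zero_add, mul_comm (g x)] at h
    refine (h.mono_left nhdsWithin_le_nhds).congr' ?_
    filter_upwards [self_mem_nhdsWithin] with z hz
    have hz : 0 < z.im := hz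
    rw [hg.cauchyT_eq hi hz.ne', integral_inv_sub_eq_of_pos hz]
  · have h := ((hg.tendsto_cauchyNear x).add (hg.tendsto_cauchyFar hi x)).add
      (hgr.mul (hlog.sub_const (Real.pi * Complex.I)))
    rw [zero_sub, mul_neg, mul_comm (g x), ← sub_eq_add_neg] at h
    refine (h.mono_left nhdsWithin_le_nhds).congr' ?_
    filter_upwards [self_mem_nhdsWithin] with z hz
    have hz : z.im < 0 := hz
    rw [hg.cauchyT_eq hi hz.ne, integral_inv_sub_eq_of_neg hz]

end Holder

/-! ### Moments of linear forms and the moment map -/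

section Moments

variable {p q : ℕ} {w₁ : Fin p → ℝ → ℝ} {w₂ : Fin q → ℝ → ℝ} {n : Fin p → ℕ} {m : Fin q → ℕ}

theorem linForm_add (w : Fin p → ℝ → ℝ) (A B : Fin p → ℂ[X]) (x : ℝ) :
    linForm w (A + B) x = linForm w A x + linForm w B x := by
  simp [linForm, add_mul, Finset.sum_add_distrib]

theorem linForm_sub (w : Fin p → ℝ → ℝ) (A B : Fin p → ℂ[X]) (x : ℝ) :
    linForm w (A - B) x = linForm w A x - linForm w B x := by
  simp [linForm, sub_mul, Finset.sum_sub_distrib]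

theorem linForm_smul (w : Fin p → ℝ → ℝ) (c : ℂ) (A : Fin p → ℂ[X]) (x : ℝ) :
    linForm w (c • A) x = c * linForm w A x := by
  simp [linForm, Finset.mul_sum, mul_assoc]

/-- The products `x^j w₁ₖ w₂ₗ` are integrable for `j ≤ nₖ + mₗ`. -/
def MomentsIntegrable (w₁ : Fin p → ℝ → ℝ) (w₂ : Fin q → ℝ → ℝ) (n : Fin p → ℕ)
    (m : Fin q → ℕ) : Prop :=
  ∀ k l, ∀ j ≤ n k + m l, Integrable fun x : ℝ => x ^ j * (w₁ k x * w₂ l x)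

/-- The zeroth power is integrable as a product of `L²` functions, the top power by assumption, and
`|x|^j ≤ 1 + |x|^N` covers those in between. -/
theorem momentsIntegrable (hn : ∀ k, 0 < n k) (hm : ∀ l, 0 < m l)
    (hF : ∀ k, ∀ j < n k, MemLp (fun x : ℝ => x ^ j * w₁ k x) 2)
    (hG : ∀ l, ∀ j < m l, MemLp (fun x : ℝ => x ^ j * w₂ l x) 2)
    (hW : ∀ k l, Integrable (fun x : ℝ => x ^ (n k + m l) * (w₁ k x * w₂ l x))) :
    MomentsIntegrable w₁ w₂ n m := by
  intro k l j hj
  have h0 : Integrable fun x : ℝ => w₁ k x * w₂ l x := by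
    simpa [Pi.mul_def] using (hF k 0 (hn k)).integrable_mul (hG l 0 (hm l))
  refine (h0.norm.add (hW k l).norm).mono' ((continuous_pow j).aestronglyMeasurable.mul h0.1)
    (Eventually.of_forall fun x => ?_)
  simp only [Pi.add_apply, norm_mul, norm_pow, Real.norm_eq_abs]
  rw [← one_add_mul (|x| ^ (n k + m l))]
  gcongr
  rcases le_total |x| 1 with h | h
  · have h1 := pow_le_one₀ (n := j) (abs_nonneg x) h
    have h2 : 0 ≤ |x| ^ (n k + m l) := by positivity
    linarith
  · have := pow_le_pow_right₀ h hj
    linarith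

theorem eval_mul_eq_sum (P : ℂ[X]) (j : ℕ) (x a : ℝ) :
    (x : ℂ) ^ j * (P.eval (x : ℂ) * a)
      = ∑ i ∈ Finset.range (P.natDegree + 1), P.coeff i * ((x ^ (i + j) * a : ℝ) : ℂ) := by
  rw [Polynomial.eval_eq_sum_range, Finset.sum_mul, Finset.mul_sum]
  refine Finset.sum_congr rfl fun i _ => ?_
  push_cast
  ring

theorem pow_mul_linForm_eq_sum (A : Fin p → ℂ[X]) (l : Fin q) (j : ℕ) (x : ℝ) :
    (x : ℂ) ^ j * (linForm w₁ A x * (w₂ l x : ℂ)) = ∑ k,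
      ∑ i ∈ Finset.range ((A k).natDegree + 1),
        (A k).coeff i * ((x ^ (i + j) * (w₁ k x * w₂ l x) : ℝ) : ℂ) := by
  rw [linForm, Finset.sum_mul, Finset.mul_sum]
  refine Finset.sum_congr rfl fun k _ => ?_
  rw [← eval_mul_eq_sum]
  push_cast
  ring

/-- Degree equal to `nₖ` and power equal to `mₗ` are both allowed: type II vectors attain the
former, and the remainder of the expansion at infinity needs the latter. -/
theorem MomentsIntegrable.pow_mul_linForm (h : MomentsIntegrable w₁ w₂ n m) {A : Fin p → ℂ[X]}
    (hA : ∀ k, (A k).natDegree ≤ n k) (l : Fin q) {j : ℕ} (hj : j ≤ m l) :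
    Integrable fun x : ℝ => (x : ℂ) ^ j * (linForm w₁ A x * (w₂ l x : ℂ)) := by
  simp only [pow_mul_linForm_eq_sum]
  refine integrable_finsetSum _ fun k _ => integrable_finsetSum _ fun i hi => ?_
  have := Finset.mem_range.1 hi
  have := hA k
  exact ((h k l (i + j) (by omega)).ofReal (𝕜 := ℂ)).const_mul _

/-- The moments of a linear form with respect to the second vector of weights. -/
noncomputable def formMoment (w₁ : Fin p → ℝ → ℝ) (w₂ : Fin q → ℝ → ℝ) (A : Fin p → ℂ[X])
    (l : Fin q) (j : ℕ) : ℂ :=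
  ∫ x : ℝ, linForm w₁ A x * (x : ℂ) ^ j * (w₂ l x : ℂ)

theorem formMoment_eq (A : Fin p → ℂ[X]) (l : Fin q) (j : ℕ) :
    formMoment w₁ w₂ A l j = ∫ x : ℝ, (x : ℂ) ^ j * (linForm w₁ A x * (w₂ l x : ℂ)) := by
  simp only [formMoment]
  congr 1
  funext x
  ring

theorem MomentsIntegrable.formMoment_add (h : MomentsIntegrable w₁ w₂ n m) {A B : Fin p → ℂ[X]}
    (hA : ∀ k, (A k).natDegree ≤ n k) (hB : ∀ k, (B k).natDegree ≤ n k) {l : Fin q} {j : ℕ}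
    (hj : j ≤ m l) :
    formMoment w₁ w₂ (A + B) l j = formMoment w₁ w₂ A l j + formMoment w₁ w₂ B l j := by
  simp only [formMoment_eq, linForm_add, add_mul, mul_add]
  exact integral_add (h.pow_mul_linForm hA l hj) (h.pow_mul_linForm hB l hj)

theorem MomentsIntegrable.formMoment_sub (h : MomentsIntegrable w₁ w₂ n m) {A B : Fin p → ℂ[X]}
    (hA : ∀ k, (A k).natDegree ≤ n k) (hB : ∀ k, (B k).natDegree ≤ n k) {l : Fin q} {j : ℕ}
    (hj : j ≤ m l) :
    formMoment w₁ w₂ (A - B) l j = formMoment w₁ w₂ A l j - formMoment w₁ w₂ B l j := by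
  simp only [formMoment_eq, linForm_sub, sub_mul, mul_sub]
  exact integral_sub (h.pow_mul_linForm hA l hj) (h.pow_mul_linForm hB l hj)

theorem formMoment_smul (c : ℂ) (A : Fin p → ℂ[X]) (l : Fin q) (j : ℕ) :
    formMoment w₁ w₂ (c • A) l j = c * formMoment w₁ w₂ A l j := by
  simp only [formMoment, linForm_smul, mul_assoc]
  exact integral_const_mul _ _

theorem natDegree_le_of_degree_lt {P : ℂ[X]} {d : ℕ} (h : P.degree < d) : P.natDegree ≤ d :=
  Polynomial.natDegree_le_of_degree_le h.le

/-! ### Vectors of polynomials, linear forms and their finite-dimensional linear algebra -/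

theorem memLp_linForm (hF : ∀ k, ∀ j < n k, MemLp (fun x : ℝ => x ^ j * w₁ k x) 2)
    {A : Fin p → ℂ[X]} (hA : ∀ k, (A k).degree < (n k : WithBot ℕ)) : MemLp (linForm w₁ A) 2 := by
  have e : linForm w₁ A = fun x : ℝ => ∑ k, ∑ i ∈ Finset.range (n k),
      (A k).coeff i * ((x ^ i * w₁ k x : ℝ) : ℂ) := by
    funext x
    refine Finset.sum_congr rfl fun k _ => ?_
    rcases eq_or_ne (A k) 0 with h0 | h0
    · simp [h0]
    rw [Polynomial.eval_eq_sum_range' ((Polynomial.natDegree_lt_iff_degree_lt h0).2 (hA k)),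
      Finset.sum_mul]
    refine Finset.sum_congr rfl fun i _ => ?_
    push_cast
    ring
  rw [e]
  exact memLp_finsetSum _ fun k _ => memLp_finsetSum _ fun i hi =>
    ((hF k i (Finset.mem_range.1 hi)).ofReal (K := ℂ)).const_mul _

/-- Vectors of polynomials with `deg Aₖ ≤ nₖ - 1`. -/
abbrev PolyVec (n : Fin p → ℕ) : Type := (k : Fin p) → Polynomial.degreeLT ℂ (n k)

/-- The underlying vector of polynomials. -/
def PolyVec.val (A : PolyVec n) : Fin p → ℂ[X] := fun k => A k

theorem PolyVec.degree_lt (A : PolyVec n) (k : Fin p) : (A.val k).degree < (n k : WithBot ℕ) :=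
  Polynomial.mem_degreeLT.1 (A k).2

theorem finrank_polyVec (n : Fin p → ℕ) : Module.finrank ℂ (PolyVec n) = ∑ k, n k := by
  rw [Module.finrank_pi_fintype]
  refine Finset.sum_congr rfl fun k _ => ?_
  rw [(Polynomial.degreeLTEquiv ℂ (n k)).finrank_eq, Module.finrank_fin_fun]

instance : FiniteDimensional ℂ (PolyVec n) := by
  have : ∀ k, FiniteDimensional ℂ (Polynomial.degreeLT ℂ (n k)) := fun k =>
    Module.Finite.equiv (Polynomial.degreeLTEquiv ℂ (n k)).symm
  infer_instance

/-- The map `A ↦ ∑ Aₖ w₁ₖ` onto the space of linear forms. -/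
noncomputable def formMap (hF : ∀ k, ∀ j < n k, MemLp (fun x : ℝ => x ^ j * w₁ k x) 2) :
    PolyVec n →ₗ[ℂ] formSpace w₁ n where
  toFun A := ⟨(memLp_linForm hF A.degree_lt).toLp _, A.val, A.degree_lt, MemLp.coeFn_toLp _⟩
  map_add' A B := by
    refine Subtype.ext (Lp.ext ?_)
    change ((memLp_linForm hF (A + B).degree_lt).toLp _ : ℝ → ℂ) =ᵐ[volume]
      ((memLp_linForm hF A.degree_lt).toLp _ + (memLp_linForm hF B.degree_lt).toLp _ :
        Lp ℂ 2 (volume : Measure ℝ))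
    filter_upwards [(memLp_linForm hF (A + B).degree_lt).coeFn_toLp,
      (memLp_linForm hF A.degree_lt).coeFn_toLp, (memLp_linForm hF B.degree_lt).coeFn_toLp,
      Lp.coeFn_add ((memLp_linForm hF A.degree_lt).toLp _) ((memLp_linForm hF B.degree_lt).toLp _)]
      with x h1 h2 h3 h4
    rw [h1, h4, Pi.add_apply, h2, h3, ← linForm_add]
    rfl
  map_smul' c A := by
    refine Subtype.ext (Lp.ext ?_)
    change ((memLp_linForm hF (c • A).degree_lt).toLp _ : ℝ → ℂ) =ᵐ[volume]
      (c • (memLp_linForm hF A.degree_lt).toLp _ : Lp ℂ 2 (volume : Measure ℝ))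
    filter_upwards [(memLp_linForm hF (c • A).degree_lt).coeFn_toLp,
      (memLp_linForm hF A.degree_lt).coeFn_toLp,
      Lp.coeFn_smul c ((memLp_linForm hF A.degree_lt).toLp _)] with x h1 h2 h4
    rw [h1, h4, Pi.smul_apply, h2, smul_eq_mul, ← linForm_smul]
    rfl

/-- The map is onto by construction, and a surjection between spaces of equal finite dimension is
injective. -/
theorem formMap_injective (hF : ∀ k, ∀ j < n k, MemLp (fun x : ℝ => x ^ j * w₁ k x) 2)
    (hdim : Module.finrank ℂ (formSpace w₁ n) = ∑ k, n k) :
    Function.Injective (formMap hF) := by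
  have hs : Function.Surjective (formMap hF) := by
    rintro ⟨f, A, hA, hf⟩
    refine ⟨fun k => ⟨A k, Polynomial.mem_degreeLT.2 (hA k)⟩, Subtype.ext (Lp.ext ?_)⟩
    exact (memLp_linForm hF hA).coeFn_toLp.trans hf.symm
  have : FiniteDimensional ℂ (formSpace w₁ n) := Module.Finite.of_surjective (formMap hF) hs
  exact (LinearMap.injective_iff_surjective_of_finrank_eq_finrank
    ((finrank_polyVec n).trans hdim.symm)).2 hs

/-- The moment map on vectors of polynomials. -/
noncomputable def momentMap (h : MomentsIntegrable w₁ w₂ n m) :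
    PolyVec n →ₗ[ℂ] ((l : Fin q) → Fin (m l) → ℂ) where
  toFun A l j := formMoment w₁ w₂ A.val l j
  map_add' A B := by
    funext l j
    exact h.formMoment_add (fun k => natDegree_le_of_degree_lt (A.degree_lt k))
      (fun k => natDegree_le_of_degree_lt (B.degree_lt k)) j.2.le
  map_smul' c A := by
    funext l j
    exact formMoment_smul c A.val l j

theorem momentMap_injective (h : MomentsIntegrable w₁ w₂ n m)
    (hF : ∀ k, ∀ j < n k, MemLp (fun x : ℝ => x ^ j * w₁ k x) 2)
    (hdim : Module.finrank ℂ (formSpace w₁ n) = ∑ k, n k)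
    (hFG : formSpace w₁ n ⊓ (formSpace w₂ m)ᗮ = ⊥) :
    Function.Injective (momentMap h) := by
  rw [injective_iff_map_eq_zero]
  intro A hA
  have hmom : ∀ l, ∀ j < m l, ∫ x : ℝ, (x : ℂ) ^ j * (linForm w₁ A.val x * (w₂ l x : ℂ)) = 0 := by
    intro l j hj
    rw [← formMoment_eq]
    exact congrFun (congrFun hA l) ⟨j, hj⟩
  -- The weights and `x` are real, so conjugation only touches the coefficients of `B`, and the
  -- inner product is a linear combination of the vanishing moments.
  have horth : (formMap hF A : Lp ℂ 2 (volume : Measure ℝ)) ∈ (formSpace w₂ m)ᗮ := by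
    rw [Submodule.mem_orthogonal]
    rintro u ⟨B, hB, hu⟩
    rw [L2.inner_def]
    have e : ∫ x : ℝ, inner ℂ (u x) ((formMap hF A : Lp ℂ 2 (volume : Measure ℝ)) x)
        = ∫ x : ℝ, ∑ l, ∑ i ∈ Finset.range (m l), (starRingEnd ℂ) ((B l).coeff i) *
          ((x : ℂ) ^ i * (linForm w₁ A.val x * (w₂ l x : ℂ))) := by
      refine integral_congr_ae ?_
      filter_upwards [hu, (memLp_linForm hF A.degree_lt).coeFn_toLp] with x h1 h2
      have h3 : ((formMap hF A : Lp ℂ 2 (volume : Measure ℝ)) : ℝ → ℂ) x = linForm w₁ A.val x := h2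
      rw [h1, h3, RCLike.inner_apply]
      generalize linForm w₁ A.val x = Q
      rw [linForm, map_sum, Finset.mul_sum]
      refine Finset.sum_congr rfl fun l _ => ?_
      rcases eq_or_ne (B l) 0 with h0 | h0
      · simp [h0]
      rw [Polynomial.eval_eq_sum_range' ((Polynomial.natDegree_lt_iff_degree_lt h0).2 (hB l)),
        map_mul, map_sum, Finset.sum_mul, Finset.mul_sum]
      refine Finset.sum_congr rfl fun i _ => ?_
      simp only [map_mul, map_pow, Complex.conj_ofReal]
      ring
    have hint : ∀ l, ∀ i ∈ Finset.range (m l), Integrable fun x : ℝ =>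
        (starRingEnd ℂ) ((B l).coeff i) *
          ((x : ℂ) ^ i * (linForm w₁ A.val x * (w₂ l x : ℂ))) := fun l i hi =>
      (h.pow_mul_linForm (fun k => natDegree_le_of_degree_lt (A.degree_lt k)) l
        (Finset.mem_range.1 hi).le).const_mul _
    rw [e, integral_finsetSum _ fun l _ => integrable_finsetSum _ (hint l)]
    refine Finset.sum_eq_zero fun l _ => ?_
    rw [integral_finsetSum _ (hint l)]
    refine Finset.sum_eq_zero fun i hi => ?_
    rw [integral_const_mul, hmom l i (Finset.mem_range.1 hi), mul_zero]
  have h0 : (formMap hF A : Lp ℂ 2 (volume : Measure ℝ)) ∈ formSpace w₁ n ⊓ (formSpace w₂ m)ᗮ :=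
    ⟨(formMap hF A).2, horth⟩
  rw [hFG, Submodule.mem_bot] at h0
  exact (injective_iff_map_eq_zero _).1 (formMap_injective hF hdim) A (Subtype.ext h0)

/-- Linear forms are determined by, and exist with, prescribed moments. -/
structure MomentsBijective (w₁ : Fin p → ℝ → ℝ) (w₂ : Fin q → ℝ → ℝ) (n : Fin p → ℕ)
    (m : Fin q → ℕ) : Prop where
  eq_zero : ∀ A : Fin p → ℂ[X], (∀ k, (A k).degree < (n k : WithBot ℕ)) →
    (∀ l, ∀ j < m l, formMoment w₁ w₂ A l j = 0) → A = 0
  exists_eq : ∀ y : Fin q → ℕ → ℂ, ∃ A : Fin p → ℂ[X],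
    (∀ k, (A k).degree < (n k : WithBot ℕ)) ∧ ∀ l, ∀ j < m l, formMoment w₁ w₂ A l j = y l j

theorem momentsBijective (h : MomentsIntegrable w₁ w₂ n m) (hnm : ∑ k, n k = ∑ l, m l)
    (hF : ∀ k, ∀ j < n k, MemLp (fun x : ℝ => x ^ j * w₁ k x) 2)
    (hdim : Module.finrank ℂ (formSpace w₁ n) = ∑ k, n k)
    (hFG : formSpace w₁ n ⊓ (formSpace w₂ m)ᗮ = ⊥) : MomentsBijective w₁ w₂ n m := by
  have hi := momentMap_injective h hF hdim hFG
  have hs : Function.Surjective (momentMap h) := by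
    refine (LinearMap.injective_iff_surjective_of_finrank_eq_finrank ?_).1 hi
    rw [finrank_polyVec, Module.finrank_pi_fintype, hnm]
    simp
  refine ⟨fun A hA hmom => ?_, fun y => ?_⟩
  · have h0 := (injective_iff_map_eq_zero _).1 hi
      (fun k => ⟨A k, Polynomial.mem_degreeLT.2 (hA k)⟩) (by
        funext l j
        exact hmom l j j.2)
    funext k
    exact congrArg Subtype.val (congrFun h0 k)
  · obtain ⟨A, hA⟩ := hs fun l j => y l j
    exact ⟨A.val, A.degree_lt, fun l j hj => congrFun (congrFun hA l) ⟨j, hj⟩⟩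

end Moments

/-! ### Normality of the neighbouring pairs -/

section Normality

variable {p q : ℕ} {w₁ : Fin p → ℝ → ℝ} {w₂ : Fin q → ℝ → ℝ} {n : Fin p → ℕ} {m : Fin q → ℕ}

theorem natDegree_le_of_degree_lt_add_single {A : Fin p → ℂ[X]} {k : Fin p}
    (hA : ∀ j, (A j).degree < (((n + Pi.single k 1 : Fin p → ℕ) j : ℕ) : WithBot ℕ)) (j : Fin p) :
    (A j).natDegree ≤ n j := by
  have h1 : (n + Pi.single k 1 : Fin p → ℕ) j ≤ n j + 1 := by
    rcases eq_or_ne j k with rfl | h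
    · simp
    · simp [h]
  rcases eq_or_ne (A j) 0 with h0 | h0
  · simp [h0]
  · have := (Polynomial.natDegree_lt_iff_degree_lt h0).2 (hA j)
    omega

theorem IsMixedMOP.natDegree_le {A : Fin p → ℂ[X]} {k : Fin p}
    (hA : IsMixedMOP w₁ w₂ (n + Pi.single k 1) m A) (j : Fin p) : (A j).natDegree ≤ n j :=
  natDegree_le_of_degree_lt_add_single hA.deg j

/-- Subtract from the monomial `x^(nₖ)` in slot `k` the vector of lower degrees with the same
moments. -/
theorem MomentsBijective.exists_typeII (hb : MomentsBijective w₁ w₂ n m)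
    (h : MomentsIntegrable w₁ w₂ n m) (k : Fin p) :
    ∃ A, IsTypeII w₁ w₂ (n + Pi.single k 1) m k A := by
  obtain ⟨V, hVk, hVj⟩ : ∃ V : Fin p → ℂ[X], V k = Polynomial.X ^ n k ∧ ∀ j ≠ k, V j = 0 :=
    ⟨Pi.single k (Polynomial.X ^ n k), Pi.single_eq_same _ _, fun j hj => Pi.single_eq_of_ne hj _⟩
  obtain ⟨B, hB, hBm⟩ := hb.exists_eq fun l j => formMoment w₁ w₂ V l j
  have hV : ∀ j, (V j).degree < (((n + Pi.single k 1 : Fin p → ℕ) j : ℕ) : WithBot ℕ) := by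
    intro j
    rcases eq_or_ne j k with rfl | h
    · rw [hVk, Polynomial.degree_X_pow, Pi.add_apply, Pi.single_eq_same]
      exact Nat.cast_lt.2 (Nat.lt_succ_self _)
    · rw [hVj j h, Polynomial.degree_zero]
      exact WithBot.bot_lt_coe _
  have hBk : (B k).degree < (V k).degree := by
    rw [hVk, Polynomial.degree_X_pow]
    exact hB k
  refine ⟨V - B, ⟨fun j => ?_, fun l j hj => ?_⟩, ?_, ?_⟩
  · have h1 : n j ≤ (n + Pi.single k 1 : Fin p → ℕ) j := Nat.le_add_right _ _
    exact (Polynomial.degree_sub_le _ _).trans_lt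
      (max_lt (hV j) ((hB j).trans_le (Nat.cast_le.2 h1)))
  · have h1 := h.formMoment_sub (natDegree_le_of_degree_lt_add_single hV)
      (fun k => natDegree_le_of_degree_lt (hB k)) hj.le
    rw [hBm l j hj, sub_self] at h1
    exact h1
  · have h1 : (V k).Monic := hVk ▸ Polynomial.monic_X_pow _
    exact h1.sub_of_left hBk
  · rw [Pi.sub_apply, Pi.add_apply, Pi.single_eq_same,
      Polynomial.natDegree_eq_of_degree_eq (Polynomial.degree_sub_eq_left_of_degree_lt hBk), hVk,
      Polynomial.natDegree_X_pow]

theorem IsTypeII.natDegree_eq {A : Fin p → ℂ[X]} {k : Fin p}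
    (hA : IsTypeII w₁ w₂ (n + Pi.single k 1) m k A) : (A k).natDegree = n k := by
  have := hA.2.2
  simp only [Pi.add_apply, Pi.single_eq_same] at this
  omega

/-- Cancelling the coefficient of `x^(nₖ)` brings the difference into the space on which vanishing
moments force zero. -/
theorem MomentsBijective.eq_smul_typeII (hb : MomentsBijective w₁ w₂ n m)
    (h : MomentsIntegrable w₁ w₂ n m) {k : Fin p} {A B : Fin p → ℂ[X]}
    (hA : IsTypeII w₁ w₂ (n + Pi.single k 1) m k A)
    (hB : IsMixedMOP w₁ w₂ (n + Pi.single k 1) m B) : B = (B k).coeff (n k) • A := by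
  set c := (B k).coeff (n k) with hc
  have hcA : ∀ j, ((c • A) j).natDegree ≤ n j := fun j =>
    (Polynomial.natDegree_smul_le c (A j)).trans (hA.1.natDegree_le j)
  rw [← sub_eq_zero]
  refine hb.eq_zero _ (fun j => ?_) fun l j hj => ?_
  · have hdeg : ((B - c • A) j).degree ≤ n j :=
      (Polynomial.degree_sub_le _ _).trans (max_le
        (Polynomial.natDegree_le_iff_degree_le.1 (hB.natDegree_le j))
        (Polynomial.natDegree_le_iff_degree_le.1 (hcA j)))
    rcases eq_or_ne j k with rfl | hjk
    · refine (Polynomial.degree_lt_iff_coeff_zero _ _).2 fun i hi => ?_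
      rcases hi.eq_or_lt with rfl | hi
      · have h1 : (A j).coeff (n j) = 1 := by
          have := hA.2.1.coeff_natDegree
          rwa [hA.natDegree_eq] at this
        simp [h1, hc]
      · exact Polynomial.coeff_eq_zero_of_degree_lt (hdeg.trans_lt (by exact_mod_cast hi))
    · have h1 := hB.deg j
      have h2 := hA.1.deg j
      simp only [Pi.add_apply, Pi.single_eq_of_ne hjk, add_zero] at h1 h2
      exact (Polynomial.degree_sub_le _ _).trans_lt (max_lt h1
        ((Polynomial.degree_smul_le c (A j)).trans_lt h2))
  · rw [h.formMoment_sub hB.natDegree_le hcA hj.le, formMoment_smul]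
    have h1 : formMoment w₁ w₂ A l j = 0 := hA.1.orth l j hj
    have h2 : formMoment w₁ w₂ B l j = 0 := hB.orth l j hj
    rw [h1, h2, mul_zero, sub_zero]

theorem MomentsBijective.typeII_unique (hb : MomentsBijective w₁ w₂ n m)
    (h : MomentsIntegrable w₁ w₂ n m) {k : Fin p} {A B : Fin p → ℂ[X]}
    (hA : IsTypeII w₁ w₂ (n + Pi.single k 1) m k A)
    (hB : IsTypeII w₁ w₂ (n + Pi.single k 1) m k B) : B = A := by
  have h1 := hb.eq_smul_typeII h hA hB.1
  have h2 : (B k).coeff (n k) = 1 := by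
    have := hB.2.1.coeff_natDegree
    rwa [hB.natDegree_eq] at this
  rwa [h2, one_smul] at h1

theorem MomentsBijective.isNormalPair_add (hb : MomentsBijective w₁ w₂ n m)
    (h : MomentsIntegrable w₁ w₂ n m) (hnm : ∑ k, n k = ∑ l, m l) (k : Fin p) :
    IsNormalPair w₁ w₂ (n + Pi.single k 1) m := by
  obtain ⟨A, hA⟩ := hb.exists_typeII h k
  refine ⟨?_, A, fun h0 => ?_, hA.1, fun B hB => ⟨_, hb.eq_smul_typeII h hA hB⟩⟩
  · simp [Finset.sum_add_distrib, hnm]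
  · have := hA.2.1.ne_zero
    simp [h0] at this

theorem sub_single_lt {k l : Fin q} {j : ℕ}
    (hj : j < (m - Pi.single k 1 : Fin q → ℕ) l) : j < m l ∧ ¬(l = k ∧ j = m k - 1) := by
  rcases eq_or_ne l k with rfl | h
  · simp only [Pi.sub_apply, Pi.single_eq_same] at hj
    exact ⟨by omega, fun h => by omega⟩
  · simp only [Pi.sub_apply, Pi.single_eq_of_ne h] at hj
    exact ⟨by omega, fun h' => h h'.1⟩

theorem lt_sub_single {k l : Fin q} {j : ℕ} (hj : j < m l) (h : ¬(l = k ∧ j = m k - 1)) :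
    j < (m - Pi.single k 1 : Fin q → ℕ) l := by
  rcases eq_or_ne l k with rfl | hlk
  · simp only [Pi.sub_apply, Pi.single_eq_same]
    have : j ≠ m l - 1 := fun h' => h ⟨rfl, h'⟩
    omega
  · simpa [hlk] using hj

theorem MomentsBijective.exists_typeI (hb : MomentsBijective w₁ w₂ n m) (hm : ∀ l, 0 < m l)
    (k : Fin q) : ∃ A, IsTypeI w₁ w₂ n (m - Pi.single k 1) k A := by
  -- The pair `(k, mₖ - 1)` is the one moment condition dropped on passing from `m` to `m - eₖ`.
  obtain ⟨A, hA, hAm⟩ := hb.exists_eq fun l j => if l = k ∧ j = m k - 1 then 1 else 0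
  refine ⟨A, ⟨hA, fun l j hj => ?_⟩, ?_⟩
  · obtain ⟨h1, h2⟩ := sub_single_lt hj
    exact (hAm l j h1).trans (if_neg h2)
  · have := hm k
    have h1 := hAm k (m k - 1) (by omega)
    simp only [and_self, if_true] at h1
    simpa [formMoment] using h1

/-- The scalar is the value of the dropped moment, so that the difference has all moments equal to
zero. -/
theorem MomentsBijective.eq_smul_typeI (hb : MomentsBijective w₁ w₂ n m)
    (h : MomentsIntegrable w₁ w₂ n m) {k : Fin q} {A B : Fin p → ℂ[X]}
    (hA : IsTypeI w₁ w₂ n (m - Pi.single k 1) k A)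
    (hB : IsMixedMOP w₁ w₂ n (m - Pi.single k 1) B) :
    B = formMoment w₁ w₂ B k (m k - 1) • A := by
  set c := formMoment w₁ w₂ B k (m k - 1) with hc
  have hcA : ∀ j, ((c • A) j).natDegree ≤ n j := fun j =>
    (Polynomial.natDegree_smul_le c (A j)).trans (natDegree_le_of_degree_lt (hA.1.deg j))
  rw [← sub_eq_zero]
  refine hb.eq_zero _ (fun j => ?_) fun l j hj => ?_
  · exact (Polynomial.degree_sub_le _ _).trans_lt (max_lt (hB.deg j)
      ((Polynomial.degree_smul_le c (A j)).trans_lt (hA.1.deg j)))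
  · rw [h.formMoment_sub (fun k => natDegree_le_of_degree_lt (hB.deg k)) hcA hj.le,
      formMoment_smul]
    by_cases hlj : l = k ∧ j = m k - 1
    · obtain ⟨rfl, rfl⟩ := hlj
      have h1 : formMoment w₁ w₂ A l (m l - 1) = 1 := by
        simpa [formMoment] using hA.2
      rw [h1, hc, mul_one, sub_self]
    · have h1 : formMoment w₁ w₂ A l j = 0 := hA.1.orth l j (lt_sub_single hj hlj)
      have h2 : formMoment w₁ w₂ B l j = 0 := hB.orth l j (lt_sub_single hj hlj)
      rw [h1, h2, mul_zero, sub_zero]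

theorem MomentsBijective.typeI_unique (hb : MomentsBijective w₁ w₂ n m)
    (h : MomentsIntegrable w₁ w₂ n m) {k : Fin q} {A B : Fin p → ℂ[X]}
    (hA : IsTypeI w₁ w₂ n (m - Pi.single k 1) k A)
    (hB : IsTypeI w₁ w₂ n (m - Pi.single k 1) k B) : B = A := by
  have h1 := hb.eq_smul_typeI h hA hB.1
  have h2 : formMoment w₁ w₂ B k (m k - 1) = 1 := by
    simpa [formMoment] using hB.2
  rwa [h2, one_smul] at h1

theorem MomentsBijective.isNormalPair_sub (hb : MomentsBijective w₁ w₂ n m)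
    (h : MomentsIntegrable w₁ w₂ n m) (hm : ∀ l, 0 < m l) (hnm : ∑ k, n k = ∑ l, m l)
    (k : Fin q) : IsNormalPair w₁ w₂ n (m - Pi.single k 1) := by
  obtain ⟨A, hA⟩ := hb.exists_typeI hm k
  refine ⟨?_, A, fun h0 => ?_, hA.1, fun B hB => ⟨_, hb.eq_smul_typeI h hA hB⟩⟩
  · have h1 : m = (m - Pi.single k 1) + Pi.single k 1 := by
      funext l
      rcases eq_or_ne l k with rfl | hl
      · have := hm l
        simp only [Pi.add_apply, Pi.sub_apply, Pi.single_eq_same]; omega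
      · simp [hl]
    rw [hnm]
    conv_lhs => rw [h1]
    simp only [Pi.add_apply, Finset.sum_add_distrib, Finset.sum_pi_single', Finset.mem_univ,
      if_true]
  · have := hA.2
    simp [h0, linForm] at this

/-- The moments of the type I form. -/
theorem IsTypeI.formMoment_eq {k : Fin q} {A : Fin p → ℂ[X]}
    (hA : IsTypeI w₁ w₂ n (m - Pi.single k 1) k A) {l : Fin q} {j : ℕ} (hj : j < m l) :
    formMoment w₁ w₂ A l j = if l = k ∧ j = m k - 1 then 1 else 0 := by
  split_ifs with hlj
  · obtain ⟨rfl, rfl⟩ := hlj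
    simpa [formMoment] using hA.2
  · exact hA.1.orth l j (lt_sub_single hj hlj)

end Normality

/-! ### Solutions built from vectors of polynomials -/

section Existence

variable {p q : ℕ} {w₁ : Fin p → ℝ → ℝ} {w₂ : Fin q → ℝ → ℝ} {n : Fin p → ℕ} {m : Fin q → ℕ}

theorem mul_jumpMatrix_inl (M : BlockMat p q) (x : ℝ) (i : Fin p ⊕ Fin q) (k : Fin p) :
    (M * jumpMatrix w₁ w₂ x) i (Sum.inl k) = M i (Sum.inl k) := by
  simp [jumpMatrix, Matrix.mul_apply, Fintype.sum_sum_type, Matrix.one_apply]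

theorem mul_jumpMatrix_inr (M : BlockMat p q) (x : ℝ) (i : Fin p ⊕ Fin q) (l : Fin q) :
    (M * jumpMatrix w₁ w₂ x) i (Sum.inr l)
      = ∑ k, M i (Sum.inl k) * ((w₁ k x : ℂ) * (w₂ l x : ℂ)) + M i (Sum.inr l) := by
  simp [jumpMatrix, Matrix.mul_apply, Fintype.sum_sum_type, Matrix.one_apply]

theorem mul_asympMatrix_inl (M : BlockMat p q) (z : ℂ) (i : Fin p ⊕ Fin q) (k : Fin p) :
    (M * asympMatrix n m z) i (Sum.inl k) = M i (Sum.inl k) * z ^ n k := by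
  simp [asympMatrix, Matrix.mul_apply, Matrix.diagonal_apply]

theorem mul_asympMatrix_inr (M : BlockMat p q) (z : ℂ) (i : Fin p ⊕ Fin q) (l : Fin q) :
    (M * asympMatrix n m z) i (Sum.inr l) = M i (Sum.inr l) * (z ^ m l)⁻¹ := by
  simp [asympMatrix, Matrix.mul_apply, Matrix.diagonal_apply]

/-- The scalar functions `(∑ Aₖ w₁ₖ) w₂ₗ`. -/
noncomputable def formWeight (w₁ : Fin p → ℝ → ℝ) (w₂ : Fin q → ℝ → ℝ) (A : Fin p → ℂ[X])
    (l : Fin q) (x : ℝ) : ℂ :=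
  linForm w₁ A x * (w₂ l x : ℂ)

theorem formWeight_eq_sum (A : Fin p → ℂ[X]) (l : Fin q) (x : ℝ) :
    formWeight w₁ w₂ A l x = ∑ k, (A k).eval (x : ℂ) * ((w₁ k x : ℂ) * (w₂ l x : ℂ)) := by
  simp [formWeight, linForm, Finset.sum_mul, mul_assoc]

theorem MomentsIntegrable.formWeight (h : MomentsIntegrable w₁ w₂ n m) {A : Fin p → ℂ[X]}
    (hA : ∀ k, (A k).natDegree ≤ n k) (l : Fin q) : Integrable (formWeight w₁ w₂ A l) := by
  have := h.pow_mul_linForm hA l (Nat.zero_le _)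
  simp only [pow_zero, one_mul] at this
  exact this

/-- The matrix whose rows consist of polynomials and of the Cauchy transforms of the associated
linear forms. -/
noncomputable def rhMatrix (w₁ : Fin p → ℝ → ℝ) (w₂ : Fin q → ℝ → ℝ)
    (a : Fin p ⊕ Fin q → Fin p → ℂ[X]) (z : ℂ) : BlockMat p q :=
  Matrix.of fun i => Sum.elim (fun k => (a i k).eval z)
    fun l => (2 * Real.pi * Complex.I)⁻¹ * cauchyT (formWeight w₁ w₂ (a i) l) z

theorem rhMatrix_inl (a : Fin p ⊕ Fin q → Fin p → ℂ[X]) (z : ℂ) (i : Fin p ⊕ Fin q) (k : Fin p) :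
    rhMatrix w₁ w₂ a z i (Sum.inl k) = (a i k).eval z := rfl

theorem rhMatrix_inr (a : Fin p ⊕ Fin q → Fin p → ℂ[X]) (z : ℂ) (i : Fin p ⊕ Fin q) (l : Fin q) :
    rhMatrix w₁ w₂ a z i (Sum.inr l)
      = (2 * Real.pi * Complex.I)⁻¹ * cauchyT (formWeight w₁ w₂ (a i) l) z := rfl

theorem differentiableOn_rhMatrix (h : MomentsIntegrable w₁ w₂ n m)
    {a : Fin p ⊕ Fin q → Fin p → ℂ[X]} (ha : ∀ i k, (a i k).natDegree ≤ n k)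
    (i j : Fin p ⊕ Fin q) : DifferentiableOn ℂ (fun z => rhMatrix w₁ w₂ a z i j) offReal := by
  rcases j with k | l
  · exact (a i k).differentiable.differentiableOn
  · exact (differentiableOn_cauchyT (h.formWeight (ha i) l)).const_mul _

theorem tendsto_add_mul_I (x c : ℝ) :
    Tendsto (fun ε : ℝ => (x : ℂ) + c * ε * Complex.I) (𝓝[>] 0) (𝓝 (x : ℂ)) := by
  have : Continuous fun ε : ℝ => (x : ℂ) + c * ε * Complex.I := by fun_prop
  simpa using (this.tendsto 0).mono_left nhdsWithin_le_nhds

theorem rhMatrix_jump_ae (h : MomentsIntegrable w₁ w₂ n m)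
    {a : Fin p ⊕ Fin q → Fin p → ℂ[X]} (ha : ∀ i k, (a i k).natDegree ≤ n k) :
    ∀ᵐ x : ℝ, ∃ Yp Ym : BlockMat p q,
      Tendsto (fun ε : ℝ => rhMatrix w₁ w₂ a ((x : ℂ) + ε * Complex.I)) (𝓝[>] 0) (𝓝 Yp) ∧
      Tendsto (fun ε : ℝ => rhMatrix w₁ w₂ a ((x : ℂ) - ε * Complex.I)) (𝓝[>] 0) (𝓝 Ym) ∧
      Yp = Ym * jumpMatrix w₁ w₂ x := by
  have hae := ae_all_iff.2 fun i => ae_all_iff.2 fun l =>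
    ae_exists_tendsto_cauchyT (h.formWeight (ha i) l)
  filter_upwards [hae] with x hx
  choose L hLp hLm using hx
  refine ⟨Matrix.of fun i => Sum.elim (fun k => (a i k).eval (x : ℂ))
      fun l => (2 * Real.pi * Complex.I)⁻¹ * L i l,
    Matrix.of fun i => Sum.elim (fun k => (a i k).eval (x : ℂ))
      fun l => (2 * Real.pi * Complex.I)⁻¹ *
        (L i l - 2 * Real.pi * Complex.I * formWeight w₁ w₂ (a i) l x), ?_, ?_, ?_⟩
  · refine tendsto_pi_nhds.2 fun i => tendsto_pi_nhds.2 fun j => ?_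
    rcases j with k | l
    · have := ((a i k).continuous.tendsto (x : ℂ)).comp (tendsto_add_mul_I x 1)
      simpa [Function.comp_def, rhMatrix] using this
    · exact (hLp i l).const_mul _
  · refine tendsto_pi_nhds.2 fun i => tendsto_pi_nhds.2 fun j => ?_
    rcases j with k | l
    · have := ((a i k).continuous.tendsto (x : ℂ)).comp (tendsto_add_mul_I x (-1))
      simpa [Function.comp_def, rhMatrix, ← sub_eq_add_neg] using this
    · exact (hLm i l).const_mul _
  · ext i j
    rcases j with k | l
    · rw [mul_jumpMatrix_inl]
      rfl
    · rw [mul_jumpMatrix_inr]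
      simp only [Matrix.of_apply, Sum.elim_inl, Sum.elim_inr, ← formWeight_eq_sum]
      rw [mul_sub, inv_mul_cancel_left₀ Complex.two_pi_I_ne_zero]
      ring

/-- Only the `G i` need be measurable, since additivity of the lower integral asks it of one summand
alone. -/
theorem tendsto_lintegral_zero_of_le {ι α : Type*} [MeasurableSpace α] {μ : Measure α}
    {s : Finset ι} {l : Filter ℝ} {F A : ℝ → α → ℝ≥0∞} {G : ι → ℝ → α → ℝ≥0∞}
    (hG : ∀ i ∈ s, ∀ᶠ ε in l, AEMeasurable (G i ε) μ)
    (hle : ∀ ε x, F ε x ≤ A ε x + ∑ i ∈ s, G i ε x)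
    (hA : Tendsto (fun ε => ∫⁻ x, A ε x ∂μ) l (𝓝 0))
    (h : ∀ i ∈ s, Tendsto (fun ε => ∫⁻ x, G i ε x ∂μ) l (𝓝 0)) :
    Tendsto (fun ε => ∫⁻ x, F ε x ∂μ) l (𝓝 0) := by
  refine tendsto_of_tendsto_of_tendsto_of_le_of_le' tendsto_const_nhds
    (h := fun ε => ∫⁻ x, A ε x ∂μ + ∑ i ∈ s, ∫⁻ x, G i ε x ∂μ) ?_
    (Eventually.of_forall fun _ => zero_le) ?_
  · simpa using hA.add (tendsto_finsetSum s h)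
  · filter_upwards [(eventually_all_finset s).2 hG] with ε hε
    rw [← lintegral_finsetSum' _ hε, ← lintegral_add_right' _
      (Finset.aemeasurable_fun_sum _ hε)]
    exact lintegral_mono (hle ε)

/-- The jump matrix multiplies polynomials taken at `x - iε`, whereas Plemelj produces the form at
`x`. The error is therefore the `L¹` Plemelj error plus shift errors of the polynomials. -/
theorem rhMatrix_jump_L1 (h : MomentsIntegrable w₁ w₂ n m)
    {a : Fin p ⊕ Fin q → Fin p → ℂ[X]} (ha : ∀ i k, (a i k).natDegree ≤ n k) (s t : ℝ)
    (i j : Fin p ⊕ Fin q) :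
    Tendsto (fun ε : ℝ => ∫⁻ x in Set.Icc s t,
      ‖(rhMatrix w₁ w₂ a ((x : ℂ) + ε * Complex.I)
        - rhMatrix w₁ w₂ a ((x : ℂ) - ε * Complex.I) * jumpMatrix w₁ w₂ x) i j‖ₑ)
      (𝓝[>] 0) (𝓝 0) := by
  rcases j with k | l
  · have h1 : ∀ c : ℝ, Tendsto (fun ε : ℝ => ∫⁻ x in Set.Icc s t,
        ‖(a i k).eval ((x : ℂ) + c * ε * Complex.I) - (a i k).eval (x : ℂ)‖ₑ) (𝓝[>] 0) (𝓝 0) := by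
      intro c
      simpa using tendsto_lintegral_shift_sub_mul (a := s) (b := t) (a i k).continuous
        (v := fun _ => 1) (continuousOn_const.integrableOn_Icc) c
    refine tendsto_lintegral_zero_of_le (s := {()})
      (G := fun _ (ε : ℝ) (x : ℝ) => ‖(a i k).eval ((x : ℂ) + ((-1 : ℝ) : ℂ) * ε * Complex.I)
        - (a i k).eval (x : ℂ)‖ₑ)
      (fun _ _ => Eventually.of_forall fun ε => ?_) (fun ε x => ?_) (h1 1) fun _ _ => h1 (-1)
    · have : Continuous fun x : ℝ => (a i k).eval ((x : ℂ) + ((-1 : ℝ) : ℂ) * ε * Complex.I)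
        - (a i k).eval (x : ℂ) := by fun_prop
      exact this.aestronglyMeasurable.enorm
    · rw [Matrix.sub_apply, mul_jumpMatrix_inl, rhMatrix_inl, rhMatrix_inl]
      simp only [Finset.sum_singleton, Complex.ofReal_one, one_mul, Complex.ofReal_neg, neg_mul,
        ← sub_eq_add_neg]
      rw [← sub_sub_sub_cancel_right _ _ ((a i k).eval (x : ℂ))]
      exact enorm_sub_le
  · have hf := h.formWeight (ha i) l
    have hw : ∀ k, IntegrableOn (fun x : ℝ => ((w₁ k x : ℂ) * (w₂ l x : ℂ))) (Set.Icc s t) := by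
      intro k
      have := ((h k l 0 (Nat.zero_le _)).ofReal (𝕜 := ℂ)).integrableOn (s := Set.Icc s t)
      simpa using this
    have h1 : Tendsto (fun ε : ℝ => ∫⁻ x in Set.Icc s t, ‖(2 * Real.pi * Complex.I : ℂ)⁻¹‖ₑ *
        ‖cauchyT (formWeight w₁ w₂ (a i) l) ((x : ℂ) + ε * Complex.I)
          - cauchyT (formWeight w₁ w₂ (a i) l) ((x : ℂ) - ε * Complex.I)
          - 2 * Real.pi * Complex.I * formWeight w₁ w₂ (a i) l x‖ₑ) (𝓝[>] 0) (𝓝 0) := by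
      have h2 := ENNReal.Tendsto.const_mul (a := ‖(2 * Real.pi * Complex.I : ℂ)⁻¹‖ₑ)
        (tendsto_lintegral_cauchyT_jump hf) (Or.inr enorm_ne_top)
      rw [mul_zero] at h2
      refine tendsto_of_tendsto_of_tendsto_of_le_of_le tendsto_const_nhds h2
        (fun _ => zero_le) fun ε => ?_
      rw [lintegral_const_mul' _ _ enorm_ne_top]
      exact mul_le_mul' le_rfl (setLIntegral_le_lintegral _ _)
    refine tendsto_lintegral_zero_of_le (s := Finset.univ)
      (G := fun (k : Fin p) (ε : ℝ) (x : ℝ) => ‖((a i k).eval ((x : ℂ) +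
        ((-1 : ℝ) : ℂ) * ε * Complex.I) - (a i k).eval (x : ℂ)) *
          ((w₁ k x : ℂ) * (w₂ l x : ℂ))‖ₑ)
      (fun k _ => Eventually.of_forall fun ε => ?_) (fun ε x => ?_) h1 fun k _ =>
        tendsto_lintegral_shift_sub_mul (a i k).continuous (hw k) (-1)
    · have : Continuous fun x : ℝ => (a i k).eval ((x : ℂ) + ((-1 : ℝ) : ℂ) * ε * Complex.I)
        - (a i k).eval (x : ℂ) := by fun_prop
      exact (this.aestronglyMeasurable.mul (hw k).1).enorm
    · rw [Matrix.sub_apply, mul_jumpMatrix_inr]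
      simp only [rhMatrix_inl, rhMatrix_inr, ← enorm_mul]
      have e : ∀ u v : ℂ, (2 * Real.pi * Complex.I : ℂ)⁻¹ * u
          - (∑ k, (a i k).eval ((x : ℂ) - ε * Complex.I) * ((w₁ k x : ℂ) * (w₂ l x : ℂ))
            + (2 * Real.pi * Complex.I : ℂ)⁻¹ * v)
          = (2 * Real.pi * Complex.I : ℂ)⁻¹ *
            (u - v - 2 * Real.pi * Complex.I * formWeight w₁ w₂ (a i) l x)
          - ∑ k, ((a i k).eval ((x : ℂ) + ((-1 : ℝ) : ℂ) * ε * Complex.I)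
            - (a i k).eval (x : ℂ)) * ((w₁ k x : ℂ) * (w₂ l x : ℂ)) := by
        intro u v
        simp only [sub_mul, Finset.sum_sub_distrib, ← formWeight_eq_sum, Complex.ofReal_neg,
          Complex.ofReal_one, neg_mul, one_mul, ← sub_eq_add_neg]
        rw [mul_sub, inv_mul_cancel_left₀ Complex.two_pi_I_ne_zero]
        ring
      rw [e]
      refine enorm_sub_le.trans ?_
      gcongr
      exact enorm_sum_le _ _

theorem isBigO_inv_of_degree_lt {P : ℂ[X]} {d : ℕ} (hP : P.degree < d) :
    (fun z : ℂ => P.eval z * (z ^ d)⁻¹) =O[Bornology.cobounded ℂ] fun z => z⁻¹ := by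
  rcases eq_or_ne P 0 with h0 | h0
  · simpa [h0] using Asymptotics.isBigO_zero _ _
  simp only [Polynomial.eval_eq_sum_range' ((Polynomial.natDegree_lt_iff_degree_lt h0).2 hP),
    Finset.sum_mul, mul_assoc]
  refine Asymptotics.IsBigO.fun_sum fun i hi => Asymptotics.IsBigO.const_mul_left ?_ _
  refine Asymptotics.IsBigO.of_bound 1 ?_
  filter_upwards [tendsto_norm_cobounded_atTop.eventually_ge_atTop 1] with z hz
  have hz0 : 0 < ‖z‖ := by linarith
  rw [norm_mul, norm_inv, norm_inv, norm_pow, norm_pow, one_mul, ← div_eq_mul_inv,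
    div_le_iff₀ (by positivity), inv_mul_eq_div, le_div_iff₀ hz0, ← pow_succ]
  exact pow_le_pow_right₀ hz (Finset.mem_range.1 hi)

theorem isBigO_cone_of_isBigO_im {f : ℂ → ℂ} {δ : ℝ} (hδ : 0 < δ)
    (hf : f =O[Bornology.cobounded ℂ ⊓ 𝓟 offReal] fun z => (|z.im|)⁻¹) :
    f =O[Bornology.cobounded ℂ ⊓ 𝓟 (offReal ∩ {z | δ * ‖z‖ ≤ |z.im|})] fun z => z⁻¹ := by
  refine (hf.mono (inf_le_inf le_rfl (principal_mono.2 Set.inter_subset_left))).trans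
    (Asymptotics.IsBigO.of_bound δ⁻¹ (mem_inf_of_right ?_))
  rintro z ⟨hz, hz'⟩
  have h1 : 0 < |z.im| := abs_pos.2 (mem_offReal.1 hz)
  have h2 : 0 < ‖z‖ := h1.trans_le (Complex.abs_im_le_norm z)
  show ‖(|z.im|)⁻¹‖ ≤ δ⁻¹ * ‖z⁻¹‖
  rw [norm_inv, norm_inv, Real.norm_eq_abs, abs_abs, ← mul_inv]
  exact inv_anti₀ (by positivity) hz'

theorem isBigO_im_of_isBigO_inv {f : ℂ → ℂ}
    (hf : f =O[Bornology.cobounded ℂ ⊓ 𝓟 offReal] fun z => z⁻¹) :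
    f =O[Bornology.cobounded ℂ ⊓ 𝓟 offReal] fun z => (|z.im|)⁻¹ := by
  refine hf.trans (Asymptotics.IsBigO.of_bound 1 (mem_inf_of_right fun z hz => ?_))
  have h1 : 0 < |z.im| := abs_pos.2 (mem_offReal.1 hz)
  show ‖z⁻¹‖ ≤ 1 * ‖(|z.im|)⁻¹‖
  rw [norm_inv, norm_inv, Real.norm_eq_abs, abs_abs, one_mul]
  exact inv_anti₀ h1 (Complex.abs_im_le_norm z)

/-- The rows of `a` have the degrees and the moments of the rows of a solution. -/
structure IsNormalizedRows (w₁ : Fin p → ℝ → ℝ) (w₂ : Fin q → ℝ → ℝ) (n : Fin p → ℕ)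
    (m : Fin q → ℕ) (a : Fin p ⊕ Fin q → Fin p → ℂ[X]) : Prop where
  natDegree_le : ∀ i k, (a i k).natDegree ≤ n k
  degree_sub_lt : ∀ i k, (a i k - if i = Sum.inl k then Polynomial.X ^ n k else 0).degree
    < (n k : WithBot ℕ)
  moments : ∀ i l, ∀ j < m l, formMoment w₁ w₂ (a i) l j
    = if i = Sum.inr l ∧ j = m l - 1 then -(2 * Real.pi * Complex.I) else 0

/-- The error term in the asymptotics of `rhMatrix`. -/
noncomputable def rhError (w₁ : Fin p → ℝ → ℝ) (w₂ : Fin q → ℝ → ℝ) (n : Fin p → ℕ)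
    (m : Fin q → ℕ) (a : Fin p ⊕ Fin q → Fin p → ℂ[X]) (z : ℂ) : BlockMat p q :=
  Matrix.of fun i => Sum.elim
    (fun k => (a i k - if i = Sum.inl k then Polynomial.X ^ n k else 0).eval z * (z ^ n k)⁻¹)
    fun l => (2 * Real.pi * Complex.I)⁻¹ *
      cauchyT (fun x => (x : ℂ) ^ m l * formWeight w₁ w₂ (a i) l x) z

theorem IsNormalizedRows.rhMatrix_eq {a : Fin p ⊕ Fin q → Fin p → ℂ[X]}
    (ha : IsNormalizedRows w₁ w₂ n m a) (h : MomentsIntegrable w₁ w₂ n m) (hm : ∀ l, 0 < m l)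
    {z : ℂ} (hz : z ∈ offReal) :
    rhMatrix w₁ w₂ a z = (1 + rhError w₁ w₂ n m a z) * asympMatrix n m z := by
  have hz0 : z ≠ 0 := by
    rintro rfl
    simp [mem_offReal] at hz
  ext i j
  rcases j with k | l
  · rw [mul_asympMatrix_inl, rhMatrix_inl]
    simp only [Matrix.add_apply, rhError, Matrix.of_apply, Sum.elim_inl, Polynomial.eval_sub,
      Matrix.one_apply, add_mul, inv_mul_cancel_right₀ (pow_ne_zero _ hz0)]
    split_ifs <;> simp
  · rw [mul_asympMatrix_inr, rhMatrix_inr, eq_mul_inv_iff_mul_eq₀ (pow_ne_zero _ hz0)]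
    have h1 := pow_mul_cauchyT (m := m l)
      (fun j hj => h.pow_mul_linForm (ha.natDegree_le i) l hj) hz
    -- Only the last moment can be nonzero, and it comes with `z^0`; divided by `2πi` it supplies
    -- the diagonal entry `1`.
    have h2 : ∑ j ∈ Finset.range (m l), z ^ (m l - 1 - j) *
        ∫ x : ℝ, (x : ℂ) ^ j * (linForm w₁ (a i) x * (w₂ l x : ℂ))
        = if i = Sum.inr l then -(2 * Real.pi * Complex.I) else 0 := by
      have h3 : ∀ j ∈ Finset.range (m l), z ^ (m l - 1 - j) *
          ∫ x : ℝ, (x : ℂ) ^ j * (linForm w₁ (a i) x * (w₂ l x : ℂ))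
          = if j = m l - 1 then (if i = Sum.inr l then -(2 * Real.pi * Complex.I) else 0)
            else 0 := by
        intro j hj
        rw [← formMoment_eq, ha.moments i l j (Finset.mem_range.1 hj)]
        by_cases hj' : j = m l - 1
        · simp [hj']
        · simp [hj']
      rw [Finset.sum_congr rfl h3, Finset.sum_ite_eq', if_pos (Finset.mem_range.2 (by
        have := hm l; omega))]
    rw [h2] at h1
    simp only [Matrix.add_apply, rhError, Matrix.of_apply, Sum.elim_inr, Matrix.one_apply]
    have h4 : cauchyT (fun x => (x : ℂ) ^ m l * formWeight w₁ w₂ (a i) l x) z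
        = z ^ m l * cauchyT (formWeight w₁ w₂ (a i) l) z
          + if i = Sum.inr l then -(2 * Real.pi * Complex.I) else 0 := by
      have e : formWeight w₁ w₂ (a i) l = fun x => linForm w₁ (a i) x * (w₂ l x : ℂ) := rfl
      rw [e]
      linear_combination -h1
    rw [h4]
    split_ifs
    · rw [mul_add, mul_neg, inv_mul_cancel₀ Complex.two_pi_I_ne_zero]
      ring
    · ring

theorem IsNormalizedRows.isRHSolution {a : Fin p ⊕ Fin q → Fin p → ℂ[X]}
    (ha : IsNormalizedRows w₁ w₂ n m a) (h : MomentsIntegrable w₁ w₂ n m) (hm : ∀ l, 0 < m l) :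
    IsRHSolution w₁ w₂ n m (rhMatrix w₁ w₂ a) := by
  have hO : ∀ i j, (fun z => rhError w₁ w₂ n m a z i j)
      =O[Bornology.cobounded ℂ ⊓ 𝓟 offReal] fun z => (|z.im|)⁻¹ := by
    rintro i (k | l)
    · exact isBigO_im_of_isBigO_inv
        ((isBigO_inv_of_degree_lt (ha.degree_sub_lt i k)).mono inf_le_left)
    · refine Asymptotics.IsBigO.const_mul_left ?_ _
      refine Asymptotics.IsBigO.of_bound (∫ x : ℝ, ‖(x : ℂ) ^ m l * formWeight w₁ w₂ (a i) l x‖)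
        (eventually_inf_principal.2 (Eventually.of_forall fun z hz => ?_))
      show ‖cauchyT _ z‖ ≤ _ * ‖(|z.im|)⁻¹‖
      rw [norm_inv, Real.norm_eq_abs, abs_abs]
      exact norm_cauchyT_le (h.pow_mul_linForm (ha.natDegree_le i) l le_rfl) hz
  exact ⟨differentiableOn_rhMatrix h ha.natDegree_le, rhMatrix_jump_ae h ha.natDegree_le,
    rhMatrix_jump_L1 h ha.natDegree_le, rhError w₁ w₂ n m a,
    fun z hz => ha.rhMatrix_eq h hm hz,
    fun δ hδ i j => isBigO_cone_of_isBigO_im hδ (hO i j), hO⟩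

end Existence

/-! ### Uniqueness -/

section Uniqueness

variable {p q : ℕ} {w₁ : Fin p → ℝ → ℝ} {w₂ : Fin q → ℝ → ℝ} {n : Fin p → ℕ} {m : Fin q → ℕ}

/-- The jump relation in the sense of `L¹_loc`. -/
def JumpL1 (w₁ : Fin p → ℝ → ℝ) (w₂ : Fin q → ℝ → ℝ) (Y : ℂ → BlockMat p q) : Prop :=
  ∀ a b : ℝ, ∀ i j, Tendsto (fun ε : ℝ => ∫⁻ x in Set.Icc a b,
      ‖(Y ((x : ℂ) + ε * Complex.I)
        - Y ((x : ℂ) - ε * Complex.I) * jumpMatrix w₁ w₂ x) i j‖ₑ) (𝓝[>] 0) (𝓝 0)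

theorem add_mul_I_mem_offReal (x : ℝ) {ε : ℝ} (hε : 0 < ε) : (x : ℂ) + ε * Complex.I ∈ offReal := by
  simp [mem_offReal, hε.ne']

theorem sub_mul_I_mem_offReal (x : ℝ) {ε : ℝ} (hε : 0 < ε) : (x : ℂ) - ε * Complex.I ∈ offReal := by
  simp [mem_offReal, hε.ne']

theorem aestronglyMeasurable_jump (h : MomentsIntegrable w₁ w₂ n m) {Y : ℂ → BlockMat p q}
    (hY : ∀ i j, DifferentiableOn ℂ (fun z => Y z i j) offReal) {ε : ℝ} (hε : 0 < ε)
    (i j : Fin p ⊕ Fin q) :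
    AEStronglyMeasurable (fun x : ℝ => (Y ((x : ℂ) + ε * Complex.I)
        - Y ((x : ℂ) - ε * Complex.I) * jumpMatrix w₁ w₂ x) i j) volume := by
  have h1 : ∀ i j, AEStronglyMeasurable (fun x : ℝ => Y ((x : ℂ) + ε * Complex.I) i j) volume :=
    fun i j => ((hY i j).continuousOn.comp_continuous (f := fun x : ℝ => (x : ℂ) + ε * Complex.I)
      (by fun_prop) fun x => add_mul_I_mem_offReal x hε).aestronglyMeasurable
  have h2 : ∀ i j, AEStronglyMeasurable (fun x : ℝ => Y ((x : ℂ) - ε * Complex.I) i j) volume :=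
    fun i j => ((hY i j).continuousOn.comp_continuous (f := fun x : ℝ => (x : ℂ) - ε * Complex.I)
      (by fun_prop) fun x => sub_mul_I_mem_offReal x hε).aestronglyMeasurable
  have hw : ∀ k l, AEStronglyMeasurable (fun x : ℝ => (w₁ k x : ℂ) * (w₂ l x : ℂ)) volume := by
    intro k l
    have := ((h k l 0 (Nat.zero_le _)).ofReal (𝕜 := ℂ)).1
    simpa using this
  rcases j with k | l
  · simp only [Matrix.sub_apply, mul_jumpMatrix_inl]
    exact (h1 _ _).sub (h2 _ _)
  · simp only [Matrix.sub_apply, mul_jumpMatrix_inr]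
    exact (h1 _ _).sub ((Finset.aestronglyMeasurable_fun_sum _ fun k _ =>
      (h2 _ _).mul (hw k l)).add (h2 _ _))

/-- The relation is linear in `Y`. Holomorphy of one of the two functions provides the measurability
needed to split the integral. -/
theorem JumpL1.sub (h : MomentsIntegrable w₁ w₂ n m) {Y Y' : ℂ → BlockMat p q}
    (hY : ∀ i j, DifferentiableOn ℂ (fun z => Y z i j) offReal) (hJ' : JumpL1 w₁ w₂ Y')
    (hJ : JumpL1 w₁ w₂ Y) : JumpL1 w₁ w₂ (fun z => Y' z - Y z) := by
  intro a b i j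
  refine tendsto_lintegral_zero_of_le (s := {()}) (G := fun _ (ε : ℝ) (x : ℝ) =>
    ‖(Y ((x : ℂ) + ε * Complex.I) - Y ((x : ℂ) - ε * Complex.I) * jumpMatrix w₁ w₂ x) i j‖ₑ)
    (fun _ _ => ?_) (fun ε x => ?_) (hJ' a b i j) fun _ _ => hJ a b i j
  · filter_upwards [self_mem_nhdsWithin] with ε hε
    exact (aestronglyMeasurable_jump h hY hε i j).restrict.enorm
  · rw [Finset.sum_singleton, sub_mul, sub_sub_sub_comm, Matrix.sub_apply]
    exact enorm_sub_le

theorem NoJump.of_jumpL1_inl {Y : ℂ → BlockMat p q} (hJ : JumpL1 w₁ w₂ Y) (i : Fin p ⊕ Fin q)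
    (k : Fin p) : NoJump fun z => Y z i (Sum.inl k) := by
  intro a b
  simpa only [Matrix.sub_apply, mul_jumpMatrix_inl] using hJ a b i (Sum.inl k)

theorem NoJump.of_jumpL1_inr {Y : ℂ → BlockMat p q} (hJ : JumpL1 w₁ w₂ Y) (i : Fin p ⊕ Fin q)
    (h0 : ∀ k, ∀ z ∈ offReal, Y z i (Sum.inl k) = 0) (l : Fin q) :
    NoJump fun z => Y z i (Sum.inr l) := by
  intro a b
  refine (hJ a b i (Sum.inr l)).congr' ?_
  filter_upwards [self_mem_nhdsWithin] with ε hε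
  refine lintegral_congr fun x => ?_
  rw [Matrix.sub_apply, mul_jumpMatrix_inr,
    Finset.sum_eq_zero fun k _ => by rw [h0 k _ (sub_mul_I_mem_offReal x hε), zero_mul], zero_add]

/-- The argument uses differences instead of `Y' Y⁻¹`: jump relations in `L¹_loc` are stable under
subtraction, while products of functions converging in `L¹` are not controlled. -/
theorem IsRHSolution.eqOn (h : MomentsIntegrable w₁ w₂ n m) (hb : MomentsBijective w₁ w₂ n m)
    {Y Y' : ℂ → BlockMat p q} (hY' : IsRHSolution w₁ w₂ n m Y') (hY : IsRHSolution w₁ w₂ n m Y) :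
    Set.EqOn Y' Y offReal := by
  obtain ⟨E, hE, -, hEO⟩ := hY.asymp
  obtain ⟨E', hE', -, hEO'⟩ := hY'.asymp
  have hD : ∀ i j, DifferentiableOn ℂ (fun z => (Y' z - Y z) i j) offReal := fun i j =>
    (hY'.holo i j).sub (hY.holo i j)
  have hDJ : JumpL1 w₁ w₂ fun z => Y' z - Y z := JumpL1.sub h hY.holo hY'.jump_L1 hY.jump_L1
  have hDE : ∀ z ∈ offReal, Y' z - Y z = (E' z - E z) * asympMatrix n m z := fun z hz => by
    rw [hE z hz, hE' z hz, ← sub_mul, add_sub_add_left_eq_sub]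
  have hO : ∀ i j, (fun z => (E' z - E z) i j)
      =O[Bornology.cobounded ℂ ⊓ 𝓟 offReal] fun z => (|z.im|)⁻¹ := fun i j =>
    (hEO' i j).sub (hEO i j)
  have hmem : ∀ᶠ z in Bornology.cobounded ℂ ⊓ 𝓟 offReal, z ∈ offReal :=
    mem_inf_of_right (mem_principal_self _)
  -- The identity parts cancel in the difference, which lowers the degree below `nₖ`.
  have hA : ∀ i k, ∃ P : ℂ[X], P.degree < (n k : WithBot ℕ) ∧
      ∀ z ∈ offReal, (Y' z - Y z) i (Sum.inl k) = P.eval z := by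
    intro i k
    refine NoJump.eq_polynomial (NoJump.of_jumpL1_inl hDJ i k) (hD _ _) ?_
    have h1 : (fun z : ℂ => (E' z - E z) i (Sum.inl k) * z ^ n k)
        =O[Bornology.cobounded ℂ ⊓ 𝓟 offReal] fun z => ‖z‖ ^ n k * (|z.im|)⁻¹ := by
      simp only [mul_comm (‖_‖ ^ _)]
      refine (hO i (Sum.inl k)).mul (Asymptotics.IsBigO.of_bound 1 (Eventually.of_forall ?_))
      intro z
      simp
    refine h1.congr' ?_ EventuallyEq.rfl
    filter_upwards [hmem] with z hz
    rw [hDE z hz, mul_asympMatrix_inl]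
  choose a ha hDa using hA
  have han : ∀ i k, (a i k).natDegree ≤ n k := fun i k => natDegree_le_of_degree_lt (ha i k)
  have hMd := differentiableOn_rhMatrix (w₁ := w₁) (w₂ := w₂) h han
  -- The first `p` columns are now zero, so multiplication by the jump matrix no longer affects the
  -- remaining columns.
  have hHJ : JumpL1 w₁ w₂ fun z => (Y' z - Y z) - rhMatrix w₁ w₂ a z :=
    JumpL1.sub h hMd hDJ (rhMatrix_jump_L1 h han)
  have hcol : ∀ i l, ∀ z ∈ offReal, (Y' z - Y z) i (Sum.inr l)
      = rhMatrix w₁ w₂ a z i (Sum.inr l) := by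
    intro i l
    have hN := NoJump.of_jumpL1_inr hHJ i
      (fun k z hz => by rw [Matrix.sub_apply, hDa i k z hz, rhMatrix_inl, sub_self]) l
    have h1 : (fun z => (Y' z - Y z) i (Sum.inr l))
        =O[Bornology.cobounded ℂ ⊓ 𝓟 offReal] fun z => (|z.im|)⁻¹ := by
      refine (Asymptotics.IsBigO.of_bound 1 ?_).trans (hO i (Sum.inr l))
      filter_upwards [hmem, mem_inf_of_left
        (tendsto_norm_cobounded_atTop.eventually_ge_atTop 1)] with z hz hz1
      rw [hDE z hz, mul_asympMatrix_inr, norm_mul, norm_inv, norm_pow, mul_comm]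
      gcongr
      exact inv_le_one_of_one_le₀ (one_le_pow₀ hz1)
    have h2 : (fun z => rhMatrix w₁ w₂ a z i (Sum.inr l))
        =O[Bornology.cobounded ℂ ⊓ 𝓟 offReal] fun z => (|z.im|)⁻¹ := by
      refine Asymptotics.IsBigO.const_mul_left (Asymptotics.IsBigO.of_bound
        (∫ x : ℝ, ‖formWeight w₁ w₂ (a i) l x‖)
        (eventually_inf_principal.2 (Eventually.of_forall fun z hz => ?_))) _
      rw [norm_inv, Real.norm_eq_abs, abs_abs]
      exact norm_cauchyT_le (h.formWeight (han i) l) hz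
    -- Growth exponent `0` gives a polynomial of degree `< 0`, that is, zero.
    obtain ⟨P, hP, hHP⟩ := hN.eq_polynomial (n := 0) ((hD _ _).sub (hMd _ _)) (by
      simpa using h1.sub h2)
    have hP0 : P = 0 := by
      rw [← Polynomial.degree_eq_bot]
      exact Nat.WithBot.lt_zero_iff.1 hP
    intro z hz
    have := hHP z hz
    rw [hP0, Polynomial.eval_zero, Matrix.sub_apply] at this
    exact sub_eq_zero.1 this
  have ha0 : ∀ i, a i = 0 := by
    intro i
    refine hb.eq_zero (a i) (ha i) fun l => ?_
    simp only [formMoment_eq]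
    obtain ⟨C, hC⟩ := (hO i (Sum.inr l)).bound
    -- On the imaginary axis `|Im z| = |z|`, so the weak error bound yields the full decay
    -- `y^(-mₗ-1)` that annihilates the moments.
    have hax : Tendsto (fun y : ℝ => (y : ℂ) * Complex.I) atTop
        (Bornology.cobounded ℂ ⊓ 𝓟 offReal) := by
      refine tendsto_inf.2 ⟨?_, tendsto_principal.2 ?_⟩
      · rw [← tendsto_norm_atTop_iff_cobounded]
        simpa using tendsto_abs_atTop_atTop
      · filter_upwards [eventually_gt_atTop 0] with y hy
        simpa using add_mul_I_mem_offReal 0 hy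
    refine integral_pow_mul_eq_zero (m := m l)
      (C := ‖(2 * Real.pi * Complex.I : ℂ)‖ * C)
      (fun j hj => h.pow_mul_linForm (han i) l hj.le) ?_
    filter_upwards [hax.eventually hC, hax.eventually hmem, eventually_gt_atTop 0] with y h1 h2 hy
    have h3 := hcol i l _ h2
    rw [hDE _ h2, mul_asympMatrix_inr, rhMatrix_inr] at h3
    have h4 : cauchyT (formWeight w₁ w₂ (a i) l) ((y : ℂ) * Complex.I)
        = 2 * Real.pi * Complex.I * ((E' (y * Complex.I) - E (y * Complex.I)) i (Sum.inr l)
          * (((y : ℂ) * Complex.I) ^ m l)⁻¹) := by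
      rw [h3, mul_inv_cancel_left₀ Complex.two_pi_I_ne_zero]
    have h5 : ‖((((y : ℂ) * Complex.I) ^ m l)⁻¹)‖ = y⁻¹ ^ m l := by
      simp [abs_of_pos hy]
    have h6 : ‖(|((y : ℂ) * Complex.I).im|)⁻¹‖ = y⁻¹ := by
      simp [abs_of_pos hy]
    rw [h6] at h1
    change ‖cauchyT (formWeight w₁ w₂ (a i) l) ((y : ℂ) * Complex.I)‖ ≤ _
    rw [h4, norm_mul (2 * Real.pi * Complex.I : ℂ), norm_mul ((E' _ - E _) _ _), h5]
    calc _ ≤ ‖(2 * Real.pi * Complex.I : ℂ)‖ * (C * y⁻¹ * y⁻¹ ^ m l) := by gcongr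
      _ = _ := by ring
  intro z hz
  rw [← sub_eq_zero]
  ext i j
  rcases j with k | l
  · rw [hDa i k z hz, ha0 i]
    simp
  · rw [hcol i l z hz, rhMatrix_inr, ha0 i]
    simp [cauchyT, formWeight, linForm]

end Uniqueness

/-! ### Solutions in the classical sense -/

section Classical

variable {p q : ℕ} {w₁ : Fin p → ℝ → ℝ} {w₂ : Fin q → ℝ → ℝ} {n : Fin p → ℕ} {m : Fin q → ℕ}

theorem tendsto_add_mul_I_nhdsWithin (x : ℝ) :
    Tendsto (fun ε : ℝ => (x : ℂ) + ε * Complex.I) (𝓝[>] 0) (𝓝[{z : ℂ | 0 < z.im}] (x : ℂ)) := by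
  refine tendsto_nhdsWithin_iff.2 ⟨by simpa using tendsto_add_mul_I x 1, ?_⟩
  filter_upwards [self_mem_nhdsWithin] with ε hε
  simpa using hε

theorem tendsto_sub_mul_I_nhdsWithin (x : ℝ) :
    Tendsto (fun ε : ℝ => (x : ℂ) - ε * Complex.I) (𝓝[>] 0) (𝓝[{z : ℂ | z.im < 0}] (x : ℂ)) := by
  refine tendsto_nhdsWithin_iff.2
    ⟨by simpa [← sub_eq_add_neg] using tendsto_add_mul_I x (-1), ?_⟩
  filter_upwards [self_mem_nhdsWithin] with ε hε
  simpa using hε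

/-- A function on a half plane with limits at all real points is bounded near real segments. -/
theorem exists_norm_le_of_tendsto_real {A : Set ℂ} {f : ℂ → ℂ} {c : ℝ}
    (hA : ∀ x ε : ℝ, 0 < ε → (x : ℂ) + c * ε * Complex.I ∈ A) (hf : ContinuousOn f A)
    (hl : ∀ x : ℝ, ∃ L, Tendsto f (𝓝[A] (x : ℂ)) (𝓝 L)) (a b : ℝ) :
    ∃ C, ∀ x ∈ Set.Icc a b, ∀ ε ∈ Set.Ioc (0 : ℝ) 1, ‖f ((x : ℂ) + c * ε * Complex.I)‖ ≤ C := by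
  have hcl : A ∪ Set.range ((↑) : ℝ → ℂ) ⊆ closure A := by
    refine Set.union_subset subset_closure ?_
    rintro _ ⟨x, rfl⟩
    refine mem_closure_of_tendsto (tendsto_add_mul_I x c) ?_
    filter_upwards [self_mem_nhdsWithin] with ε hε using hA x ε hε
  have hc : ContinuousOn (extendFrom A f) (A ∪ Set.range ((↑) : ℝ → ℂ)) := by
    refine continuousOn_extendFrom hcl ?_
    rintro z (hz | ⟨x, rfl⟩)
    · exact ⟨f z, hf z hz⟩
    · exact hl x
  have hK : IsCompact ((fun t : ℝ × ℝ => (t.1 : ℂ) + c * t.2 * Complex.I) ''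
      (Set.Icc a b ×ˢ Set.Icc 0 1)) :=
    (isCompact_Icc.prod isCompact_Icc).image (by fun_prop)
  obtain ⟨C, hC⟩ := hK.exists_bound_of_continuousOn (hc.mono (by
    rintro _ ⟨⟨x, ε⟩, ⟨-, hε⟩, rfl⟩
    rcases hε.1.eq_or_lt with h0 | h0
    · right
      have h0' : ε = 0 := h0.symm
      exact ⟨x, by simp [h0']⟩
    · exact Or.inl (hA x ε h0)))
  refine ⟨C, fun x hx ε hε => ?_⟩
  rw [← extendFrom_extends hf _ (hA x ε hε.1)]
  exact hC _ ⟨(x, ε), ⟨hx, hε.1.le, hε.2⟩, rfl⟩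

/-- Limits at every real point extend `Y` continuously from each side, hence it is bounded near
segments. Dominated convergence applies with a majorant built from constants and the `|w₁ₖ w₂ₗ|`. -/
theorem IsClassicalRHSolution.jumpL1 (h : MomentsIntegrable w₁ w₂ n m) {Y : ℂ → BlockMat p q}
    (hY : IsClassicalRHSolution w₁ w₂ n m Y) : JumpL1 w₁ w₂ Y := by
  intro a b i j
  choose Yp Ym hp hm hpm using hY.jump
  have hbp : ∀ i j, ∃ C, ∀ x ∈ Set.Icc a b, ∀ ε ∈ Set.Ioc (0 : ℝ) 1,
      ‖Y ((x : ℂ) + ε * Complex.I) i j‖ ≤ C := by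
    intro i j
    simpa using exists_norm_le_of_tendsto_real (A := {z : ℂ | 0 < z.im}) (c := 1)
      (f := fun z => Y z i j) (fun x ε hε => by simpa using hε)
      ((hY.holo i j).continuousOn.mono fun z hz => mem_offReal.2 (ne_of_gt hz))
      (fun x => ⟨_, tendsto_pi_nhds.1 (tendsto_pi_nhds.1 (hp x) i) j⟩) a b
  have hbm : ∀ i j, ∃ C, ∀ x ∈ Set.Icc a b, ∀ ε ∈ Set.Ioc (0 : ℝ) 1,
      ‖Y ((x : ℂ) - ε * Complex.I) i j‖ ≤ C := by
    intro i j
    simpa [← sub_eq_add_neg] using exists_norm_le_of_tendsto_real (A := {z : ℂ | z.im < 0})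
      (c := -1) (f := fun z => Y z i j) (fun x ε hε => by simpa using hε)
      ((hY.holo i j).continuousOn.mono fun z hz => mem_offReal.2 (ne_of_lt hz))
      (fun x => ⟨_, tendsto_pi_nhds.1 (tendsto_pi_nhds.1 (hm x) i) j⟩) a b
  choose Cp hCp using hbp
  choose Cm hCm using hbm
  obtain ⟨g, hg, hbound⟩ : ∃ g : ℝ → ℝ, IntegrableOn g (Set.Icc a b) ∧
      ∀ ε ∈ Set.Ioc (0 : ℝ) 1, ∀ x ∈ Set.Icc a b, ‖(Y ((x : ℂ) + ε * Complex.I)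
        - Y ((x : ℂ) - ε * Complex.I) * jumpMatrix w₁ w₂ x) i j‖ ≤ g x := by
    rcases j with k | l
    · refine ⟨fun _ => Cp i (Sum.inl k) + Cm i (Sum.inl k), continuousOn_const.integrableOn_Icc,
        fun ε hε x hx => ?_⟩
      rw [Matrix.sub_apply, mul_jumpMatrix_inl]
      exact (norm_sub_le _ _).trans (add_le_add (hCp _ _ x hx ε hε) (hCm _ _ x hx ε hε))
    · refine ⟨fun x => Cp i (Sum.inr l) + (∑ k, Cm i (Sum.inl k) * ‖w₁ k x * w₂ l x‖
        + Cm i (Sum.inr l)), ?_, fun ε hε x hx => ?_⟩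
      · refine (continuousOn_const.integrableOn_Icc).add
          (Integrable.add (integrable_finsetSum _ fun k _ => Integrable.const_mul ?_ _)
            continuousOn_const.integrableOn_Icc)
        have := (h k l 0 (Nat.zero_le _)).norm
        simp only [pow_zero, one_mul] at this
        exact this.integrableOn
      · rw [Matrix.sub_apply, mul_jumpMatrix_inr]
        refine (norm_sub_le _ _).trans (add_le_add (hCp _ _ x hx ε hε)
          ((norm_add_le _ _).trans (add_le_add ?_ (hCm _ _ x hx ε hε))))
        refine (norm_sum_le _ _).trans (Finset.sum_le_sum fun k _ => ?_)
        rw [norm_mul, ← Complex.ofReal_mul, Complex.norm_real]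
        exact mul_le_mul_of_nonneg_right (hCm _ _ x hx ε hε) (norm_nonneg _)
  have key := tendsto_lintegral_filter_of_dominated_convergence' (l := 𝓝[>] (0 : ℝ))
    (μ := volume.restrict (Set.Icc a b)) (F := fun (ε : ℝ) (x : ℝ) =>
      ‖(Y ((x : ℂ) + ε * Complex.I)
        - Y ((x : ℂ) - ε * Complex.I) * jumpMatrix w₁ w₂ x) i j‖ₑ) (f := fun _ => 0)
    (fun x => ‖g x‖ₑ) ?_ ?_ hg.2.ne ?_
  · simpa using key
  · filter_upwards [self_mem_nhdsWithin] with ε hε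
    exact (aestronglyMeasurable_jump h hY.holo hε i j).restrict.enorm
  · filter_upwards [Ioc_mem_nhdsGT (zero_lt_one' ℝ)] with ε hε
    filter_upwards [ae_restrict_mem measurableSet_Icc] with x hx
    exact enorm_le_iff_norm_le.2 ((hbound ε hε x hx).trans (le_abs_self _))
  · refine Eventually.of_forall fun x => ?_
    have h1 := (((hp x).comp (tendsto_add_mul_I_nhdsWithin x)).sub
      (((hm x).comp (tendsto_sub_mul_I_nhdsWithin x)).mul_const (jumpMatrix w₁ w₂ x)))
    rw [hpm x, sub_self] at h1
    have h2 := (tendsto_pi_nhds.1 (tendsto_pi_nhds.1 h1 i) j).enorm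
    simpa using h2

theorem IsClassicalRHSolution.isRHSolution (h : MomentsIntegrable w₁ w₂ n m)
    {Y : ℂ → BlockMat p q} (hY : IsClassicalRHSolution w₁ w₂ n m Y) :
    IsRHSolution w₁ w₂ n m Y := by
  obtain ⟨E, hE, hO⟩ := hY.asymp
  refine ⟨hY.holo, Eventually.of_forall fun x => ?_, hY.jumpL1 h, E, hE, fun δ hδ i j => ?_,
    fun i j => isBigO_im_of_isBigO_inv (hO i j)⟩
  · obtain ⟨Yp, Ym, hp, hm, hpm⟩ := hY.jump x
    exact ⟨Yp, Ym, hp.comp (tendsto_add_mul_I_nhdsWithin x),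
      hm.comp (tendsto_sub_mul_I_nhdsWithin x), hpm⟩
  · exact (hO i j).mono (inf_le_inf le_rfl (principal_mono.2 Set.inter_subset_left))

/-- The Cauchy transform of `f` is bounded and has limits at all real points. -/
structure HasRegularCauchyT (f : ℝ → ℂ) : Prop where
  integrable : Integrable f
  bound : ∃ B, ∀ z ∈ offReal, ‖cauchyT f z‖ ≤ B
  tendsto : ∀ x : ℝ, ∃ L,
    Tendsto (cauchyT f) (𝓝[{z : ℂ | 0 < z.im}] (x : ℂ)) (𝓝 (L + Real.pi * Complex.I * f x)) ∧
    Tendsto (cauchyT f) (𝓝[{z : ℂ | z.im < 0}] (x : ℂ)) (𝓝 (L - Real.pi * Complex.I * f x))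

theorem HasRegularCauchyT.const_mul {f : ℝ → ℂ} (hf : HasRegularCauchyT f) (c : ℂ) :
    HasRegularCauchyT fun x => c * f x := by
  refine ⟨hf.integrable.const_mul c, ?_, fun x => ?_⟩
  · obtain ⟨B, hB⟩ := hf.bound
    refine ⟨‖c‖ * B, fun z hz => ?_⟩
    rw [cauchyT_const_mul, norm_mul]
    exact mul_le_mul_of_nonneg_left (hB z hz) (norm_nonneg c)
  · obtain ⟨L, h1, h2⟩ := hf.tendsto x
    have e : cauchyT (fun x => c * f x) = fun z => c * cauchyT f z :=
      funext fun z => cauchyT_const_mul c f z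
    refine ⟨c * L, ?_, ?_⟩
    · rw [e]
      convert h1.const_mul c using 2
      ring
    · rw [e]
      convert h2.const_mul c using 2
      ring

theorem HasRegularCauchyT.sum {ι : Type*} {s : Finset ι} {f : ι → ℝ → ℂ}
    (hf : ∀ i ∈ s, HasRegularCauchyT (f i)) : HasRegularCauchyT fun x => ∑ i ∈ s, f i x := by
  have e : ∀ z ∈ offReal, cauchyT (fun x => ∑ i ∈ s, f i x) z = ∑ i ∈ s, cauchyT (f i) z :=
    fun z hz => cauchyT_sum s (fun i hi => (hf i hi).integrable) hz
  refine ⟨integrable_finsetSum _ fun i hi => (hf i hi).integrable, ?_, fun x => ?_⟩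
  -- The membership guard makes the choice total in `i`; the value `0` outside `s` is irrelevant.
  · have hb : ∀ i, ∃ B, i ∈ s → ∀ z ∈ offReal, ‖cauchyT (f i) z‖ ≤ B := fun i => by
      by_cases hi : i ∈ s
      · obtain ⟨B, hB⟩ := (hf i hi).bound
        exact ⟨B, fun _ => hB⟩
      · exact ⟨0, fun h => absurd h hi⟩
    choose B hB using hb
    refine ⟨∑ i ∈ s, B i, fun z hz => ?_⟩
    rw [e z hz]
    exact (norm_sum_le _ _).trans (Finset.sum_le_sum fun i hi => hB i hi z hz)
  · have hL : ∀ i, ∃ L, i ∈ s →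
      Tendsto (cauchyT (f i)) (𝓝[{z : ℂ | 0 < z.im}] (x : ℂ))
        (𝓝 (L + Real.pi * Complex.I * f i x)) ∧
      Tendsto (cauchyT (f i)) (𝓝[{z : ℂ | z.im < 0}] (x : ℂ))
        (𝓝 (L - Real.pi * Complex.I * f i x)) := fun i => by
      by_cases hi : i ∈ s
      · obtain ⟨L, hL⟩ := (hf i hi).tendsto x
        exact ⟨L, fun _ => hL⟩
      · exact ⟨0, fun h => absurd h hi⟩
    choose L hL using hL
    refine ⟨∑ i ∈ s, L i, ?_, ?_⟩
    · rw [Finset.mul_sum, ← Finset.sum_add_distrib]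
      refine (tendsto_finsetSum s fun i hi => (hL i hi).1).congr' ?_
      filter_upwards [self_mem_nhdsWithin] with z hz
      exact (e z (mem_offReal.2 (ne_of_gt hz))).symm
    · rw [Finset.mul_sum, ← Finset.sum_sub_distrib]
      refine (tendsto_finsetSum s fun i hi => (hL i hi).2).congr' ?_
      filter_upwards [self_mem_nhdsWithin] with z hz
      exact (e z (mem_offReal.2 (ne_of_lt hz))).symm

theorem IsHolder.hasRegularCauchyT {g : ℝ → ℂ} {C α : ℝ} (hg : IsHolder g C α)
    (hi : Integrable g) : HasRegularCauchyT g :=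
  ⟨hi, hg.exists_norm_cauchyT_le hi, hg.tendsto_cauchyT hi⟩

theorem HolderWith.isHolder_ofReal {g : ℝ → ℝ} {C α : ℝ≥0} (hα : 0 < α) (hg : HolderWith C α g) :
    IsHolder (fun x => (g x : ℂ)) C α := by
  refine ⟨hα, fun s t => ?_⟩
  have := hg.dist_le s t
  rwa [Real.dist_eq, Real.dist_eq, ← Real.norm_eq_abs, ← Complex.norm_real,
    Complex.ofReal_sub] at this

/-- A coefficient index up to `nₖ` and a power up to `mₗ + 1` use the regularity assumption to its
last exponent. -/
theorem IsRegularJump.hasRegularCauchyT (hR : IsRegularJump w₁ w₂ n m) {A : Fin p → ℂ[X]}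
    (hA : ∀ k, (A k).natDegree ≤ n k) (l : Fin q) {j : ℕ} (hj : j ≤ m l + 1) :
    HasRegularCauchyT fun x => (x : ℂ) ^ j * formWeight w₁ w₂ A l x := by
  simp only [formWeight, pow_mul_linForm_eq_sum]
  refine HasRegularCauchyT.sum fun k _ => HasRegularCauchyT.sum fun i hi => ?_
  have h1 := Finset.mem_range.1 hi
  have h2 := hA k
  obtain ⟨h3, C, α, hα, h4⟩ := hR k l (i + j) (by omega)
  exact ((h4.isHolder_ofReal hα).hasRegularCauchyT h3.ofReal).const_mul _

/-- Multiplying by `z` gives the Cauchy transform of `x f` minus a constant, which is bounded up to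
the real axis. This is the purpose of the extra power of `x`. -/
theorem HasRegularCauchyT.isBigO_inv {f : ℝ → ℂ} (hf : Integrable f)
    (h : HasRegularCauchyT fun x => (x : ℂ) * f x) :
    cauchyT f =O[Bornology.cobounded ℂ ⊓ 𝓟 offReal] fun z => z⁻¹ := by
  obtain ⟨B, hB⟩ := h.bound
  refine Asymptotics.IsBigO.of_bound (B + ‖∫ x : ℝ, f x‖)
    (eventually_inf_principal.2 (Eventually.of_forall fun z hz => ?_))
  have hz0 : z ≠ 0 := by
    rintro rfl
    simp [mem_offReal] at hz
  rw [norm_inv, ← div_eq_mul_inv, le_div_iff₀ (norm_pos_iff.2 hz0), mul_comm, ← norm_mul,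
    mul_cauchyT hf h.integrable hz]
  exact (norm_sub_le _ _).trans (add_le_add_left (hB z hz) _)

theorem IsNormalizedRows.isClassicalRHSolution {a : Fin p ⊕ Fin q → Fin p → ℂ[X]}
    (ha : IsNormalizedRows w₁ w₂ n m a) (h : MomentsIntegrable w₁ w₂ n m) (hm : ∀ l, 0 < m l)
    (hR : IsRegularJump w₁ w₂ n m) :
    IsClassicalRHSolution w₁ w₂ n m (rhMatrix w₁ w₂ a) := by
  refine ⟨differentiableOn_rhMatrix h ha.natDegree_le, fun x => ?_, rhError w₁ w₂ n m a,
    fun z hz => ha.rhMatrix_eq h hm hz, ?_⟩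
  · have hf : ∀ i l, HasRegularCauchyT (formWeight w₁ w₂ (a i) l) := fun i l => by
      simpa using hR.hasRegularCauchyT (ha.natDegree_le i) l (Nat.zero_le _)
    choose L hLp hLm using fun i l => (hf i l).tendsto x
    refine ⟨Matrix.of fun i => Sum.elim (fun k => (a i k).eval (x : ℂ))
        fun l => (2 * Real.pi * Complex.I)⁻¹ *
          (L i l + Real.pi * Complex.I * formWeight w₁ w₂ (a i) l x),
      Matrix.of fun i => Sum.elim (fun k => (a i k).eval (x : ℂ))
        fun l => (2 * Real.pi * Complex.I)⁻¹ *
          (L i l - Real.pi * Complex.I * formWeight w₁ w₂ (a i) l x), ?_, ?_, ?_⟩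
    · refine tendsto_pi_nhds.2 fun i => tendsto_pi_nhds.2 fun j => ?_
      rcases j with k | l
      · exact ((a i k).continuous.tendsto (x : ℂ)).mono_left nhdsWithin_le_nhds
      · exact (hLp i l).const_mul _
    · refine tendsto_pi_nhds.2 fun i => tendsto_pi_nhds.2 fun j => ?_
      rcases j with k | l
      · exact ((a i k).continuous.tendsto (x : ℂ)).mono_left nhdsWithin_le_nhds
      · exact (hLm i l).const_mul _
    · ext i j
      rcases j with k | l
      · rw [mul_jumpMatrix_inl]
        rfl
      · rw [mul_jumpMatrix_inr]
        simp only [Matrix.of_apply, Sum.elim_inl, Sum.elim_inr, ← formWeight_eq_sum]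
        have := inv_mul_cancel_left₀ Complex.two_pi_I_ne_zero (formWeight w₁ w₂ (a i) l x)
        linear_combination this
  · rintro i (k | l)
    · exact (isBigO_inv_of_degree_lt (ha.degree_sub_lt i k)).mono inf_le_left
    · refine Asymptotics.IsBigO.const_mul_left (HasRegularCauchyT.isBigO_inv
        (h.pow_mul_linForm (ha.natDegree_le i) l le_rfl) ?_) _
      have := hR.hasRegularCauchyT (ha.natDegree_le i) l (le_refl (m l + 1))
      simp only [pow_succ', mul_assoc] at this
      exact this

end Classical

/-! ### The rows of the solution and the main theorem -/

theorem isNormalizedRows_of_typeII_typeI {p q : ℕ} {w₁ : Fin p → ℝ → ℝ} {w₂ : Fin q → ℝ → ℝ}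
    {n : Fin p → ℕ} {m : Fin q → ℕ} {AII : Fin p → Fin p → ℂ[X]} {AI : Fin q → Fin p → ℂ[X]}
    (hII : ∀ k, IsTypeII w₁ w₂ (n + Pi.single k 1) m k (AII k))
    (hI : ∀ k, IsTypeI w₁ w₂ n (m - Pi.single k 1) k (AI k)) :
    IsNormalizedRows w₁ w₂ n m
      (Sum.elim AII fun k => (-(2 * Real.pi * Complex.I) : ℂ) • AI k) := by
  refine ⟨?_, ?_, ?_⟩
  · rintro (i | i) k
    · exact (hII i).1.natDegree_le k
    · exact (Polynomial.natDegree_smul_le _ _).trans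
        (natDegree_le_of_degree_lt ((hI i).1.deg k))
  · rintro (i | i) k
    · rw [Sum.elim_inl]
      rcases eq_or_ne i k with rfl | hik
      · rw [if_pos rfl]
        have h1 : (AII i i).degree = n i := by
          rw [Polynomial.degree_eq_natDegree (hII i).2.1.ne_zero, (hII i).natDegree_eq]
        rw [← h1]
        refine Polynomial.degree_sub_lt_left ?_ (hII i).2.1.ne_zero ?_
        · rw [h1, Polynomial.degree_X_pow]
        · rw [(hII i).2.1.leadingCoeff, (Polynomial.monic_X_pow _).leadingCoeff]
      · rw [if_neg fun h => hik (Sum.inl_injective h), sub_zero]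
        have h1 := (hII i).1.deg k
        rwa [Pi.add_apply, Pi.single_eq_of_ne hik.symm, add_zero] at h1
    · rw [if_neg Sum.inr_ne_inl, sub_zero]
      exact (Polynomial.degree_smul_le _ _).trans_lt ((hI i).1.deg k)
  · rintro (i | i) l j hj
    · rw [if_neg fun h => Sum.inl_ne_inr h.1]
      exact (hII i).1.orth l j hj
    · rw [Sum.elim_inr, formMoment_smul, (hI i).formMoment_eq hj]
      by_cases hil : l = i
      · subst hil
        by_cases hj' : j = m l - 1 <;> simp [hj']
      · have hli : i ≠ l := fun h => hil h.symm
        simp [hil, hli]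

theorem theorem3p1 {p q : ℕ} (w₁ : Fin p → ℝ → ℝ) (w₂ : Fin q → ℝ → ℝ)
    (n : Fin p → ℕ) (m : Fin q → ℕ)
    (hw₁ : ∀ k, IsWeight (w₁ k)) (hw₂ : ∀ l, IsWeight (w₂ l))
    (hn : ∀ k, 0 < n k) (hm : ∀ l, 0 < m l)
    (hnm : ∑ k, n k = ∑ l, m l)
    (hF : ∀ k, ∀ j < n k, MemLp (fun x : ℝ => x ^ j * w₁ k x) 2)
    (hG : ∀ l, ∀ j < m l, MemLp (fun x : ℝ => x ^ j * w₂ l x) 2)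
    (hW : ∀ k l, Integrable (fun x : ℝ => x ^ (n k + m l) * (w₁ k x * w₂ l x)))
    (hdim : Module.finrank ℂ (formSpace w₁ n) = ∑ k, n k)
    (hFG : formSpace w₁ n ⊓ (formSpace w₂ m)ᗮ = ⊥) :
    (∀ k, IsNormalPair w₁ w₂ (n + Pi.single k 1) m) ∧
    (∀ k, IsNormalPair w₁ w₂ n (m - Pi.single k 1)) ∧
    ∃ (AII : Fin p → Fin p → ℂ[X]) (AI : Fin q → Fin p → ℂ[X]),
      (∀ k, IsTypeII w₁ w₂ (n + Pi.single k 1) m k (AII k) ∧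
        ∀ A, IsTypeII w₁ w₂ (n + Pi.single k 1) m k A → A = AII k) ∧
      (∀ k, IsTypeI w₁ w₂ n (m - Pi.single k 1) k (AI k) ∧
        ∀ A, IsTypeI w₁ w₂ n (m - Pi.single k 1) k A → A = AI k) ∧
      ∃ Y : ℂ → BlockMat p q,
        IsRHSolution w₁ w₂ n m Y ∧
        (∀ Y', IsRHSolution w₁ w₂ n m Y' → Set.EqOn Y' Y offReal) ∧
        (IsRegularJump w₁ w₂ n m → IsClassicalRHSolution w₁ w₂ n m Y ∧
          ∀ Y', IsClassicalRHSolution w₁ w₂ n m Y' → Set.EqOn Y' Y offReal) ∧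
        ∀ z ∈ offReal,
          (∀ k l : Fin p, Y z (Sum.inl k) (Sum.inl l) = (AII k l).eval z) ∧
          (∀ (k : Fin q) (l : Fin p), Y z (Sum.inr k) (Sum.inl l)
            = -2 * Real.pi * Complex.I * (AI k l).eval z) ∧
          (∀ (k : Fin p) (l : Fin q), Y z (Sum.inl k) (Sum.inr l)
            = 1 / (2 * Real.pi * Complex.I) *
              ∫ x : ℝ, linForm w₁ (AII k) x * (w₂ l x : ℂ) / ((x : ℂ) - z)) ∧
          (∀ k l : Fin q, Y z (Sum.inr k) (Sum.inr l)
            = -∫ x : ℝ, linForm w₁ (AI k) x * (w₂ l x : ℂ) / ((x : ℂ) - z)) := by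
  have h := momentsIntegrable hn hm hF hG hW
  have hb := momentsBijective h hnm hF hdim hFG
  choose AII hII using hb.exists_typeII h
  choose AI hI using hb.exists_typeI hm
  have ha := isNormalizedRows_of_typeII_typeI hII hI
  have hY := ha.isRHSolution h hm
  refine ⟨hb.isNormalPair_add h hnm, hb.isNormalPair_sub h hm hnm, AII, AI,
    fun k => ⟨hII k, fun A hA => hb.typeII_unique h (hII k) hA⟩,
    fun k => ⟨hI k, fun A hA => hb.typeI_unique h (hI k) hA⟩, _, hY,
    fun Y' hY' => hY'.eqOn h hb hY,
    -- Uniqueness in the classical sense is inherited from the general one.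
    fun hR => ⟨ha.isClassicalRHSolution h hm hR, fun Y' hY' => (hY'.isRHSolution h).eqOn h hb hY⟩,
    fun z _ => ⟨fun k l => rfl, fun k l => ?_, fun k l => ?_, fun k l => ?_⟩⟩
  · rw [rhMatrix_inl]
    simp
  · rw [rhMatrix_inr, one_div]
    rfl
  · rw [rhMatrix_inr]
    have e : formWeight w₁ w₂ (Sum.elim AII (fun k => (-(2 * Real.pi * Complex.I) : ℂ) • AI k)
        (Sum.inr k)) l = fun x => -(2 * Real.pi * Complex.I) * formWeight w₁ w₂ (AI k) l x := by
      funext x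
      rw [formWeight, Sum.elim_inr, linForm_smul, mul_assoc]
      rfl
    rw [e, cauchyT_const_mul, neg_mul, mul_neg, inv_mul_cancel_left₀ Complex.two_pi_I_ne_zero]
    rfl
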